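/- Let $\mathcal T_t$ be a quantum Markov process on $\mathcal B(\mathbb C^N)$: either a quantum Markov chain $\mathcal T_t=\mathcal T^t$, $t\in\mathbb N_0$, with $\mathcal T$ a quantum channel (completely positive and trace preserving), or a quantum dynamical semigroup $\mathcal T_t=e^{t\mathcal L}$, $t\ge 0$, with $\mathcal L$ a Lindbladian (all $\mathcal T_t$ are quantum channels). Definitions. The attractor space $\mathsf{Atr}(\mathcal T)$ is the span of the eigenoperators of $\mathcal T$ with eigenvalues $|\lambda|=1$ (respectively of $\mathcal L$ with eigenvalues $\operatorname{Re}a=0$, in which case $\lambda^t:=e^{at}$); $\mathsf{Atr}(\mathcal T^\dagger)$ is defined in the same way from the Hilbert–Schmidt adjoint. Given a basis $X_{\lambda,j}$ of eigenoperators of $\mathsf{Atr}(\mathcal T)$ with dual basis $X^{\lambda,j}$ in $\mathsf{Atr}(\mathcal T^\dagger)$, the asymptotic trajectory of a state $\rho(0)$ is $\rho_{as}(t)=\sum_{\lambda,j}\lambda^tX_{\lambda,j}\operatorname{Tr}[X^{\lambda,j\dagger}\rho(0)]$. The T-projector $P$ is the orthogonal projection onto the support of an invariant state of maximal support; a T-trajectory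 is an asymptotic trajectory of a state, all of whose states have support $P\mathbb C^N$. A constant of motion is a family $C(t)=C(t)^\dagger\in\mathsf{Atr}(\mathcal T^\dagger)$ with $\operatorname{Tr}[C(t+s)\mathcal T_t\rho]=\operatorname{Tr}[C(s)\rho]$ for all states $\rho$ and all times $s,t$; these form a real vector space. The relative entropy is $S(\rho|\sigma)=\operatorname{Tr}[\rho(\ln\rho-\ln\sigma)]$ if $\operatorname{supp}\rho\subseteq\operatorname{supp}\sigma$ and $+\infty$ otherwise, where $\ln$ of a positive operator is zero on its kernel. Theorem. Let $\sigma(t)$ be a T-trajectory, $P$ the T-projector, and $\{I,C_1(t),\dots,C_d(t)\}$ a basis of the constants of motion. For $\gamma\in\mathbb R^d$ let $G_\gamma(t)=\exp[\ln\sigma(t)-\sum_j\gamma_jPC_j(t)P]$, the exponential being taken on $P\mathbb C^N$ and extended by zero to the orthogonal complement. Then $\mathcal Z(\gamma)=\operatorname{Tr}G_\gamma(t)>0$ does not depend on $t$, and there is a map $\Gamma:\mathbb R^d\to\mathbb R^d$ such that the following holds for every initial state $\rho(0)$ with (time-independent) expectation values $c_j=\operatorname{Tr}[C_j(t)\,\mathcal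 T_t\rho(0)]$ and asymptotic trajectory $\rho_{as}(t)$. 1. $\mathcal T_t\rho(0)-\rho_{as}(t)\to0$ as $t\to\infty$, and for every time $t$ the state $\rho_{as}(t)$ is the unique minimizer of $S(\rho|\sigma(t))$ among all states $\rho$ with $\operatorname{Tr}[C_j(t)\rho]=c_j$ for $j=1,\dots,d$. 2. If the states $\rho_{as}(t)$ are strictly positive on $P\mathbb C^N$ (that is, $\rho_{as}$ is a T-trajectory), then for every $t$ and $\gamma\in\mathbb R^d$ one has $\rho_{as}(t)=\mathcal Z(\gamma)^{-1}\exp\big[\ln\sigma(t)-\sum_j\gamma_jPC_j(t)P\big]$ if and only if $\gamma=\Gamma(c)$. So the Lagrange multipliers exist, do not depend on time, and are determined by the expectation values. 3. In general $\rho_{as}$ is of this form with some of the multipliers taken in the limit $\pm\infty$: there are $\gamma,\eta\in\mathbb R^d$, independent of time, with $\rho_{as}(t)=\lim_{s\to+\infty}\mathcal Z(\gamma+s\eta)^{-1}G_{\gamma+s\eta}(t)$ for every $t$. -/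

import Mathlib

open scoped NNReal Topology ComplexOrder

/-- Operators on the Hilbert space `ℂⁿ`, as matrices in an orthonormal basis indexed by `n`. -/
abbrev Op (n : Type*) := Matrix n n ℂ

/-- Superoperators: linear maps acting on operators. -/
abbrev SuperOp (n : Type*) := Op n →ₗ[ℂ] Op n

section States

variable {n : Type*} [Fintype n]

/-- Density operators: positive operators of trace one. -/
def IsDensity (ρ : Op n) : Prop := ρ.PosSemidef ∧ ρ.trace = 1

/-- Range of an operator. For Hermitian operators this is the support. -/
def opSupport (A : Op n) : Submodule ℂ (n → ℂ) := LinearMap.range A.mulVecLin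

variable [DecidableEq n]

/-- Logarithm of a positive operator. Since `Real.log 0 = 0`, it is the logarithm of the strictly
positive part of `A` on the support of `A`, and zero on the orthogonal complement. -/
noncomputable def opLog (A : Op n) : Op n := cfc Real.log A

open scoped Classical in
/-- Quantum relative entropy `S(ρ|σ)`. -/
noncomputable def relEntropy (ρ σ : Op n) : EReal :=
  if opSupport ρ ≤ opSupport σ then ((ρ * (opLog ρ - opLog σ)).trace.re : EReal) else ⊤

end States

section Maps

variable {n : Type*} [Fintype n] [DecidableEq n]

/-- Quantum channels: completely positive trace preserving maps, in Kraus form. -/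
def IsChannel (Φ : SuperOp n) : Prop :=
  ∃ (m : ℕ) (K : Fin m → Op n),
    ∑ j, (K j).conjTranspose * K j = 1 ∧ ∀ X, Φ X = ∑ j, K j * X * (K j).conjTranspose

/-- The adjoint of a superoperator for the Hilbert-Schmidt product `(A, B) = Tr (Aᴴ B)`; its
`(i, j)` entry at `Y` is `(Φ E_ij, Y)` with `E_ij` the matrix units (see `trace_hsAdjoint`). -/
noncomputable def hsAdjoint (Φ : SuperOp n) : SuperOp n where
  toFun Y := Matrix.of fun i j => ((Φ (Matrix.single i j 1)).conjTranspose * Y).trace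
  map_add' Y Z := by ext i j; simp [Matrix.mul_add]
  map_smul' c Y := by ext i j; simp

/-- The defining property of the adjoint: `(Φ X, Y) = (X, Φ† Y)`. -/
theorem trace_hsAdjoint (Φ : SuperOp n) (X Y : Op n) :
    ((Φ X).conjTranspose * Y).trace = (X.conjTranspose * hsAdjoint Φ Y).trace := by
  have hX : Φ X = ∑ i, ∑ j, X i j • Φ (Matrix.single i j 1) := by
    conv_lhs => rw [Matrix.matrix_eq_sum_single X]
    simp only [map_sum]
    refine Finset.sum_congr rfl fun i _ => Finset.sum_congr rfl fun j _ => ?_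
    rw [← map_smul]
    simp
  rw [hX]
  simp only [Matrix.conjTranspose_sum, Matrix.conjTranspose_smul, Finset.sum_mul,
    Matrix.smul_mul, Matrix.trace_sum, Matrix.trace_smul, smul_eq_mul]
  rw [Finset.sum_comm]
  simp [Matrix.trace, Matrix.mul_apply, hsAdjoint]

/-- The exponential `exp (t L)` of a superoperator, computed on its matrix in the basis of matrix
units (the result does not depend on the choice of the basis). -/
noncomputable def superExp (L : SuperOp n) (t : ℝ) : SuperOp n :=
  Matrix.toLin (Matrix.stdBasis ℂ n n) (Matrix.stdBasis ℂ n n)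
    (NormedSpace.exp
      ((t : ℂ) • LinearMap.toMatrix (Matrix.stdBasis ℂ n n) (Matrix.stdBasis ℂ n n) L))

/-- Lindbladians: generators of semigroups of quantum channels. -/
def IsLindbladian (L : SuperOp n) : Prop := ∀ t : ℝ, 0 ≤ t → IsChannel (superExp L t)

end Maps

/-- Uniform quantum Markov processes on `ℂⁿ`: quantum Markov chains, generated by a channel, and
quantum Markov dynamical semigroups, generated by a Lindbladian. -/
inductive QMP (n : Type*) [Fintype n] [DecidableEq n]
  | chain (T : SuperOp n) (hT : IsChannel T)
  | semigroup (L : SuperOp n) (hL : IsLindbladian L)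

namespace QMP

variable {n : Type*} [Fintype n] [DecidableEq n]

/-- Time: `ℕ` for chains, `[0, ∞)` for dynamical semigroups. -/
def Time : QMP n → Type
  | chain _ _ => ℕ
  | semigroup _ _ => ℝ≥0

noncomputable instance (D : QMP n) : AddCommMonoid D.Time :=
  match D with
  | chain _ _ => inferInstanceAs (AddCommMonoid ℕ)
  | semigroup _ _ => inferInstanceAs (AddCommMonoid ℝ≥0)

noncomputable instance (D : QMP n) : Preorder D.Time :=
  match D with
  | chain _ _ => inferInstanceAs (Preorder ℕ)
  | semigroup _ _ => inferInstanceAs (Preorder ℝ≥0)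

/-- The propagator: `T ^ t` for a chain, `exp (t L)` for a dynamical semigroup. -/
noncomputable def prop : (D : QMP n) → D.Time → SuperOp n
  | chain T _ => fun t : ℕ => (T ^ t : Module.End ℂ (Op n))
  | semigroup L _ => fun t : ℝ≥0 => superExp L t

/-- The generator: `T` for a chain, `L` for a dynamical semigroup. -/
def gen : QMP n → Module.End ℂ (Op n)
  | chain T _ => T
  | semigroup L _ => L

/-- The spectral parameters of the asymptotic part of the dynamics: `|a| = 1` for a chain and
`Re a = 0` for a dynamical semigroup. -/
def asymptoticParam : QMP n → Set ℂ
  | chain _ _ => {a | ‖a‖ = 1}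
  | semigroup _ _ => {a | a.re = 0}

/-- The factor by which an attractor with spectral parameter `a` evolves in time `t`: `a ^ t` for
a chain and `exp (a t)` for a dynamical semigroup. -/
noncomputable def phase : (D : QMP n) → ℂ → D.Time → ℂ
  | chain _ _ => fun a (t : ℕ) => a ^ t
  | semigroup _ _ => fun a (t : ℝ≥0) => Complex.exp (a * ((t : ℝ) : ℂ))

/-- The attractor space in the Schrödinger picture. -/
def attractorSpace (D : QMP n) : Submodule ℂ (Op n) :=
  ⨆ a ∈ D.asymptoticParam, Module.End.eigenspace D.gen a

/-- The attractor space in the Heisenberg picture. -/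
noncomputable def dualAttractorSpace (D : QMP n) : Submodule ℂ (Op n) :=
  ⨆ a ∈ D.asymptoticParam,
    Module.End.eigenspace (hsAdjoint D.gen : Module.End ℂ (Op n)) a

/-- `X` is a basis of the attractor space consisting of eigenoperators of the generator with
spectral parameters `a`, and `Y` is the dual basis in the Heisenberg attractor space. -/
structure IsAttractorBasis (D : QMP n) {m : ℕ} (a : Fin m → ℂ) (X Y : Fin m → Op n) : Prop where
  param_mem : ∀ k, a k ∈ D.asymptoticParam
  eigen : ∀ k, D.gen (X k) = a k • X k
  linearIndependent : LinearIndependent ℂ X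
  span_eq : Submodule.span ℂ (Set.range X) = D.attractorSpace
  dual_mem : ∀ k, Y k ∈ D.dualAttractorSpace
  dual : ∀ k l, ((Y k).conjTranspose * X l).trace = if k = l then 1 else 0

/-- `ρ` is the asymptotic trajectory of the initial state `ρ₀`. -/
def IsAsymptoticTrajectory (D : QMP n) (ρ₀ : Op n) (ρ : D.Time → Op n) : Prop :=
  ∃ (m : ℕ) (a : Fin m → ℂ) (X Y : Fin m → Op n), D.IsAttractorBasis a X Y ∧
    ∀ t, ρ t = ∑ k, (D.phase (a k) t * ((Y k).conjTranspose * ρ₀).trace) • X k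

/-- Invariant states. -/
def IsInvariantState (D : QMP n) (σ : Op n) : Prop := IsDensity σ ∧ ∀ t, D.prop t σ = σ

/-- T-states: invariant states with the maximal support. -/
def IsTState (D : QMP n) (σ : Op n) : Prop :=
  D.IsInvariantState σ ∧ ∀ ω, D.IsInvariantState ω → opSupport ω ≤ opSupport σ

/-- `P` is the T-projector: the orthogonal projection onto the support of a T-state. -/
def IsTProjector (D : QMP n) (P : Op n) : Prop :=
  P.IsHermitian ∧ P * P = P ∧ ∃ σ, D.IsTState σ ∧ opSupport P = opSupport σ

/-- T-trajectories: asymptotic trajectories all of whose states have the support of the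
T-projector `P`. -/
def IsTTrajectory (D : QMP n) (P : Op n) (σ : D.Time → Op n) : Prop :=
  (∃ ρ₀, IsDensity ρ₀ ∧ D.IsAsymptoticTrajectory ρ₀ σ) ∧ ∀ t, opSupport (σ t) = opSupport P

/-- The real vector space of constants of motion: Hermitian operator trajectories `C` in the
Heisenberg attractor space such that the expectation value of `C (t + s)` in `ρ(t)` equals the
expectation value of `C s` in `ρ(0)`, for all state trajectories and all times. -/
noncomputable def constantsOfMotion (D : QMP n) : Submodule ℝ (D.Time → Op n) where
  carrier := {C | (∀ t, (C t).IsHermitian) ∧ (∀ t, C t ∈ D.dualAttractorSpace) ∧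
    ∀ ρ₀, IsDensity ρ₀ → ∀ t s, (C (t + s) * D.prop t ρ₀).trace = (C s * ρ₀).trace}
  add_mem' := fun {B C} hB hC =>
    ⟨fun t => (hB.1 t).add (hC.1 t), fun t => Submodule.add_mem _ (hB.2.1 t) (hC.2.1 t),
      fun ρ₀ h t s => by
        simp [Matrix.add_mul, hB.2.2 ρ₀ h t s, hC.2.2 ρ₀ h t s]⟩
  zero_mem' := ⟨fun t => by simp, fun t => Submodule.zero_mem _, fun ρ₀ h t s => by simp⟩
  smul_mem' := fun r C hC =>
    ⟨fun t => by
        have h : (r • C t).conjTranspose = r • C t := by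
          rw [Matrix.conjTranspose_smul, hC.1 t]; simp
        exact h,
      fun t => by
        have h := Submodule.smul_mem _ (r : ℂ) (hC.2.1 t)
        rwa [Complex.coe_smul] at h,
      fun ρ₀ h t s => by
        simp [hC.2.2 ρ₀ h t s]⟩

/-- The family `{I, C 0, …, C (d - 1)}` is a basis of the constants of motion. -/
def IsBasisOfConstants (D : QMP n) {d : ℕ} (C : Fin d → D.Time → Op n) : Prop :=
  LinearIndependent ℝ (Fin.cons (fun _ => 1) C : Fin (d + 1) → D.Time → Op n) ∧
    Submodule.span ℝ (Set.range (Fin.cons (fun _ => 1) C : Fin (d + 1) → D.Time → Op n)) =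
      D.constantsOfMotion

/-- The operator `exp [ln σ(t) - ∑ j, γ j • P C_j(t) P]` on the range of `P`, extended by zero on
the orthogonal complement. -/
noncomputable def gibbsOp (D : QMP n) (σ : D.Time → Op n) (P : Op n) {d : ℕ}
    (C : Fin d → D.Time → Op n) (γ : Fin d → ℝ) (t : D.Time) : Op n :=
  P * NormedSpace.exp (opLog (σ t) - ∑ j, γ j • (P * C j t * P))

/-- At time `t`, `ρ` is the unique minimizer of the relative entropy with respect to `σ` among all
states in which the constants of motion `C j` have the expectation values `c j`. -/
def IsUniqueMinimizer (D : QMP n) {d : ℕ} (C : Fin d → D.Time → Op n) (c : Fin d → ℝ)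
    (t : D.Time) (σ ρ : Op n) : Prop :=
  (IsDensity ρ ∧ ∀ j, (C j t * ρ).trace = (c j : ℂ)) ∧
    ∀ ω, IsDensity ω → (∀ j, (C j t * ω).trace = (c j : ℂ)) → ω ≠ ρ → relEntropy ρ σ < relEntropy ω σ

end QMP

/-!
The attractor space is the range of an idempotent channel `E`, and on this range the evolution is
reversible. `E` is found as an idempotent limit of `D.prop t` along times tending to infinity: the
limit points of the bounded evolution form a compact semigroup, which contains an idempotent
(`QMP.exists_isAsymptoticProjection`). No Jordan block survives on its range, so the range is
spanned by the asymptotic eigenoperators (`QMP.IsAsymptoticProjection.range_eq`), and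
`D.prop t (E ρ₀)` is the asymptotic trajectory of `ρ₀`; the uniform bound on the evolution gives
convergence. Since `E` is a channel, asymptotic trajectories consist of states.

The T-projector `P` satisfies `P * E X = E X` (`QMP.IsAsymptoticProjection.proj_mul_apply`), and
some invariant state is faithful on the range of `P`. Equality in the Kadison-Schwarz inequality
then shows that the compression `𝒩` to the range of `P` of the Heisenberg attractor space is a
`*`-algebra (`recurrentAlgebra`), that the Heisenberg evolution acts on it by `*`-automorphisms,
and that `E` is dual to a conditional expectation onto it. It follows that the reference operator
`E P` commutes with `𝒩`, and that the range of `E` is `𝒩 * E P`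
(`IsRecurrentProjection.exists_eq_mul_reference`). As the two factors commute, logarithms add: the
logarithm of a state in the range of `E` is, on its support, a Hermitian element of `𝒩` plus the
fixed operator `referenceLog E P` (`IsRecurrentProjection.exists_log`). The compressed constants of
motion are a basis of the Hermitian part of `𝒩` modulo `P`. These facts give all the claims.

* Relative entropy. If `E ω = ρ`, then `ω` and `ρ` have the same expectations in `𝒩`, hence the same
  expectation of `ln ρ - ln σ`, and `S(ω|σ) - S(ρ|σ) = S(ω|ρ)`; Klein's inequality makes this positive
  for `ω ≠ ρ` (`IsRecurrentProjection.relEntropy_lt`). The constants of motion determine `E ω`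
  (`QMP.apply_eq_of_expectations`).
* Gibbs operators evolve as the process does (`QMP.prop_gibbsOp`), because the evolution acts on `𝒩`
  by automorphisms and on `E P` by multiplication by a central element of `𝒩`. Hence their trace is
  constant, and the multipliers can be found at time `0`.
* Two strictly positive states in the range of `E` differ, in the logarithm, by an element of `𝒩`,
  hence by a combination of `P` and the `P C_j P`, with unique coefficients
  (`QMP.exists_eq_gibbsOp`, `QMP.gibbsOp_injective`).
* For a state with support projection `Q` in the range of `P`, the exponent `K - s (P - Q)` with
  `s → ∞` suppresses the complement of the support (`QMP.exists_tendsto_gibbsOp`).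
-/

/-! ### Positive operators and supports -/

section PositiveOperators

variable {n : Type*} [Fintype n]

open scoped MatrixOrder in
theorem Matrix.PosSemidef.exists_eq_conjTranspose_mul_self [DecidableEq n] {A : Op n}
    (hA : A.PosSemidef) :
    ∃ B : Op n, A = B.conjTranspose * B := by
  obtain ⟨B, hB⟩ := CStarAlgebra.nonneg_iff_eq_star_mul_self.1 (Matrix.nonneg_iff_posSemidef.2 hA)
  exact ⟨B, hB⟩

theorem Matrix.PosSemidef.trace_mul_nonneg [DecidableEq n] {A B : Op n} (hA : A.PosSemidef)
    (hB : B.PosSemidef) : 0 ≤ (A * B).trace := by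
  obtain ⟨C, rfl⟩ := hB.exists_eq_conjTranspose_mul_self
  have h := (hA.mul_mul_conjTranspose_same C).trace_nonneg
  rwa [← Matrix.mul_assoc, Matrix.trace_mul_comm, ← Matrix.mul_assoc]

/-- A positive definite operator detects positive operators under the trace pairing. -/
theorem Matrix.PosDef.eq_zero_of_trace_mul_eq_zero [DecidableEq n] {A B : Op n} (hA : A.PosDef)
    (hB : B.PosSemidef) (h : (A * B).trace = 0) : B = 0 := by
  obtain ⟨C, rfl⟩ := hB.exists_eq_conjTranspose_mul_self
  rw [← Matrix.mul_assoc, Matrix.trace_mul_comm, ← Matrix.mul_assoc] at h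
  have h0 := (hA.posSemidef.mul_mul_conjTranspose_same C).trace_eq_zero_iff.1 h
  have hC : C.conjTranspose = 0 := by
    refine Matrix.toLin'.injective (LinearMap.ext fun x => ?_)
    rw [Matrix.toLin'_apply, Matrix.toLin'_apply]
    by_contra hx
    rw [Matrix.zero_mulVec] at hx
    have h1 := hA.dotProduct_mulVec_pos hx
    have h2 : star (C.conjTranspose.mulVec x) ⬝ᵥ A.mulVec (C.conjTranspose.mulVec x) = 0 := by
      rw [Matrix.star_mulVec, Matrix.conjTranspose_conjTranspose, Matrix.mulVec_mulVec,
        ← Matrix.dotProduct_mulVec, Matrix.mulVec_mulVec, ← Matrix.mul_assoc, h0]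
      simp
    exact h1.ne' h2
  rw [hC, Matrix.zero_mul]

theorem opSupport_le_iff {A P : Op n} (hP : P * P = P) :
    opSupport A ≤ opSupport P ↔ P * A = A := by
  constructor
  · intro h
    classical
    refine Matrix.toLin'.injective (LinearMap.ext fun x => ?_)
    rw [Matrix.toLin'_apply, Matrix.toLin'_apply]
    obtain ⟨y, hy⟩ := h ⟨x, rfl⟩
    simp only [Matrix.mulVecLin_apply] at hy
    rw [← Matrix.mulVec_mulVec, ← hy, Matrix.mulVec_mulVec, hP]
  · rintro h _ ⟨x, rfl⟩
    exact ⟨A.mulVec x, by simp [Matrix.mulVec_mulVec, h]⟩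

/-- A positive operator whose support is the range of the projection `P` is positive definite on
that range. -/
theorem posDef_add_compl_of_opSupport_eq [DecidableEq n] {A P : Op n} (hA : A.PosSemidef)
    (hPh : P.IsHermitian) (hP : P * P = P) (h : opSupport A = opSupport P) :
    (A + (1 - P)).PosDef := by
  have hQh : (1 - P).conjTranspose = 1 - P := by simp [hPh.eq]
  have hQ : (1 - P).PosSemidef := by
    have := Matrix.posSemidef_conjTranspose_mul_self (1 - P)
    rw [hQh] at this
    convert this using 1
    simp [Matrix.mul_sub, Matrix.sub_mul, hP]
  refine Matrix.PosDef.of_dotProduct_mulVec_pos (hA.1.add hQ.1) fun {x} hx => ?_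
  refine lt_of_le_of_ne ((hA.add hQ).dotProduct_mulVec_nonneg x) fun h0 => hx ?_
  rw [Matrix.add_mulVec, dotProduct_add] at h0
  have h1 := (add_eq_zero_iff_of_nonneg (hA.dotProduct_mulVec_nonneg x)
    (hQ.dotProduct_mulVec_nonneg x)).1 h0.symm
  have h2 := (hA.dotProduct_mulVec_zero_iff x).1 h1.1
  have h3 := (hQ.dotProduct_mulVec_zero_iff x).1 h1.2
  rw [Matrix.sub_mulVec, Matrix.one_mulVec, sub_eq_zero] at h3
  obtain ⟨z, hz⟩ : P.mulVec x ∈ opSupport A := h ▸ ⟨x, rfl⟩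
  simp only [Matrix.mulVecLin_apply] at hz
  rw [← h3] at hz
  rw [← dotProduct_star_self_eq_zero]
  nth_rw 2 [← hz]
  rw [Matrix.dotProduct_mulVec, ← hA.1.eq, ← Matrix.star_mulVec, h2, star_zero, zero_dotProduct]

end PositiveOperators

/-! ### Functional calculus -/

section FunctionalCalculus

variable {n : Type*} [Fintype n] [DecidableEq n]

/-- On finitely many operators the functional calculus is given by a single polynomial. -/
theorem exists_polynomial_cfc_eq (f : ℝ → ℝ) {A B : Op n} (hA : A.IsHermitian)
    (hB : B.IsHermitian) :
    ∃ p : Polynomial ℝ, cfc f A = Polynomial.aeval A p ∧ cfc f B = Polynomial.aeval B p := by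
  classical
  obtain ⟨s, hs⟩ := ((Matrix.finite_real_spectrum (A := A)).union
    (Matrix.finite_real_spectrum (A := B))).exists_finset_coe
  have key : ∀ x ∈ s, (Lagrange.interpolate s id f).eval x = f x := fun x hx =>
    Lagrange.eval_interpolate_at_node f (Function.injective_id.injOn) hx
  refine ⟨Lagrange.interpolate s id f, ?_, ?_⟩
  · rw [← cfc_polynomial _ A hA]
    refine cfc_congr fun x hx => (key x ?_).symm
    rw [← Finset.mem_coe, hs]; exact Or.inl hx
  · rw [← cfc_polynomial _ B hB]
    refine cfc_congr fun x hx => (key x ?_).symm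
    rw [← Finset.mem_coe, hs]; exact Or.inr hx

theorem aeval_mul_of_mul_eq {A B q : Op n} (hA : Commute A q) (h : A * q = B * q)
    (p : Polynomial ℝ) : Polynomial.aeval A p * q = Polynomial.aeval B p * q := by
  have hpow : ∀ k : ℕ, A ^ k * q = B ^ k * q := by
    intro k
    induction k with
    | zero => simp
    | succ k ih =>
      rw [pow_succ, pow_succ, Matrix.mul_assoc, h, Matrix.mul_assoc, ← h, hA.eq, ← Matrix.mul_assoc,
        ih, Matrix.mul_assoc]
  induction p using Polynomial.induction_on' with
  | add p q hp hq => simp [Matrix.add_mul, hp, hq]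
  | monomial k a => simp [Polynomial.aeval_monomial, Algebra.algebraMap_eq_smul_one, hpow]

/-- The functional calculus is local: two Hermitian operators that agree on a common invariant
subspace have the same functions on it. -/
theorem cfc_mul_of_mul_eq (f : ℝ → ℝ) {A B q : Op n} (hA : A.IsHermitian) (hB : B.IsHermitian)
    (hAq : Commute A q) (h : A * q = B * q) : cfc f A * q = cfc f B * q := by
  obtain ⟨p, h1, h2⟩ := exists_polynomial_cfc_eq f hA hB
  rw [h1, h2, aeval_mul_of_mul_eq hAq h]

theorem cfc_mem_subalgebra (f : ℝ → ℝ) {A : Op n} (hA : A.IsHermitian) {S : Subalgebra ℝ (Op n)}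
    (h : A ∈ S) : cfc f A ∈ S := by
  obtain ⟨p, h1, -⟩ := exists_polynomial_cfc_eq f hA hA
  rw [h1]
  exact Polynomial.aeval_mem_adjoin_singleton ℝ A |> Algebra.adjoin_le (by simpa using h)

theorem opLog_isHermitian (A : Op n) : (opLog A).IsHermitian := cfc_predicate Real.log A

open scoped Matrix.Norms.L2Operator in
theorem opLog_exp {K : Op n} (hK : K.IsHermitian) : opLog (NormedSpace.exp K) = K :=
  CFC.log_exp K hK

open scoped Matrix.Norms.L2Operator MatrixOrder in
theorem exp_opLog {A : Op n} (hA : A.PosDef) : NormedSpace.exp (opLog A) = A :=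
  CFC.exp_log A (Matrix.isStrictlyPositive_iff_posDef.2 hA)

open scoped Matrix.Norms.L2Operator in
theorem cfc_exp {K : Op n} (hK : K.IsHermitian) : cfc Real.exp K = NormedSpace.exp K :=
  CFC.real_exp_eq_normedSpace_exp hK

open scoped Matrix.Norms.L2Operator MatrixOrder in
theorem exp_posDef {K : Op n} (hK : K.IsHermitian) : (NormedSpace.exp K).PosDef := by
  refine (Matrix.PosSemidef.posDef_iff_isUnit (Matrix.nonneg_iff_posSemidef.1
    (IsSelfAdjoint.exp_nonneg hK))).2 (Matrix.isUnit_exp K)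

theorem opLog_mul_commute {A B : Op n} (h : Commute A B) : Commute (opLog A) B :=
  Commute.cfc_real h _

/-- The logarithm of a positive operator compressed by a commuting projection: the convention
`log 0 = 0` makes it the compression of the logarithm. -/
theorem opLog_mul_proj {A q : Op n} (hA : A.IsHermitian) (hq : q.IsHermitian) (hqq : q * q = q)
    (h : Commute A q) : opLog (A * q) = opLog A * q := by
  have hAq : (A * q).IsHermitian := by
    rw [Matrix.IsHermitian, Matrix.conjTranspose_mul, hA.eq, hq.eq, h.eq]
  have hc : Commute (A * q) q := h.mul_left (Commute.refl q)
  have h1 : opLog (A * q) * q = opLog A * q :=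
    cfc_mul_of_mul_eq _ hAq hA hc (by rw [Matrix.mul_assoc, hqq])
  have h2 : opLog (A * q) * (1 - q) = 0 := by
    have := cfc_mul_of_mul_eq Real.log hAq (Matrix.isHermitian_zero (n := n) (α := ℂ))
      (q := 1 - q) ((Commute.one_right _).sub_right hc)
      (by simp [Matrix.mul_sub, Matrix.mul_assoc, hqq])
    rw [opLog, this, cfc_apply_zero, Real.log_zero]; simp
  rw [← h1, ← sub_eq_zero, ← h2, Matrix.mul_sub, Matrix.mul_one]

end FunctionalCalculus

/-! ### Klein's inequality -/

section Klein

variable {n : Type*} [Fintype n] [DecidableEq n]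

/-- The squared overlaps `|⟨e i, f j⟩|²` of the eigenbases of two Hermitian operators. -/
noncomputable def eigenOverlap {A B : Op n} (hA : A.IsHermitian) (hB : B.IsHermitian)
    (i j : n) : ℝ :=
  ‖(star (hA.eigenvectorUnitary : Op n) * (hB.eigenvectorUnitary : Op n)) i j‖ ^ 2

omit [DecidableEq n] in
theorem trace_conj_mul_conj (U V D E : Op n) :
    (U * D * star U * (V * E * star V)).trace =
      (D * (star U * V) * E * star (star U * V)).trace := by
  rw [star_mul, star_star, Matrix.mul_assoc U, Matrix.mul_assoc U, Matrix.trace_mul_comm U]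
  simp only [Matrix.mul_assoc]

theorem trace_diagonal_mul_mul_diagonal_mul_star (W : Op n) (f g : n → ℝ) :
    (Matrix.diagonal (fun i => (f i : ℂ)) * W * Matrix.diagonal (fun i => (g i : ℂ)) *
      star W).trace = ((∑ i, ∑ j, ‖W i j‖ ^ 2 * (f i * g j) : ℝ) : ℂ) := by
  rw [Matrix.trace]
  push_cast
  refine Finset.sum_congr rfl fun i _ => ?_
  rw [Matrix.diag_apply, Matrix.mul_apply]
  refine Finset.sum_congr rfl fun j _ => ?_
  rw [Matrix.mul_diagonal, Matrix.diagonal_mul, Matrix.star_apply, ← Complex.mul_conj',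
    Complex.star_def]
  ring

/-- The trace of `f(A) g(B)` is a double sum over the two spectra, weighted by the overlaps. It reduces
trace inequalities for two noncommuting operators to inequalities for pairs of real numbers. -/
theorem trace_cfc_mul_cfc (f g : ℝ → ℝ) {A B : Op n} (hA : A.IsHermitian) (hB : B.IsHermitian) :
    (cfc f A * cfc g B).trace =
      ((∑ i, ∑ j, eigenOverlap hA hB i j * (f (hA.eigenvalues i) * g (hB.eigenvalues j)) : ℝ) : ℂ)
      := by
  rw [hA.cfc_eq, hB.cfc_eq]
  exact (trace_conj_mul_conj _ _ _ _).trans (trace_diagonal_mul_mul_diagonal_mul_star _ _ _)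

/-- The scalar form of Klein's inequality. -/
theorem mul_log_sub_nonneg {p r : ℝ} (hp : 0 ≤ p) (hr : 0 < r) :
    0 ≤ p * Real.log p - p * Real.log r - p + r ∧
      (p * Real.log p - p * Real.log r - p + r = 0 → p = r) := by
  rcases hp.eq_or_lt with rfl | hp
  · simp; constructor <;> intros <;> linarith
  · have hlog : Real.log (r / p) = Real.log r - Real.log p := Real.log_div hr.ne' hp.ne'
    by_cases h : p = r
    · subst h; simp
    · have h1 : Real.log (r / p) < r / p - 1 :=
        Real.log_lt_sub_one_of_pos (by positivity) (by rw [ne_eq, div_eq_one_iff_eq hp.ne']; tauto)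
      have h2 : p * Real.log (r / p) < p * (r / p - 1) := mul_lt_mul_of_pos_left h1 hp
      have h3 : p * (r / p - 1) = r - p := by field_simp
      rw [hlog, h3] at h2
      constructor
      · linarith
      · intro h0; linarith

/-- Klein's inequality, with strictness: the relative entropy of two distinct states is positive.
The hypothesis `hker` says that the kernel of `ρ` is contained in the kernel of `ω`. -/
theorem klein_inequality {ω ρ : Op n} (hω : ω.PosSemidef) (hρ : ρ.PosSemidef)
    (htr : ω.trace = ρ.trace)
    (hker : (ω * cfc (fun x : ℝ => if x = 0 then 1 else 0) ρ).trace = 0) (hne : ω ≠ ρ) :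
    0 < (ω * (opLog ω - opLog ρ)).trace.re := by
  set w := eigenOverlap hω.1 hρ.1 with hw
  set p := hω.1.eigenvalues with hp
  set r := hρ.1.eigenvalues with hr
  have hp0 : ∀ i, 0 ≤ p i := hω.eigenvalues_nonneg
  have hr0 : ∀ i, 0 ≤ r i := hρ.eigenvalues_nonneg
  have hw0 : ∀ i j, 0 ≤ w i j := fun i j => by rw [hw, eigenOverlap]; positivity
  have T := fun f g => trace_cfc_mul_cfc f g hω.1 hρ.1
  rw [← hw, ← hp, ← hr] at T
  have hidω : cfc (fun x : ℝ => x) ω = ω := cfc_id' ℝ ω hω.1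
  have hidρ : cfc (fun x : ℝ => x) ρ = ρ := cfc_id' ℝ ρ hρ.1
  have honeω : cfc (fun _ : ℝ => (1 : ℝ)) ω = 1 := cfc_const_one ℝ ω hω.1
  have honeρ : cfc (fun _ : ℝ => (1 : ℝ)) ρ = 1 := cfc_const_one ℝ ρ hρ.1
  have hent : cfc (fun x : ℝ => x * Real.log x) ω = ω * opLog ω := by
    rw [cfc_mul (fun x : ℝ => x) Real.log ω (Set.Finite.continuousOn
      Matrix.finite_real_spectrum _) (Set.Finite.continuousOn Matrix.finite_real_spectrum _), hidω]
    rfl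
  have hsqω : cfc (fun x : ℝ => x * x) ω = ω * ω := by
    rw [cfc_mul (fun x : ℝ => x) (fun x : ℝ => x) ω, hidω]
  have hsqρ : cfc (fun x : ℝ => x * x) ρ = ρ * ρ := by
    rw [cfc_mul (fun x : ℝ => x) (fun x : ℝ => x) ρ, hidρ]
  -- for `r j = 0` the kernel condition gives `w i j * p i = 0`
  have hzero : ∀ i j, r j = 0 → w i j * p i = 0 := by
    have h := T (fun x => x) (fun x : ℝ => if x = 0 then 1 else 0)
    rw [hidω, hker, eq_comm, Complex.ofReal_eq_zero] at h
    have hnn : ∀ i j, 0 ≤ w i j * (p i * if r j = 0 then 1 else 0) := fun i j =>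
      mul_nonneg (hw0 i j) (mul_nonneg (hp0 i) (by split_ifs <;> norm_num))
    intro i j hj
    rw [Finset.sum_eq_zero_iff_of_nonneg fun i _ => Finset.sum_nonneg fun j _ => hnn i j] at h
    have h' := h i (Finset.mem_univ i)
    rw [Finset.sum_eq_zero_iff_of_nonneg fun j _ => hnn i j] at h'
    simpa [hj] using h' j (Finset.mem_univ j)
  -- the trace condition adds `- p i + r j` for free and makes every term nonnegative
  set e : n → n → ℝ := fun i j =>
    w i j * (p i * Real.log (p i) - p i * Real.log (r j) - p i + r j) with he
  have he0 : ∀ i j, 0 ≤ e i j ∧ (e i j = 0 → w i j * ((p i - r j) * (p i - r j)) = 0) := by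
    intro i j
    rcases (hr0 j).eq_or_lt with hj | hj
    · rcases mul_eq_zero.1 (hzero i j hj.symm) with h | h
      · simp [he, h]
      · simp [he, h, ← hj]
    · obtain ⟨h1, h2⟩ := mul_log_sub_nonneg (hp0 i) hj
      refine ⟨mul_nonneg (hw0 i j) h1, fun h => ?_⟩
      rcases mul_eq_zero.1 h with h | h
      · simp [h]
      · simp [h2 h]
  have hsum : (ω * (opLog ω - opLog ρ)).trace = ((∑ i, ∑ j, e i j : ℝ) : ℂ) := by
    have h1 := T (fun x => x * Real.log x) (fun _ => 1)
    have h2 := T (fun x => x) Real.log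
    have h3 := T (fun x => x) (fun _ => 1)
    have h4 := T (fun _ => 1) (fun x => x)
    rw [hent, honeρ, Matrix.mul_one] at h1
    rw [hidω, show cfc Real.log ρ = opLog ρ from rfl] at h2
    rw [hidω, honeρ, Matrix.mul_one] at h3
    rw [hidρ, honeω, Matrix.one_mul] at h4
    rw [Matrix.mul_sub, Matrix.trace_sub]
    have : (ω * opLog ω).trace - (ω * opLog ρ).trace
        = (ω * opLog ω).trace - (ω * opLog ρ).trace - ω.trace + ρ.trace := by rw [htr]; ring
    rw [this, h1, h2, h3, h4]
    norm_cast
    simp only [he, ← Finset.sum_sub_distrib, ← Finset.sum_add_distrib]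
    refine Finset.sum_congr rfl fun i _ => Finset.sum_congr rfl fun j _ => ?_
    ring
  rw [hsum, Complex.ofReal_re]
  refine lt_of_le_of_ne (Finset.sum_nonneg fun i _ => Finset.sum_nonneg fun j _ => (he0 i j).1)
    fun h0 => hne ?_
  have hall : ∀ i j, w i j * ((p i - r j) * (p i - r j)) = 0 := by
    intro i j
    rw [eq_comm, Finset.sum_eq_zero_iff_of_nonneg fun i _ => Finset.sum_nonneg fun j _ =>
      (he0 i j).1] at h0
    have h' := h0 i (Finset.mem_univ i)
    rw [Finset.sum_eq_zero_iff_of_nonneg fun j _ => (he0 i j).1] at h'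
    exact (he0 i j).2 (h' j (Finset.mem_univ j))
  -- `Tr (ω - ρ)²` is the overlap-weighted sum of `(p i - r j)²`
  have hdist : ((ω - ρ).conjTranspose * (ω - ρ)).trace = 0 := by
    have h1 := T (fun x => x * x) (fun _ => 1)
    have h2 := T (fun x => x) (fun x => x)
    have h3 := T (fun _ => 1) (fun x => x * x)
    rw [hsqω, honeρ, Matrix.mul_one] at h1
    rw [hidω, hidρ] at h2
    rw [hsqρ, honeω, Matrix.one_mul] at h3
    rw [(hω.1.sub hρ.1).eq]
    have : ((ω - ρ) * (ω - ρ)).trace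
        = (ω * ω).trace - (ω * ρ).trace - (ω * ρ).trace + (ρ * ρ).trace := by
      simp only [Matrix.sub_mul, Matrix.mul_sub, Matrix.trace_sub, Matrix.trace_mul_comm ρ ω]
      ring
    rw [this, h1, h2, h3]
    norm_cast
    simp only [← Finset.sum_sub_distrib, ← Finset.sum_add_distrib]
    refine Finset.sum_eq_zero fun i _ => Finset.sum_eq_zero fun j _ => ?_
    rw [← hall i j]
    ring
  exact sub_eq_zero.1 (Matrix.trace_conjTranspose_mul_self_eq_zero_iff.1 hdist)

end Klein

/-! ### Adjoints and Schwarz channels -/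

section Adjoint

variable {n : Type*} [Fintype n] [DecidableEq n]

theorem eq_hsAdjoint_of_trace {Φ Ψ : SuperOp n}
    (h : ∀ X Y, ((Φ X).conjTranspose * Y).trace = (X.conjTranspose * Ψ Y).trace) :
    hsAdjoint Φ = Ψ := by
  refine LinearMap.ext fun Y => Matrix.ext_iff_trace_mul_left.2 fun X => ?_
  have h1 := trace_hsAdjoint Φ X.conjTranspose Y
  rw [h, Matrix.conjTranspose_conjTranspose] at h1
  exact h1.symm

theorem hsAdjoint_mul (Φ Ψ : Module.End ℂ (Op n)) :
    hsAdjoint (Φ * Ψ) = (hsAdjoint Ψ * hsAdjoint Φ : Module.End ℂ (Op n)) := by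
  refine eq_hsAdjoint_of_trace fun X Y => ?_
  rw [Module.End.mul_apply, Module.End.mul_apply, trace_hsAdjoint, trace_hsAdjoint]

theorem hsAdjoint_one : hsAdjoint (1 : Module.End ℂ (Op n)) = (1 : Module.End ℂ (Op n)) :=
  eq_hsAdjoint_of_trace fun _ _ => rfl

theorem hsAdjoint_pow (Φ : Module.End ℂ (Op n)) (k : ℕ) :
    hsAdjoint (Φ ^ k) = (hsAdjoint Φ ^ k : Module.End ℂ (Op n)) := by
  induction k with
  | zero => rw [pow_zero, pow_zero, hsAdjoint_one]
  | succ k ih => rw [pow_succ, hsAdjoint_mul, ih, pow_succ']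

theorem trace_mul_hsAdjoint {Φ : SuperOp n} (hΦ : ∀ X, Φ X.conjTranspose = (Φ X).conjTranspose)
    (X Y : Op n) : (Φ X * Y).trace = (X * hsAdjoint Φ Y).trace := by
  have h := trace_hsAdjoint Φ X.conjTranspose Y
  rwa [hΦ, Matrix.conjTranspose_conjTranspose, Matrix.conjTranspose_conjTranspose] at h

/-- A Hermiticity preserving, trace preserving map whose adjoint satisfies the Kadison-Schwarz
inequality. These are the only properties of channels that the argument uses, and unlike a Kraus
form they obviously survive pointwise limits. -/
structure IsSchwarzChannel (Φ : SuperOp n) : Prop where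
  map_conjTranspose : ∀ X, Φ X.conjTranspose = (Φ X).conjTranspose
  trace_map : ∀ X, (Φ X).trace = X.trace
  schwarz : ∀ A, (hsAdjoint Φ (A.conjTranspose * A) -
    (hsAdjoint Φ A).conjTranspose * hsAdjoint Φ A).PosSemidef

namespace IsSchwarzChannel

variable {Φ : SuperOp n} (hΦ : IsSchwarzChannel Φ)
include hΦ

theorem adjoint_one : hsAdjoint Φ 1 = 1 := by
  refine Matrix.ext_iff_trace_mul_left.2 fun X => ?_
  rw [← trace_mul_hsAdjoint hΦ.map_conjTranspose, Matrix.mul_one, Matrix.mul_one, hΦ.trace_map]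

theorem adjoint_conjTranspose (A : Op n) :
    hsAdjoint Φ A.conjTranspose = (hsAdjoint Φ A).conjTranspose := by
  refine Matrix.ext_iff_trace_mul_left.2 fun X => ?_
  rw [← trace_mul_hsAdjoint hΦ.map_conjTranspose]
  have h := congrArg star (trace_hsAdjoint Φ X A)
  simp only [← Matrix.trace_conjTranspose, Matrix.conjTranspose_mul,
    Matrix.conjTranspose_conjTranspose] at h
  rw [Matrix.trace_mul_comm, h, Matrix.trace_mul_comm]

theorem adjoint_posSemidef {A : Op n} (hA : A.PosSemidef) : (hsAdjoint Φ A).PosSemidef := by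
  obtain ⟨B, rfl⟩ := hA.exists_eq_conjTranspose_mul_self
  simpa using (hΦ.schwarz B).add (Matrix.posSemidef_conjTranspose_mul_self (hsAdjoint Φ B))

theorem map_posSemidef {X : Op n} (hX : X.PosSemidef) : (Φ X).PosSemidef := by
  refine Matrix.PosSemidef.of_dotProduct_mulVec_nonneg ?_ fun v => ?_
  · rw [Matrix.IsHermitian, ← hΦ.map_conjTranspose, hX.1.eq]
  · have h := hX.trace_mul_nonneg (hΦ.adjoint_posSemidef (Matrix.posSemidef_vecMulVec_self_star v))
    rwa [← trace_mul_hsAdjoint hΦ.map_conjTranspose, Matrix.trace_mul_comm, Matrix.vecMulVec_mul,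
      Matrix.trace_vecMulVec, dotProduct_comm, ← Matrix.dotProduct_mulVec] at h

theorem isDensity {X : Op n} (hX : IsDensity X) : IsDensity (Φ X) :=
  ⟨hΦ.map_posSemidef hX.1, (hΦ.trace_map X).trans hX.2⟩

end IsSchwarzChannel

theorem IsChannel.isSchwarzChannel {Φ : SuperOp n} (hΦ : IsChannel Φ) : IsSchwarzChannel Φ := by
  obtain ⟨m, K, hK, hΦ⟩ := hΦ
  have hadj : ∀ Y, hsAdjoint Φ Y = ∑ j, (K j).conjTranspose * Y * K j := by
    have : hsAdjoint Φ = ∑ j, LinearMap.mulLeftRight ℂ ((K j).conjTranspose, K j) := by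
      refine eq_hsAdjoint_of_trace fun X Y => ?_
      simp only [hΦ, LinearMap.sum_apply, LinearMap.mulLeftRight_apply, Matrix.conjTranspose_sum,
        Finset.sum_mul, Finset.mul_sum, Matrix.trace_sum, Matrix.conjTranspose_mul,
        Matrix.conjTranspose_conjTranspose]
      refine Finset.sum_congr rfl fun j _ => ?_
      rw [Matrix.mul_assoc, Matrix.trace_mul_comm]
      simp only [Matrix.mul_assoc]
    intro Y
    simp [this]
  refine ⟨fun X => ?_, fun X => ?_, fun A => ?_⟩
  · simp [hΦ, Matrix.conjTranspose_sum, Matrix.mul_assoc]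
  · rw [hΦ, Matrix.trace_sum]
    simp only [Matrix.trace_mul_comm _ (Matrix.conjTranspose _), ← Matrix.mul_assoc]
    rw [← Matrix.trace_sum, ← Finset.sum_mul, hK, Matrix.one_mul]
  · set B := hsAdjoint Φ A with hB
    -- the defect in the Kadison-Schwarz inequality is a sum of squares of `A K_j - K_j Φ†(A)`
    have : hsAdjoint Φ (A.conjTranspose * A) - B.conjTranspose * B =
        ∑ j, (A * K j - K j * B).conjTranspose * (A * K j - K j * B) := by
      have h1 : ∑ j, (K j).conjTranspose * (A.conjTranspose * K j) = B.conjTranspose := by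
        rw [hB, hadj, Matrix.conjTranspose_sum]
        simp [Matrix.mul_assoc]
      have h2 : ∑ j, (K j).conjTranspose * (A * K j) = B := by
        rw [hB, hadj]; simp [Matrix.mul_assoc]
      simp only [Matrix.conjTranspose_sub, Matrix.conjTranspose_mul, Matrix.sub_mul,
        Matrix.mul_sub, Finset.sum_sub_distrib, Matrix.mul_assoc]
      rw [← Finset.mul_sum, h2]
      have h3 : ∑ j, (K j).conjTranspose * (A.conjTranspose * (K j * B)) = B.conjTranspose * B := by
        rw [← h1, Finset.sum_mul]; simp only [Matrix.mul_assoc]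
      have h4 : ∑ j, (K j).conjTranspose * (K j * B) = B := by
        simp only [← Matrix.mul_assoc]
        rw [← Finset.sum_mul, hK, Matrix.one_mul]
      rw [h3, ← Finset.mul_sum, h4, hadj]
      simp only [Matrix.mul_assoc]
      abel
    rw [this]
    exact Matrix.posSemidef_sum _ fun j _ => Matrix.posSemidef_conjTranspose_mul_self _

theorem IsChannel.one : IsChannel (1 : Module.End ℂ (Op n)) :=
  ⟨1, fun _ => 1, by simp, fun X => by simp⟩

theorem IsChannel.mul {Φ Ψ : Module.End ℂ (Op n)} (hΦ : IsChannel Φ) (hΨ : IsChannel Ψ) :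
    IsChannel (Φ * Ψ : Module.End ℂ (Op n)) := by
  obtain ⟨m, K, hK, hΦ⟩ := hΦ
  obtain ⟨m', K', hK', hΨ⟩ := hΨ
  refine ⟨m * m', fun j => K (finProdFinEquiv.symm j).1 * K' (finProdFinEquiv.symm j).2, ?_,
    fun X => ?_⟩
  · rw [finProdFinEquiv.symm.sum_comp fun p : Fin m × Fin m' =>
      (K p.1 * K' p.2).conjTranspose * (K p.1 * K' p.2), Fintype.sum_prod_type_right, ← hK']
    refine Finset.sum_congr rfl fun j _ => ?_
    simp only [Matrix.conjTranspose_mul, Matrix.mul_assoc]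
    rw [← Finset.mul_sum]
    simp only [← Matrix.mul_assoc]
    rw [← Finset.sum_mul, hK, Matrix.one_mul]
  · rw [finProdFinEquiv.symm.sum_comp fun p : Fin m × Fin m' =>
      (K p.1 * K' p.2) * X * (K p.1 * K' p.2).conjTranspose, Fintype.sum_prod_type,
      Module.End.mul_apply, hΦ, hΨ]
    refine Finset.sum_congr rfl fun i _ => ?_
    simp only [Finset.mul_sum, Finset.sum_mul, Matrix.conjTranspose_mul, Matrix.mul_assoc]

/-- Channels are uniformly bounded, entry by entry. -/
theorem IsChannel.norm_apply_le {Φ : SuperOp n} (hΦ : IsChannel Φ) (X : Op n) (a b : n) :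
    ‖Φ X a b‖ ≤ ∑ c, ∑ d, ‖X c d‖ := by
  obtain ⟨m, K, hK, hΦ⟩ := hΦ
  have hcol : ∀ a c, ∑ j, ‖K j a c‖ ^ 2 ≤ 1 := by
    intro a c
    have h := congrFun (congrFun hK c) c
    rw [Matrix.sum_apply, Matrix.one_apply_eq] at h
    simp only [Matrix.mul_apply, Matrix.conjTranspose_apply, Complex.star_def,
      Complex.conj_mul'] at h
    norm_cast at h
    rw [← h]
    exact Finset.sum_le_sum fun j _ =>
      Finset.single_le_sum (f := fun i => ‖K j i c‖ ^ 2) (fun i _ => by positivity)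
        (Finset.mem_univ a)
  have h1 : Φ X a b = ∑ c, ∑ d, X c d * ∑ j, K j a c * star (K j b d) := by
    have h2 : ∀ j, (K j * X * (K j).conjTranspose) a b =
        ∑ c, ∑ d, X c d * (K j a c * star (K j b d)) := fun j => by
      simp only [Matrix.mul_apply, Finset.sum_mul, Matrix.conjTranspose_apply]
      rw [Finset.sum_comm]
      exact Finset.sum_congr rfl fun c _ => Finset.sum_congr rfl fun d _ => by ring
    rw [hΦ, Matrix.sum_apply, Finset.sum_congr rfl fun j _ => h2 j, Finset.sum_comm]
    refine Finset.sum_congr rfl fun c _ => ?_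
    rw [Finset.sum_comm]
    exact Finset.sum_congr rfl fun d _ => (Finset.mul_sum _ _ _).symm
  rw [h1]
  refine (norm_sum_le _ _).trans (Finset.sum_le_sum fun c _ => (norm_sum_le _ _).trans
    (Finset.sum_le_sum fun d _ => ?_))
  rw [norm_mul]
  refine mul_le_of_le_one_right (norm_nonneg _) ((norm_sum_le _ _).trans ?_)
  have h2 : ∀ j, ‖K j a c * star (K j b d)‖ ≤ (‖K j a c‖ ^ 2 + ‖K j b d‖ ^ 2) / 2 := fun j => by
    rw [norm_mul, norm_star]
    nlinarith [sq_nonneg (‖K j a c‖ - ‖K j b d‖)]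
  refine (Finset.sum_le_sum fun j _ => h2 j).trans ?_
  rw [← Finset.sum_div, Finset.sum_add_distrib]
  linarith [hcol a c, hcol b d]

omit [DecidableEq n] in
theorem Matrix.PosSemidef.of_tendsto {ι : Type*} {U : Filter ι} [U.NeBot] {A : ι → Op n} {B : Op n}
    (h : Filter.Tendsto A U (𝓝 B)) (hA : ∀ t, (A t).PosSemidef) : B.PosSemidef := by
  refine Matrix.PosSemidef.of_dotProduct_mulVec_nonneg ?_ fun v => ?_
  · refine tendsto_nhds_unique
      ((Continuous.matrix_conjTranspose continuous_id).continuousAt.tendsto.comp h) ?_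
    refine h.congr fun t => ((hA t).1.eq).symm
  · exact ge_of_tendsto' ((Continuous.dotProduct continuous_const
      (Continuous.matrix_mulVec continuous_id continuous_const)).continuousAt.tendsto.comp h) fun t =>
        (hA t).dotProduct_mulVec_nonneg v

theorem tendsto_hsAdjoint {ι : Type*} {U : Filter ι} {Φ : ι → SuperOp n} {Ψ : SuperOp n}
    (h : ∀ X, Filter.Tendsto (fun t => Φ t X) U (𝓝 (Ψ X))) (Y : Op n) :
    Filter.Tendsto (fun t => hsAdjoint (Φ t) Y) U (𝓝 (hsAdjoint Ψ Y)) := by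
  refine tendsto_pi_nhds.2 fun i => tendsto_pi_nhds.2 fun j => ?_
  have hc : Continuous fun X : Op n => (X.conjTranspose * Y).trace := by fun_prop
  exact hc.continuousAt.tendsto.comp (h (Matrix.single i j 1))

theorem IsSchwarzChannel.of_tendsto {ι : Type*} {U : Filter ι} [U.NeBot] {Φ : ι → SuperOp n}
    {Ψ : SuperOp n} (hΦ : ∀ t, IsSchwarzChannel (Φ t))
    (h : ∀ X, Filter.Tendsto (fun t => Φ t X) U (𝓝 (Ψ X))) : IsSchwarzChannel Ψ := by
  have hc : Continuous fun X : Op n => X.conjTranspose := by fun_prop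
  have ht : Continuous fun X : Op n => X.trace := by fun_prop
  have hm : Continuous fun X : Op n => X.conjTranspose * X := by fun_prop
  refine ⟨fun X => ?_, fun X => ?_, fun A => ?_⟩
  · refine tendsto_nhds_unique (h _) ?_
    exact (hc.continuousAt.tendsto.comp (h X)).congr fun t => ((hΦ t).map_conjTranspose X).symm
  · refine tendsto_nhds_unique (ht.continuousAt.tendsto.comp (h X)) ?_
    exact tendsto_const_nhds.congr fun t => ((hΦ t).trace_map X).symm
  · exact Matrix.PosSemidef.of_tendsto ((tendsto_hsAdjoint h _).sub
      (hm.continuousAt.tendsto.comp (tendsto_hsAdjoint h A))) fun t => (hΦ t).schwarz A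

end Adjoint

/-! ### Exponentials of superoperators -/

section SuperExp

variable {n : Type*} [Fintype n] [DecidableEq n]

theorem superExp_eq (L : SuperOp n) (t : ℝ) :
    superExp L t = Matrix.toLinAlgEquiv (Matrix.stdBasis ℂ n n) (NormedSpace.exp
      ((t : ℂ) • LinearMap.toMatrixAlgEquiv (Matrix.stdBasis ℂ n n) L)) := rfl

open scoped Matrix.Norms.L2Operator in
theorem superExp_hasSum (L : Module.End ℂ (Op n)) (t : ℝ) (X : Op n) :
    HasSum (fun k : ℕ => ((k.factorial : ℂ)⁻¹ * (t : ℂ) ^ k) • (L ^ k) X) (superExp L t X) := by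
  set b := Matrix.stdBasis ℂ n n
  have h := NormedSpace.exp_series_hasSum_exp' (𝕂 := ℂ)
    ((t : ℂ) • LinearMap.toMatrixAlgEquiv b L)
  let f : Matrix (n × n) (n × n) ℂ →ₗ[ℂ] Op n :=
    (LinearMap.applyₗ X) ∘ₗ (Matrix.toLinAlgEquiv b).toLinearMap
  have hf : Continuous f := LinearMap.continuous_of_finiteDimensional f
  have h2 := h.map f hf
  convert h2 using 1
  · funext k
    simp only [f, Function.comp_apply, LinearMap.comp_apply, map_smul, smul_pow, smul_smul,
      AlgEquiv.toLinearMap_apply, map_pow, Matrix.toLinAlgEquiv_toMatrixAlgEquiv,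
      LinearMap.applyₗ_apply_apply]
  · rfl

theorem superExp_zero (L : SuperOp n) : superExp L 0 = LinearMap.id := by
  rw [superExp_eq]; simp; rfl

open scoped Matrix.Norms.L2Operator in
theorem superExp_add (L : SuperOp n) (s t : ℝ) (X : Op n) :
    superExp L (s + t) X = superExp L s (superExp L t X) := by
  have h : superExp L (s + t) = (superExp L s * superExp L t : Module.End ℂ (Op n)) := by
    rw [superExp_eq, superExp_eq, superExp_eq, ← map_mul, ← Matrix.exp_add_of_commute]
    · push_cast; rw [add_smul]
    · exact (Commute.refl _).smul_left _ |>.smul_right _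
  rw [h]; rfl

theorem hsAdjoint_superExp (L : Module.End ℂ (Op n)) (t : ℝ) :
    hsAdjoint (superExp L t) = superExp (hsAdjoint L) t := by
  refine eq_hsAdjoint_of_trace fun X Y => ?_
  have h1 := superExp_hasSum L t X
  have h2 := superExp_hasSum (hsAdjoint L) t Y
  have c1 : Continuous fun Z : Op n => (Z.conjTranspose * Y).trace := by fun_prop
  have c2 : Continuous fun Z : Op n => (X.conjTranspose * Z).trace := by fun_prop
  have h3 := h1.map (AddMonoidHom.mk' (fun Z : Op n => (Z.conjTranspose * Y).trace)
    fun a b => by simp [Matrix.add_mul]) c1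
  have h4 := h2.map (AddMonoidHom.mk' (fun Z : Op n => (X.conjTranspose * Z).trace)
    fun a b => by simp [Matrix.mul_add]) c2
  refine h3.unique ?_
  convert h4 using 1
  · funext k
    simp only [Function.comp_apply, AddMonoidHom.mk'_apply, Matrix.conjTranspose_smul,
      Matrix.smul_mul, Matrix.mul_smul, Matrix.trace_smul, ← hsAdjoint_pow, trace_hsAdjoint]
    simp
  · rfl

theorem superExp_eigenvector {L : Module.End ℂ (Op n)} {a : ℂ} {x : Op n} (h : L x = a • x)
    (t : ℝ) : superExp L t x = Complex.exp (a * t) • x := by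
  refine (superExp_hasSum L t x).unique ?_
  have h1 : HasSum (fun k : ℕ => ((k.factorial : ℂ)⁻¹ • (a * t) ^ k)) (Complex.exp (a * t)) := by
    rw [Complex.exp_eq_exp_ℂ]; exact NormedSpace.exp_series_hasSum_exp' (𝕂 := ℂ) (a * (t : ℂ))
  convert h1.smul_const x using 1
  funext k
  have : ∀ k : ℕ, (L ^ k) x = a ^ k • x := fun k => by
    induction k with
    | zero => simp
    | succ k ih => rw [pow_succ', Module.End.mul_apply, ih, map_smul, h, smul_smul, pow_succ]
  rw [this, smul_smul, mul_pow, smul_eq_mul]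
  ring_nf

/-- On a Jordan chain of length two the exponential grows linearly. -/
theorem superExp_jordan {L : Module.End ℂ (Op n)} {a : ℂ} {y z : Op n} (hy : L y = a • y + z)
    (hz : L z = a • z) (t : ℝ) :
    superExp L t y = Complex.exp (a * t) • y + (t * Complex.exp (a * t)) • z := by
  have h1 : HasSum (fun k : ℕ => ((k.factorial : ℂ)⁻¹ • (a * t) ^ k)) (Complex.exp (a * t)) := by
    rw [Complex.exp_eq_exp_ℂ]; exact NormedSpace.exp_series_hasSum_exp' (𝕂 := ℂ) (a * (t : ℂ))
  have h2 : HasSum (fun k : ℕ => ((k.factorial : ℂ)⁻¹ * (t : ℂ) ^ k) * (k * a ^ (k - 1)))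
      (t * Complex.exp (a * t)) := by
    refine (hasSum_nat_add_iff' 1).1 ?_
    simp only [Finset.range_one, Finset.sum_singleton, Nat.cast_zero, zero_mul, mul_zero, sub_zero]
    have h3 := h1.mul_left (t : ℂ)
    rw [show (fun k : ℕ => (((k + 1).factorial : ℂ)⁻¹ * (t : ℂ) ^ (k + 1)) *
      (((k + 1 : ℕ) : ℂ) * a ^ (k + 1 - 1))) =
        fun k : ℕ => (t : ℂ) * ((k.factorial : ℂ)⁻¹ • (a * t) ^ k) from funext fun k => ?_]
    · exact h3
    rw [Nat.factorial_succ, smul_eq_mul, mul_pow, Nat.add_sub_cancel]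
    push_cast
    have : (k.factorial : ℂ) ≠ 0 := by exact_mod_cast k.factorial_ne_zero
    have h' : ((k : ℂ) + 1) ≠ 0 := by exact_mod_cast k.succ_ne_zero
    field_simp
    ring
  refine (superExp_hasSum L t y).unique ?_
  convert (h1.smul_const y).add (h2.smul_const z) using 1
  funext k
  have hz' : ∀ k : ℕ, (L ^ k) y = a ^ k • y + ((k : ℂ) * a ^ (k - 1)) • z := fun k => by
    induction k with
    | zero => simp
    | succ k ih =>
      rw [pow_succ', Module.End.mul_apply, ih, map_add, map_smul, map_smul, hy, hz]
      rcases k with _ | k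
      · simp
      · simp only [Nat.add_sub_cancel]
        push_cast
        module
  rw [hz', smul_add, smul_smul, smul_smul, mul_pow, smul_eq_mul]
  ring_nf

end SuperExp

/-! ### Evolution of a Markov process -/

namespace QMP

variable {n : Type*} [Fintype n] [DecidableEq n] (D : QMP n)

instance : Nonempty D.Time := ⟨0⟩

instance : IsDirectedOrder D.Time :=
  match D with
  | chain _ _ => inferInstanceAs (IsDirectedOrder ℕ)
  | semigroup _ _ => inferInstanceAs (IsDirectedOrder ℝ≥0)

instance : CanonicallyOrderedAdd D.Time :=
  match D with
  | chain _ _ => inferInstanceAs (CanonicallyOrderedAdd ℕ)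
  | semigroup _ _ => inferInstanceAs (CanonicallyOrderedAdd ℝ≥0)

theorem prop_isChannel (t : D.Time) : IsChannel (D.prop t) := by
  cases D with
  | chain T hT =>
    change IsChannel ((T : Module.End ℂ (Op n)) ^ (show ℕ from t))
    generalize (show ℕ from t) = k
    induction k with
    | zero => rw [pow_zero]; exact IsChannel.one
    | succ k ih => rw [pow_succ]; exact ih.mul hT
  | semigroup L hL => exact hL (show ℝ≥0 from t) (show ℝ≥0 from t).2

theorem prop_zero (X : Op n) : D.prop 0 X = X := by
  cases D with
  | chain T hT => rfl
  | semigroup L hL =>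
    change superExp L ((0 : ℝ≥0) : ℝ) X = X
    rw [NNReal.coe_zero, superExp_zero]; rfl

theorem prop_add (s t : D.Time) (X : Op n) : D.prop (s + t) X = D.prop s (D.prop t X) := by
  cases D with
  | chain T hT =>
    change ((T : Module.End ℂ (Op n)) ^ ((show ℕ from s) + (show ℕ from t))) X = _
    rw [pow_add]; rfl
  | semigroup L hL =>
    change superExp L (((show ℝ≥0 from s) + (show ℝ≥0 from t) : ℝ≥0) : ℝ) X = _
    rw [NNReal.coe_add, superExp_add]; rfl

/-- The evolution generated by an arbitrary superoperator `G` in the time of the process `D`. It is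
used for the generator of the process and for its adjoint. -/
noncomputable def flow : (D : QMP n) → Module.End ℂ (Op n) → D.Time → SuperOp n
  | chain _ _ => fun G (t : ℕ) => (G ^ t : Module.End ℂ (Op n))
  | semigroup _ _ => fun G (t : ℝ≥0) => superExp G t

theorem flow_gen (t : D.Time) : D.flow D.gen t = D.prop t := by
  cases D <;> rfl

theorem flow_hsAdjoint_gen (t : D.Time) : D.flow (hsAdjoint D.gen) t = hsAdjoint (D.prop t) := by
  cases D with
  | chain T hT => exact (hsAdjoint_pow T _).symm
  | semigroup L hL => exact (hsAdjoint_superExp L _).symm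

theorem flow_eigenvector {G : Module.End ℂ (Op n)} {a : ℂ} {x : Op n} (h : G x = a • x)
    (t : D.Time) : D.flow G t x = D.phase a t • x := by
  cases D with
  | chain T hT =>
    change (G ^ (show ℕ from t)) x = a ^ (show ℕ from t) • x
    generalize (show ℕ from t) = k
    induction k with
    | zero => simp
    | succ k ih => rw [pow_succ', Module.End.mul_apply, ih, map_smul, h, smul_smul, pow_succ]
  | semigroup L hL => exact superExp_eigenvector h _

omit [Fintype n] [DecidableEq n] in
/-- A sequence that grows linearly in the direction `z` is bounded only for `z = 0`. -/
theorem eq_zero_of_natCast_mul_norm_le {y z : Op n} {B : ℝ}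
    (h : ∀ (k : ℕ) i j, ∃ u v : ℂ, ‖u‖ = 1 ∧ ‖v‖ = 1 ∧
      ‖u * y i j + (k * v) * z i j‖ ≤ B) : z = 0 := by
  ext i j
  by_contra hz
  have hpos : 0 < ‖z i j‖ := norm_pos_iff.2 hz
  obtain ⟨k, hk⟩ := exists_nat_gt ((B + ‖y i j‖) / ‖z i j‖)
  rw [div_lt_iff₀ hpos] at hk
  obtain ⟨u, v, hu, hv, hB⟩ := h k i j
  have h1 : ‖((k : ℂ) * v) * z i j‖ = k * ‖z i j‖ := by simp [hv]
  have h2 := norm_sub_le (u * y i j + (k * v) * z i j) (u * y i j)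
  rw [add_sub_cancel_left, h1, norm_mul u, hu, one_mul] at h2
  linarith

/-- A bounded flow has no Jordan block for an asymptotic spectral parameter. -/
theorem flow_jordan {G : Module.End ℂ (Op n)} {a : ℂ} {y z : Op n}
    (ha : a ∈ D.asymptoticParam) (hy : G y = a • y + z)
    (hz : G z = a • z) (hb : ∃ B : ℝ, ∀ t i j, ‖D.flow G t y i j‖ ≤ B) : z = 0 := by
  obtain ⟨B, hb⟩ := hb
  cases D with
  | chain T hT =>
    have ha : ‖a‖ = 1 := ha
    have hz' : ∀ k : ℕ, (G ^ k) y = a ^ k • y + ((k : ℂ) * a ^ (k - 1)) • z := fun k => by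
      induction k with
      | zero => simp
      | succ k ih =>
        rw [pow_succ', Module.End.mul_apply, ih, map_add, map_smul, map_smul, hy, hz]
        rcases k with _ | k
        · simp
        · simp only [Nat.add_sub_cancel]
          push_cast
          module
    refine eq_zero_of_natCast_mul_norm_le (y := y) (B := B) fun k i j =>
      ⟨a ^ k, a ^ (k - 1), by simp [ha], by simp [ha], ?_⟩
    have h := hb (show ℕ from k) i j
    change ‖(G ^ k) y i j‖ ≤ B at h
    rw [hz'] at h
    exact h
  | semigroup L hL =>
    have ha : a.re = 0 := ha
    have h1 : ∀ k : ℕ, ‖Complex.exp (a * k)‖ = 1 := fun k => by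
      rw [Complex.norm_exp]; simp [ha]
    refine eq_zero_of_natCast_mul_norm_le (y := y) (B := B) fun k i j =>
      ⟨Complex.exp (a * k), Complex.exp (a * k), h1 k, h1 k, ?_⟩
    have h := hb (show ℝ≥0 from k) i j
    change ‖superExp G (((k : ℝ≥0) : ℝ)) y i j‖ ≤ B at h
    rw [superExp_jordan hy hz] at h
    simpa using h

theorem flow_apply_gen (G : Module.End ℂ (Op n)) (t : D.Time) (X : Op n) :
    D.flow G t (G X) = G (D.flow G t X) := by
  cases D with
  | chain T hT =>
    change (G ^ (show ℕ from t) * G) X = (G * G ^ (show ℕ from t)) X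
    rw [← pow_succ, ← pow_succ']
  | semigroup L hL =>
    have h1 := superExp_hasSum G ((show ℝ≥0 from t) : ℝ) (G X)
    have h2 := (superExp_hasSum G ((show ℝ≥0 from t) : ℝ) X).map G
      (LinearMap.continuous_of_finiteDimensional G)
    refine h1.unique ?_
    convert h2 using 1
    · funext k
      rw [Function.comp_apply, map_smul, ← Module.End.mul_apply, ← Module.End.mul_apply,
        ← pow_succ, ← pow_succ']
    · rfl

theorem norm_phase {a : ℂ} (ha : a ∈ D.asymptoticParam) (t : D.Time) : ‖D.phase a t‖ = 1 := by
  cases D with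
  | chain T hT =>
    have ha : ‖a‖ = 1 := ha
    change ‖a ^ (show ℕ from t)‖ = 1
    rw [norm_pow, ha, one_pow]
  | semigroup L hL =>
    have ha : a.re = 0 := ha
    change ‖Complex.exp (a * (((show ℝ≥0 from t) : ℝ) : ℂ))‖ = 1
    rw [Complex.norm_exp]; simp [ha]

/-- A bounded phase that is not asymptotic decays. -/
theorem tendsto_phase {a : ℂ} (ha : a ∉ D.asymptoticParam)
    (hb : ∃ B : ℝ, ∀ t, ‖D.phase a t‖ ≤ B) :
    Filter.Tendsto (D.phase a) Filter.atTop (𝓝 0) := by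
  obtain ⟨B, hb⟩ := hb
  cases D with
  | chain T hT =>
    have ha : ‖a‖ ≠ 1 := ha
    have hb : ∀ t : ℕ, ‖a ^ t‖ ≤ B := hb
    rcases ha.lt_or_gt with h | h
    · exact tendsto_pow_atTop_nhds_zero_of_norm_lt_one h
    · obtain ⟨k, hk⟩ := pow_unbounded_of_one_lt B h
      have := hb k
      rw [norm_pow] at this
      exact absurd this (not_le.2 hk)
  | semigroup L hL =>
    have ha : a.re ≠ 0 := ha
    have hn : ∀ t : ℝ≥0, ‖Complex.exp (a * ((t : ℝ) : ℂ))‖ = Real.exp (a.re * t) := fun t => by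
      rw [Complex.norm_exp]; simp
    have hb : ∀ t : ℝ≥0, ‖Complex.exp (a * ((t : ℝ) : ℂ))‖ ≤ B := hb
    rcases ha.lt_or_gt with h | h
    · change Filter.Tendsto (fun t : ℝ≥0 => Complex.exp (a * ((t : ℝ) : ℂ))) Filter.atTop (𝓝 0)
      rw [tendsto_zero_iff_norm_tendsto_zero]
      simp only [hn]
      refine Real.tendsto_exp_atBot.comp ?_
      exact (NNReal.tendsto_coe_atTop.2 Filter.tendsto_id).const_mul_atTop_of_neg h
    · obtain ⟨k, hk⟩ := exists_nat_gt (B / a.re)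
      rw [div_lt_iff₀ h] at hk
      have h1 := hb k
      rw [hn] at h1
      have h2 := Real.add_one_le_exp (a.re * ((k : ℝ≥0) : ℝ))
      rw [NNReal.coe_natCast] at h1 h2
      linarith

end QMP

/-! ### The asymptotic projection -/

namespace QMP

variable {n : Type*} [Fintype n] [DecidableEq n] (D : QMP n)

/-- `E` is an idempotent limit, along a filter `U` of times tending to infinity, of the bounded
evolution generated by `G`. It projects onto the asymptotic part of the evolution. -/
structure IsAsymptoticProjection (G E : Module.End ℂ (Op n)) (U : Filter D.Time) : Prop where
  neBot : U.NeBot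
  le_atTop : U ≤ Filter.atTop
  norm_flow_le : ∀ t X i j, ‖D.flow G t X i j‖ ≤ ∑ c, ∑ d, ‖X c d‖
  idem : ∀ X, E (E X) = E X
  tendsto : ∀ X, Filter.Tendsto (fun t => D.flow G t X) U (𝓝 (E X))

/-- The limit points of the evolution at infinite time form a compact semigroup under composition,
which therefore contains an idempotent. -/
theorem exists_isAsymptoticProjection : ∃ E U, D.IsAsymptoticProjection D.gen E U := by
  let _ : TopologicalSpace (Function.End (Op n)) :=
    Pi.topologicalSpace (Y := fun _ : Op n => Op n)
  have : T2Space (Function.End (Op n)) := Pi.t2Space (Y := fun _ : Op n => Op n)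
  -- composition is not jointly continuous in the pointwise topology, but it is continuous in its
  -- left factor, which suffices for the existence of an idempotent
  let T : D.Time → Function.End (Op n) := fun t => (D.prop t : Op n → Op n)
  let K : Set (Function.End (Op n)) := {f | MapClusterPt f Filter.atTop T}
  let C : Set (Function.End (Op n)) := Set.pi Set.univ fun X : Op n => Set.pi Set.univ fun a : n =>
    Set.pi Set.univ fun b : n => Metric.closedBall (0 : ℂ) (∑ c, ∑ d, ‖X c d‖)
  have hC : IsCompact C := isCompact_univ_pi fun X => isCompact_univ_pi fun a =>
    isCompact_univ_pi fun b => isCompact_closedBall _ _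
  have hTC : ∀ t, T t ∈ C := fun t X _ a _ b _ => by
    rw [mem_closedBall_zero_iff]; exact (D.prop_isChannel t).norm_apply_le X a b
  have hKC : K ⊆ C := fun f hf =>
    hC.isClosed.mem_of_mapClusterPt hf (Filter.Eventually.of_forall hTC)
  have hKclosed : IsClosed K := isClosed_setOfPred_clusterPt
  have hK : IsCompact K := hC.of_isClosed_subset hKclosed hKC
  have hKne : K.Nonempty := by
    obtain ⟨f, -, hf⟩ := hC.exists_mapClusterPt (f := Filter.atTop) (u := T) (by
      rw [Filter.le_principal_iff, Filter.mem_map]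
      exact Filter.univ_mem' hTC)
    exact ⟨f, hf⟩
  have hmul1 : ∀ t, ∀ g ∈ K, T t * g ∈ K := by
    intro t g hg
    have hc : Continuous fun f : Function.End (Op n) => T t * f := by
      refine continuous_pi fun X => ?_
      exact (LinearMap.continuous_of_finiteDimensional (D.prop t)).comp (continuous_apply X)
    have h1 : MapClusterPt (T t * g) Filter.atTop fun s => T t * T s :=
      hg.continuousAt_comp hc.continuousAt
    have h2 : (fun s => T t * T s) = T ∘ fun s => t + s := by
      funext s X; exact (D.prop_add t s X).symm
    rw [h2] at h1
    refine h1.of_comp (Filter.tendsto_atTop_mono (fun s => ?_) Filter.tendsto_id)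
    exact le_add_self
  have hmul : ∀ f ∈ K, ∀ g ∈ K, f * g ∈ K := by
    intro f hf g hg
    obtain ⟨U, hU, hUf⟩ := mapClusterPt_iff_ultrafilter.1 hf
    have hc : Continuous fun f : Function.End (Op n) => f * g :=
      continuous_pi fun X => continuous_apply (g X)
    exact hKclosed.mem_of_tendsto (hc.continuousAt.tendsto.comp hUf)
      (Filter.Eventually.of_forall fun t => hmul1 t g hg)
  obtain ⟨e, heK, hee⟩ := exists_idempotent_in_compact_subsemigroup
    (fun g : Function.End (Op n) => continuous_pi fun X => continuous_apply (g X)) K hKne hK hmul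
  obtain ⟨U, hU, hUe⟩ := mapClusterPt_iff_ultrafilter.1 heK
  refine ⟨linearMapOfTendsto (l := (U : Filter D.Time)) e (fun t => D.prop t) hUe, U,
    inferInstance, hU, fun t X i j => ?_, fun X => congrFun hee X, fun X => ?_⟩
  · rw [flow_gen]; exact (D.prop_isChannel t).norm_apply_le X i j
  · simp only [flow_gen]
    exact tendsto_pi_nhds.1 hUe X

namespace IsAsymptoticProjection

variable {D} {G E : Module.End ℂ (Op n)} {U : Filter D.Time}

/-- The Heisenberg evolution has the adjoint projection as its asymptotic projection. -/
theorem hsAdjoint_gen (hE : D.IsAsymptoticProjection D.gen E U) :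
    D.IsAsymptoticProjection (hsAdjoint D.gen) (hsAdjoint E) U where
  neBot := hE.neBot
  le_atTop := hE.le_atTop
  norm_flow_le t Y i j := by
    rw [flow_hsAdjoint_gen]
    change ‖((D.prop t (Matrix.single i j 1)).conjTranspose * Y).trace‖ ≤ _
    rw [Matrix.trace, Finset.sum_comm]
    refine (norm_sum_le _ _).trans (Finset.sum_le_sum fun d _ => ?_)
    rw [Matrix.diag_apply, Matrix.mul_apply]
    refine (norm_sum_le _ _).trans (Finset.sum_le_sum fun c _ => ?_)
    rw [norm_mul, Matrix.conjTranspose_apply, norm_star]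
    refine mul_le_of_le_one_left (norm_nonneg _)
      (((D.prop_isChannel t).norm_apply_le _ c d).trans ?_)
    rw [Finset.sum_eq_single i (fun b _ hb => ?_) (by simp),
      Finset.sum_eq_single j (fun b _ hb => ?_) (by simp)]
    · simp
    · simp [Matrix.single_apply_of_col_ne _ _ hb.symm]
    · simp [Matrix.single_apply_of_row_ne hb.symm]
  idem Y := by
    have h : E * E = E := LinearMap.ext hE.idem
    have h1 := hsAdjoint_mul E E
    rw [h] at h1
    exact (LinearMap.congr_fun h1 Y).symm
  tendsto Y := by
    simp only [flow_hsAdjoint_gen]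
    refine tendsto_hsAdjoint (fun X => ?_) Y
    simpa only [flow_gen] using hE.tendsto X

variable (hE : D.IsAsymptoticProjection G E U)
include hE

theorem apply_gen (X : Op n) : E (G X) = G (E X) := by
  have := hE.neBot
  refine tendsto_nhds_unique (hE.tendsto (G X)) ?_
  have hc : Continuous G := LinearMap.continuous_of_finiteDimensional G
  simp only [flow_apply_gen]
  exact hc.continuousAt.tendsto.comp (hE.tendsto X)

theorem eigenvector_mem_range {a : ℂ} (ha : a ∈ D.asymptoticParam) {x : Op n} (hx : G x = a • x) :
    E x = x := by
  have := hE.neBot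
  set y := x - E x with hy
  have hGy : G y = a • y := by rw [hy, map_sub, ← hE.apply_gen, hx, map_smul, smul_sub]
  have hEy : E y = 0 := by rw [hy, map_sub, hE.idem, sub_self]
  have h1 := hE.tendsto y
  simp only [D.flow_eigenvector hGy, hEy] at h1
  have h2 : y = 0 := by
    ext i j
    have h3 := ((tendsto_pi_nhds.1 (tendsto_pi_nhds.1 h1 i) j)).norm
    simp only [Matrix.smul_apply, norm_smul, D.norm_phase ha, one_mul, Matrix.zero_apply,
      norm_zero] at h3
    exact norm_eq_zero.1 (tendsto_nhds_unique tendsto_const_nhds h3)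
  rw [hy, sub_eq_zero] at h2
  exact h2.symm

theorem asymptoticParam_of_eigenvector {a : ℂ} {x : Op n} (hx : G x = a • x) (hEx : E x = x)
    (hx0 : x ≠ 0) : a ∈ D.asymptoticParam := by
  have := hE.neBot
  by_contra ha
  obtain ⟨i, j, hij⟩ : ∃ i j, x i j ≠ 0 := by
    by_contra! h
    exact hx0 (Matrix.ext h)
  have hpos : 0 < ‖x i j‖ := norm_pos_iff.2 hij
  have h1 : Filter.Tendsto (D.phase a) Filter.atTop (𝓝 0) := by
    refine D.tendsto_phase ha ⟨(∑ c, ∑ d, ‖x c d‖) / ‖x i j‖, fun t => ?_⟩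
    have := hE.norm_flow_le t x i j
    rwa [D.flow_eigenvector hx, Matrix.smul_apply, norm_smul, ← le_div_iff₀ hpos] at this
  have h2 := hE.tendsto x
  simp only [D.flow_eigenvector hx, hEx] at h2
  have h3 := (h1.mono_left hE.le_atTop).smul_const x
  rw [zero_smul] at h3
  exact hx0 (tendsto_nhds_unique h2 h3)

/-- Generalized eigenoperators in the range of `E` are eigenoperators: a Jordan chain in the range
would have an asymptotic parameter, and grow without bound. -/
theorem eigenvector_of_generalized {a : ℂ} (k : ℕ) {x : Op n} (hEx : E x = x)
    (hx : ((G - algebraMap ℂ _ a) ^ k) x = 0) : G x = a • x := by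
  induction k with
  | zero => simp only [pow_zero, Module.End.one_apply] at hx; simp [hx]
  | succ k ih =>
    rcases k with _ | k
    · simpa [sub_eq_zero, Algebra.algebraMap_eq_smul_one] using hx
    refine ih ?_
    set N := G - algebraMap ℂ (Module.End ℂ (Op n)) a with hN
    have hNx : ∀ z, G z = a • z + N z := fun z => by
      simp [hN, Algebra.algebraMap_eq_smul_one]
    have hEN : ∀ z, E z = z → E (N z) = N z := fun z hz => by
      simp [hN, Algebra.algebraMap_eq_smul_one, hE.apply_gen, hz]
    set y := (N ^ k) x with hy
    have hEy : E y = y := by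
      have : ∀ k : ℕ, E ((N ^ k) x) = (N ^ k) x := fun k => by
        induction k with
        | zero => simpa using hEx
        | succ k ih => rw [pow_succ', Module.End.mul_apply, hEN _ ih]
      exact this k
    have hy1 : (N ^ (k + 1)) x = N y := by rw [pow_succ', Module.End.mul_apply]
    have hy2 : N (N y) = 0 := by
      rw [← hy1, ← Module.End.mul_apply, ← pow_succ', hx]
    rw [hy1]
    have hz : G (N y) = a • N y := by rw [hNx, hy2, add_zero]
    by_contra h0
    have ha := hE.asymptoticParam_of_eigenvector hz (hEN y hEy) h0
    exact h0 (D.flow_jordan ha (hNx y) hz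
      ⟨∑ c, ∑ d, ‖y c d‖, fun t i j => hE.norm_flow_le t y i j⟩)

/-- The range of the asymptotic projection is spanned by the asymptotic eigenoperators. -/
theorem range_eq : LinearMap.range E =
    ⨆ a ∈ D.asymptoticParam, Module.End.eigenspace G a := by
  refine le_antisymm ?_ (iSup₂_le fun a ha x hx => ?_)
  · rw [LinearMap.range_eq_map, ← Module.End.iSup_maxGenEigenspace_eq_top G, Submodule.map_iSup]
    refine iSup_le fun a => ?_
    rintro _ ⟨x, hx, rfl⟩
    obtain ⟨k, hk⟩ := Module.End.mem_maxGenEigenspace G a x |>.1 hx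
    have hk' : ((G - algebraMap ℂ _ a) ^ k) (E x) = 0 := by
      have hcomm : ∀ k : ℕ, ∀ z, ((G - algebraMap ℂ _ a) ^ k) (E z) =
          E (((G - algebraMap ℂ _ a) ^ k) z) := fun k => by
        induction k with
        | zero => simp
        | succ k ih =>
          intro z
          rw [pow_succ, Module.End.mul_apply, Module.End.mul_apply, ← ih]
          simp [Algebra.algebraMap_eq_smul_one, hE.apply_gen]
      rw [hcomm, Algebra.algebraMap_eq_smul_one, hk, map_zero]
    have hG := hE.eigenvector_of_generalized k (hE.idem x) hk'
    by_cases h0 : E x = 0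
    · rw [h0]; exact Submodule.zero_mem _
    · have ha := hE.asymptoticParam_of_eigenvector hG (hE.idem x) h0
      exact Submodule.mem_iSup_of_mem a (Submodule.mem_iSup_of_mem ha
        (Module.End.mem_eigenspace_iff.2 hG))
  · exact ⟨x, hE.eigenvector_mem_range ha (Module.End.mem_eigenspace_iff.1 hx)⟩

end IsAsymptoticProjection

end QMP

/-! ### The set of states -/

section PositiveOperators

variable {n : Type*} [Fintype n] [DecidableEq n]

theorem Matrix.PosSemidef.mul_proj_eq_zero {A R : Op n} (hA : A.PosSemidef) (hR : R.IsHermitian)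
    (hRR : R * R = R) (h : (A * R).trace = 0) : A * R = 0 ∧ R * A = 0 := by
  have h1 : A * R = 0 := by
    obtain ⟨C, rfl⟩ := hA.exists_eq_conjTranspose_mul_self
    have h2 : ((C * R).conjTranspose * (C * R)).trace = 0 := by
      rw [Matrix.conjTranspose_mul, hR.eq, Matrix.mul_assoc, Matrix.trace_mul_comm, ← h]
      simp only [Matrix.mul_assoc, hRR]
    rw [Matrix.mul_assoc, Matrix.trace_conjTranspose_mul_self_eq_zero_iff.1 h2, Matrix.mul_zero]
  refine ⟨h1, ?_⟩
  have := congrArg Matrix.conjTranspose h1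
  rwa [Matrix.conjTranspose_mul, hR.eq, hA.1.eq, Matrix.conjTranspose_zero] at this

omit [DecidableEq n] in
theorem Matrix.IsHermitian.posSemidef_of_mul_self {R : Op n} (hR : R.IsHermitian)
    (hRR : R * R = R) : R.PosSemidef := by
  have := Matrix.posSemidef_conjTranspose_mul_self R
  rwa [hR.eq, hRR] at this

theorem IsDensity.norm_apply_le {ρ : Op n} (hρ : IsDensity ρ) (i j : n) : ‖ρ i j‖ ≤ 1 := by
  obtain ⟨C, rfl⟩ := hρ.1.exists_eq_conjTranspose_mul_self
  have htr : ∑ j, ∑ k, ‖C k j‖ ^ 2 = 1 := by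
    have h := hρ.2
    simp only [Matrix.trace, Matrix.diag_apply, Matrix.mul_apply, Matrix.conjTranspose_apply,
      Complex.star_def, Complex.conj_mul'] at h
    exact_mod_cast h
  have hcol : ∀ j, ∑ k, ‖C k j‖ ^ 2 ≤ 1 := fun j => by
    rw [← htr]
    exact Finset.single_le_sum (f := fun j => ∑ k, ‖C k j‖ ^ 2)
      (fun i _ => Finset.sum_nonneg fun k _ => by positivity) (Finset.mem_univ j)
  rw [Matrix.mul_apply]
  refine (norm_sum_le _ _).trans ?_
  have h2 : ∀ k, ‖C.conjTranspose i k * C k j‖ ≤ (‖C k i‖ ^ 2 + ‖C k j‖ ^ 2) / 2 := fun k => by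
    rw [norm_mul, Matrix.conjTranspose_apply, norm_star]
    nlinarith [sq_nonneg (‖C k i‖ - ‖C k j‖)]
  refine (Finset.sum_le_sum fun k _ => h2 k).trans ?_
  rw [← Finset.sum_div, Finset.sum_add_distrib]
  linarith [hcol i, hcol j]

omit [DecidableEq n] in
theorem isClosed_setOf_isDensity : IsClosed {ρ : Op n | IsDensity ρ} := by
  refine isClosed_of_closure_subset fun y hy => ?_
  have := mem_closure_iff_comap_neBot.1 hy
  have hxy := Filter.tendsto_comap (f := ((↑) : {ρ : Op n | IsDensity ρ} → Op n)) (x := 𝓝 y)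
  refine ⟨Matrix.PosSemidef.of_tendsto hxy fun k => k.2.1, ?_⟩
  have ht : Continuous fun X : Op n => X.trace := by fun_prop
  exact tendsto_nhds_unique (ht.continuousAt.tendsto.comp hxy)
    (tendsto_const_nhds.congr fun k => k.2.2.symm)

theorem isCompact_setOf_isDensity : IsCompact {ρ : Op n | IsDensity ρ} := by
  have hC : IsCompact (Set.pi Set.univ fun _ : n => Set.pi Set.univ fun _ : n =>
      Metric.closedBall (0 : ℂ) 1) := isCompact_univ_pi fun a =>
    isCompact_univ_pi fun b => isCompact_closedBall _ _
  refine hC.of_isClosed_subset isClosed_setOf_isDensity fun ρ hρ i _ j _ => ?_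
  rw [mem_closedBall_zero_iff]
  exact hρ.norm_apply_le i j

open scoped Matrix.Norms.L2Operator MatrixOrder in
theorem LinearMap.ext_posSemidef {V : Type*} [AddCommGroup V] [Module ℂ V] {f g : Op n →ₗ[ℂ] V}
    (h : ∀ X : Op n, X.PosSemidef → f X = g X) : f = g :=
  LinearMap.ext_on CStarAlgebra.span_nonneg fun X hX => h X (Matrix.nonneg_iff_posSemidef.1 hX)

theorem ext_of_density {f g : Op n →ₗ[ℂ] ℂ} (h : ∀ X : Op n, IsDensity X → f X = g X) : f = g := by
  refine LinearMap.ext_posSemidef fun X hX => ?_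
  by_cases h0 : X.trace = 0
  · rw [hX.trace_eq_zero_iff.1 h0, map_zero, map_zero]
  · have h1 : IsDensity (X.trace⁻¹ • X) := by
      refine ⟨hX.smul ?_, by simp [h0]⟩
      exact inv_nonneg.2 hX.trace_nonneg
    have h2 := h _ h1
    rw [map_smul, map_smul] at h2
    exact smul_right_injective _ (inv_ne_zero h0) h2

/-- Linear functionals on operators are given by the Hilbert-Schmidt pairing. -/
theorem exists_trace_eq (f : Op n →ₗ[ℂ] ℂ) :
    ∃ Y : Op n, ∀ X, (Y.conjTranspose * X).trace = f X := by
  refine ⟨Matrix.of fun i j => star (f (Matrix.single i j 1)), fun X => ?_⟩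
  conv_rhs => rw [Matrix.matrix_eq_sum_single X]
  simp only [Matrix.trace, Matrix.diag_apply, Matrix.mul_apply, Matrix.conjTranspose_apply,
    Matrix.of_apply, star_star, map_sum]
  rw [Finset.sum_comm]
  refine Finset.sum_congr rfl fun i _ => Finset.sum_congr rfl fun j _ => ?_
  have h : Matrix.single i j (X i j) = X i j • Matrix.single i j 1 := by simp
  rw [h, map_smul, smul_eq_mul, mul_comm]

end PositiveOperators

/-! ### Asymptotic trajectories and the T-projector -/

namespace QMP

variable {n : Type*} [Fintype n] [DecidableEq n] (D : QMP n)

theorem prop_comm (s t : D.Time) (X : Op n) : D.prop s (D.prop t X) = D.prop t (D.prop s X) := by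
  rw [← prop_add, ← prop_add, add_comm]

theorem prop_isSchwarzChannel (t : D.Time) : IsSchwarzChannel (D.prop t) :=
  (D.prop_isChannel t).isSchwarzChannel

/-- The Markov-Kakutani fixed point theorem for the evolution of a process. -/
theorem exists_fixed_point {K : Set (Op n)} (hconv : Convex ℝ K) (hcomp : IsCompact K)
    (hne : K.Nonempty) (hinv : ∀ t, ∀ x ∈ K, D.prop t x ∈ K) :
    ∃ x ∈ K, ∀ t, D.prop t x = x := by
  let T : D.Time → Module.End ℂ (Op n) := fun t => D.prop t
  have hTcomm : ∀ s t, Commute (T s) (T t) := fun s t => LinearMap.ext fun X => D.prop_comm s t X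
  -- `A (N, t)` is the average of the first `N + 1` powers of the evolution by `t`
  let A : ℕ × D.Time → Module.End ℂ (Op n) := fun i =>
    ((i.1 + 1 : ℝ)⁻¹ : ℂ) • ∑ k ∈ Finset.range (i.1 + 1), T i.2 ^ k
  have hpow : ∀ t (k : ℕ), ∀ x ∈ K, (T t ^ k) x ∈ K := by
    intro t k
    induction k with
    | zero => intro x hx; simpa using hx
    | succ k ih => intro x hx; rw [pow_succ, Module.End.mul_apply]; exact ih _ (hinv t x hx)
  have hAapp : ∀ i x, A i x = ∑ k ∈ Finset.range (i.1 + 1), (i.1 + 1 : ℝ)⁻¹ • (T i.2 ^ k) x := by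
    intro i x
    simp only [A, LinearMap.smul_apply, LinearMap.sum_apply, Finset.smul_sum]
    refine Finset.sum_congr rfl fun k _ => ?_
    rw [← Complex.coe_smul]; push_cast; rfl
  have hAK : ∀ i, ∀ x ∈ K, A i x ∈ K := by
    intro i x hx
    rw [hAapp]
    refine hconv.sum_mem (fun k _ => by positivity) ?_ fun k _ => hpow _ k x hx
    rw [Finset.sum_const, Finset.card_range, nsmul_eq_mul]
    push_cast
    exact mul_inv_cancel₀ (by positivity)
  -- finitely many images `A i '' K` have a common point, as the averages commute
  have hfin : ∀ u : Finset (ℕ × D.Time), ∃ B : Module.End ℂ (Op n), (∀ x ∈ K, B x ∈ K) ∧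
      (∀ t, Commute B (T t)) ∧ ∀ i ∈ u, ∀ x ∈ K, B x ∈ A i '' K := by
    classical
    intro u
    induction u using Finset.induction_on with
    | empty => exact ⟨1, fun x hx => hx, fun t => Commute.one_left _, by simp⟩
    | insert i u hi ih =>
      obtain ⟨B, hBK, hBT, hBu⟩ := ih
      have hAT : ∀ t, Commute (A i) (T t) := fun t =>
        (Commute.sum_left _ _ _ fun k _ => (hTcomm _ _).pow_left k).smul_left _
      have hBA : Commute B (A i) :=
        (Commute.sum_right _ _ _ fun k _ => (hBT _).pow_right k).smul_right _
      refine ⟨A i * B, fun x hx => hAK i _ (hBK x hx), fun t => (hAT t).mul_left (hBT t),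
        fun j hj x hx => ?_⟩
      rcases Finset.mem_insert.1 hj with rfl | hj
      · exact ⟨B x, hBK x hx, rfl⟩
      · rw [← hBA.eq]
        exact hBu j hj _ (hAK i x hx)
  obtain ⟨x, hxK, hx⟩ := hcomp.inter_iInter_nonempty (fun i => A i '' K)
    (fun i => (hcomp.image (LinearMap.continuous_of_finiteDimensional (A i))).isClosed) fun u => by
      obtain ⟨B, hBK, -, hBu⟩ := hfin u
      obtain ⟨y, hy⟩ := hne
      exact ⟨B y, hBK y hy, Set.mem_iInter₂.2 fun i hi => hBu i hi y hy⟩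
  refine ⟨x, hxK, fun t => ?_⟩
  have hc : Continuous fun X : Op n => ∑ i, ∑ j, ‖X i j‖ := by fun_prop
  obtain ⟨R, hR⟩ := hcomp.bddAbove_image hc.continuousOn
  have hR' : ∀ y ∈ K, ∀ i j, ‖y i j‖ ≤ R := fun y hy i j =>
    (Finset.single_le_sum (f := fun j => ‖y i j‖) (fun _ _ => norm_nonneg _)
      (Finset.mem_univ j)).trans ((Finset.single_le_sum (f := fun i => ∑ j, ‖y i j‖)
      (fun _ _ => Finset.sum_nonneg fun _ _ => norm_nonneg _) (Finset.mem_univ i)).trans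
      (hR ⟨y, hy, rfl⟩))
  -- a point in the image of `A (N, t)` is moved by `t` by at most the diameter over `N + 1`
  have hbound : ∀ (N : ℕ) i j, (N + 1 : ℝ) * ‖(T t x - x) i j‖ ≤ 2 * R := by
    intro N i j
    obtain ⟨y, hyK, hy⟩ := Set.mem_iInter.1 hx (N, t)
    have h1 : (N + 1 : ℂ) • (T t x - x) = (T t ^ (N + 1)) y - y := by
      have h2 : (N + 1 : ℂ) • x = ∑ k ∈ Finset.range (N + 1), (T t ^ k) y := by
        rw [← hy]
        simp only [A, LinearMap.smul_apply, LinearMap.sum_apply, smul_smul]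
        push_cast
        rw [mul_inv_cancel₀ (by exact_mod_cast N.succ_ne_zero), one_smul]
      have h3 := congrArg (fun f : Module.End ℂ (Op n) => f y)
        (mul_geom_sum (T t) (N + 1))
      simp only [Module.End.mul_apply, LinearMap.sub_apply, LinearMap.sum_apply,
        Module.End.one_apply] at h3
      rw [smul_sub, ← map_smul, h2, h3]
    have h4 := congrFun (congrFun h1 i) j
    rw [Matrix.smul_apply, smul_eq_mul] at h4
    have h5 := congrArg norm h4
    rw [norm_mul] at h5
    have h6 : ‖(N + 1 : ℂ)‖ = N + 1 := by
      have : (N + 1 : ℂ) = ((N + 1 : ℝ) : ℂ) := by push_cast; rfl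
      rw [this, Complex.norm_real, Real.norm_of_nonneg (by positivity)]
    rw [h6] at h5
    rw [h5, Matrix.sub_apply]
    refine (norm_sub_le _ _).trans ?_
    linarith [hR' _ (hpow t (N + 1) y hyK) i j, hR' y hyK i j]
  refine sub_eq_zero.1 (Matrix.ext fun i j => ?_)
  by_contra h0
  have hpos : 0 < ‖(T t x - x) i j‖ := norm_pos_iff.2 h0
  obtain ⟨N, hN⟩ := exists_nat_gt (2 * R / ‖(T t x - x) i j‖)
  rw [div_lt_iff₀ hpos] at hN
  have := hbound N i j
  linarith

namespace IsAsymptoticProjection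

variable {D} {E : Module.End ℂ (Op n)} {U : Filter D.Time}
  (hE : D.IsAsymptoticProjection D.gen E U)
include hE

theorem tendsto_prop (X : Op n) : Filter.Tendsto (fun t => D.prop t X) U (𝓝 (E X)) := by
  simpa only [flow_gen] using hE.tendsto X

theorem isSchwarzChannel : IsSchwarzChannel E := by
  have := hE.neBot
  exact IsSchwarzChannel.of_tendsto D.prop_isSchwarzChannel hE.tendsto_prop

theorem apply_prop (t : D.Time) (X : Op n) : E (D.prop t X) = D.prop t (E X) := by
  have := hE.neBot
  refine tendsto_nhds_unique (hE.tendsto_prop _) ?_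
  simp only [D.prop_comm _ t]
  exact (LinearMap.continuous_of_finiteDimensional (D.prop t)).continuousAt.tendsto.comp
    (hE.tendsto_prop X)

theorem adjoint_apply_prop (t : D.Time) (Y : Op n) :
    hsAdjoint E (hsAdjoint (D.prop t) Y) = hsAdjoint (D.prop t) (hsAdjoint E Y) := by
  have h : E * (D.prop t : Module.End ℂ (Op n)) = (D.prop t : Module.End ℂ (Op n)) * E :=
    LinearMap.ext fun X => hE.apply_prop t X
  have h1 := congrArg hsAdjoint h
  rw [hsAdjoint_mul, hsAdjoint_mul] at h1
  exact (LinearMap.congr_fun h1 Y).symm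

/-- Along the filter `U` the evolution of `X - E X` tends to zero, and the uniform bound
extends this to all times. -/
theorem tendsto_prop_sub (X : Op n) :
    Filter.Tendsto (fun t => D.prop t X - D.prop t (E X)) Filter.atTop (𝓝 0) := by
  have := hE.neBot
  set y := X - E X with hy
  have h0 : Filter.Tendsto (fun t => ∑ c, ∑ d, ‖D.prop t y c d‖) U (𝓝 0) := by
    have hc : Continuous fun X : Op n => ∑ i, ∑ j, ‖X i j‖ := by fun_prop
    have h1 := hc.continuousAt.tendsto.comp (hE.tendsto_prop y)
    have hEy : E y = 0 := by rw [hy, map_sub, hE.idem, sub_self]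
    rw [hEy] at h1
    simpa only [Function.comp_def, Matrix.zero_apply, norm_zero, Finset.sum_const_zero] using h1
  simp only [← map_sub, ← hy]
  refine tendsto_pi_nhds.2 fun i => tendsto_pi_nhds.2 fun j => ?_
  refine Metric.tendsto_nhds.2 fun ε hε => ?_
  obtain ⟨s, hs⟩ := (h0.eventually (gt_mem_nhds hε)).exists
  filter_upwards [Filter.eventually_ge_atTop s] with t hst
  obtain ⟨r, rfl⟩ := exists_add_of_le hst
  rw [Matrix.zero_apply, dist_zero_right, add_comm, prop_add]
  exact ((D.prop_isChannel r).norm_apply_le _ i j).trans_lt hs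

theorem mem_attractorSpace_iff {X : Op n} : X ∈ D.attractorSpace ↔ E X = X := by
  rw [attractorSpace, ← hE.range_eq]
  exact ⟨fun ⟨Y, hY⟩ => by rw [← hY, hE.idem], fun h => ⟨X, h⟩⟩

theorem mem_dualAttractorSpace_iff {Y : Op n} : Y ∈ D.dualAttractorSpace ↔ hsAdjoint E Y = Y := by
  rw [dualAttractorSpace, ← hE.hsAdjoint_gen.range_eq]
  exact ⟨fun ⟨Z, hZ⟩ => by rw [← hZ, hE.hsAdjoint_gen.idem], fun h => ⟨Y, h⟩⟩

/-- The evolution is injective on the attractor space. -/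
theorem eq_zero_of_prop_eq_zero {X : Op n} (hX : E X = X) {t : D.Time} (h : D.prop t X = 0) :
    X = 0 := by
  have := hE.neBot
  rw [← hX]
  refine tendsto_nhds_unique (hE.tendsto_prop X) (Filter.EventuallyEq.tendsto ?_)
  filter_upwards [hE.le_atTop (Filter.eventually_ge_atTop t)] with s hs
  obtain ⟨r, rfl⟩ := exists_add_of_le hs
  rw [add_comm, prop_add, h, map_zero]

theorem eq_zero_of_adjoint_prop_eq_zero {Y : Op n} (hY : hsAdjoint E Y = Y) {t : D.Time}
    (h : hsAdjoint (D.prop t) Y = 0) : Y = 0 := by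
  have := hE.neBot
  rw [← hY]
  refine tendsto_nhds_unique (tendsto_hsAdjoint hE.tendsto_prop Y) (Filter.EventuallyEq.tendsto ?_)
  filter_upwards [hE.le_atTop (Filter.eventually_ge_atTop t)] with s hs
  obtain ⟨r, rfl⟩ := exists_add_of_le hs
  have h1 : D.prop (t + r) = ((D.prop t : Module.End ℂ (Op n)) * D.prop r : Module.End ℂ (Op n)) :=
    LinearMap.ext fun X => D.prop_add t r X
  rw [h1, hsAdjoint_mul, Module.End.mul_apply, h, map_zero]

/-- The asymptotic trajectory does not depend on the basis of the attractor space that defines it. -/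
theorem eq_prop_of_isAsymptoticTrajectory {ρ₀ : Op n} {ρ : D.Time → Op n}
    (h : D.IsAsymptoticTrajectory ρ₀ ρ) (t : D.Time) : ρ t = D.prop t (E ρ₀) := by
  obtain ⟨m, a, X, Y, hb, hρ⟩ := h
  have hmem : E ρ₀ ∈ Submodule.span ℂ (Set.range X) := by
    rw [hb.span_eq, hE.mem_attractorSpace_iff, hE.idem]
  obtain ⟨c, hc⟩ := (Submodule.mem_span_range_iff_exists_fun ℂ).1 hmem
  have hcoef : ∀ k, ((Y k).conjTranspose * ρ₀).trace = c k := fun k => by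
    have h1 := trace_hsAdjoint E ρ₀ (Y k)
    rw [hE.mem_dualAttractorSpace_iff.1 (hb.dual_mem k)] at h1
    have h2 := congrArg star h1
    simp only [← Matrix.trace_conjTranspose, Matrix.conjTranspose_mul,
      Matrix.conjTranspose_conjTranspose] at h2
    rw [← h2, ← hc]
    simp [Finset.mul_sum, Matrix.trace_sum, hb.dual]
  rw [hρ, ← hc, map_sum]
  refine Finset.sum_congr rfl fun k _ => ?_
  rw [hcoef, map_smul, ← flow_gen, D.flow_eigenvector (hb.eigen k), smul_smul, mul_comm]

/-- The dual basis exists in the Heisenberg attractor space: any dual operators may be replaced by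
their images under `E†`. -/
theorem exists_attractorBasis : ∃ (m : ℕ) (a : Fin m → ℂ) (X Y : Fin m → Op n),
    D.IsAttractorBasis a X Y := by
  let s : Set (Op n) := {x | ∃ a ∈ D.asymptoticParam, D.gen x = a • x}
  have hs : Submodule.span ℂ s = D.attractorSpace := by
    refine le_antisymm (Submodule.span_le.2 ?_) (iSup₂_le fun a ha x hx =>
      Submodule.subset_span ⟨a, ha, Module.End.mem_eigenspace_iff.1 hx⟩)
    rintro x ⟨a, ha, hx⟩
    exact Submodule.mem_iSup_of_mem a (Submodule.mem_iSup_of_mem ha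
        (Module.End.mem_eigenspace_iff.2 hx))
  obtain ⟨b, hbs, hspan, hli⟩ := exists_linearIndependent ℂ s
  have hfin : Finite b := hli.setFinite
  obtain ⟨m, ⟨e⟩⟩ := Finite.exists_equiv_fin b
  let X : Fin m → Op n := fun k => e.symm k
  have hX : LinearIndependent ℂ X := hli.comp _ e.symm.injective
  have hrange : Set.range X = b := by
    rw [show X = Subtype.val ∘ e.symm from rfl, e.symm.surjective.range_comp, Subtype.range_coe]
  have hXs : ∀ k, X k ∈ s := fun k => hbs (e.symm k).2
  choose a ha hXa using hXs
  have hsp : Submodule.span ℂ (Set.range X) = D.attractorSpace := by rw [hrange, hspan, hs]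
  have hEX : ∀ k, E (X k) = X k := fun k => by
    rw [← hE.mem_attractorSpace_iff, ← hsp]
    exact Submodule.subset_span ⟨k, rfl⟩
  have hdual : ∀ k, ∃ Y : Op n, ∀ l, (Y.conjTranspose * X l).trace = if k = l then 1 else 0 := by
    intro k
    obtain ⟨f, hf⟩ := LinearMap.exists_extend (Finsupp.lapply k ∘ₗ hX.repr)
    obtain ⟨Y, hY⟩ := exists_trace_eq f
    refine ⟨Y, fun l => ?_⟩
    rw [hY]
    have h1 := LinearMap.congr_fun hf ⟨X l, Submodule.subset_span ⟨l, rfl⟩⟩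
    simp only [LinearMap.comp_apply, Submodule.subtype_apply] at h1
    rw [h1, hX.repr_eq_single l _ rfl, Finsupp.lapply_apply,
      Finsupp.single_apply]
    simp [eq_comm]
  choose Y hY using hdual
  refine ⟨m, a, X, fun k => hsAdjoint E (Y k), ha, hXa, hX, hsp, fun k => ?_, fun k l => ?_⟩
  · rw [hE.mem_dualAttractorSpace_iff, hE.hsAdjoint_gen.idem]
  · have h1 := trace_hsAdjoint E (X l) (Y k)
    have h2 := congrArg star h1
    simp only [← Matrix.trace_conjTranspose, Matrix.conjTranspose_mul,
      Matrix.conjTranspose_conjTranspose] at h2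
    rw [← h2, hEX, hY]

/-- The trajectory of the projected state is the asymptotic trajectory. -/
theorem isAsymptoticTrajectory (ρ₀ : Op n) :
    D.IsAsymptoticTrajectory ρ₀ fun t => D.prop t (E ρ₀) := by
  obtain ⟨m, a, X, Y, hb⟩ := hE.exists_attractorBasis
  exact ⟨m, a, X, Y, hb, fun t => (hE.eq_prop_of_isAsymptoticTrajectory
    ⟨m, a, X, Y, hb, fun _ => rfl⟩ t).symm⟩

omit hE in
/-- An invariant state with the support of the T-projector `P` is faithful on the range of `P`. -/
theorem exists_faithful_invariant {P : Op n} (hP : D.IsTProjector P) :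
    ∃ τ : Op n, IsDensity τ ∧ (∀ t, D.prop t τ = τ) ∧ P * τ = τ ∧ (τ + (1 - P)).PosDef := by
  obtain ⟨hPh, hPP, τ, hτ, hsupp⟩ := hP
  exact ⟨τ, hτ.1.1, hτ.1.2, (opSupport_le_iff hPP).1 hsupp.ge,
    posDef_add_compl_of_opSupport_eq hτ.1.1.1 hPh hPP hsupp.symm⟩

/-- The asymptotic states live on the range of the T-projector `P`: the limit `E† (1 - P)` is a
positive fixed point of the Heisenberg evolution, orthogonal to every invariant state, hence it
vanishes by the fixed point theorem. -/
theorem proj_mul_apply {P : Op n} (hP : D.IsTProjector P) (X : Op n) : P * E X = E X := by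
  have := hE.neBot
  obtain ⟨τ, hτ, hτinv, hPτ, hτpos⟩ := exists_faithful_invariant hP
  obtain ⟨hPh, hPP, τ', hτ', hsupp⟩ := hP
  have hch := hE.isSchwarzChannel
  set R := 1 - P with hR
  have hRh : R.IsHermitian := Matrix.isHermitian_one.sub hPh
  have hRR : R * R = R := by simp [hR, Matrix.mul_sub, Matrix.sub_mul, hPP]
  have hPR : P * R = 0 := by simp [hR, Matrix.mul_sub, hPP]
  have hRP : R * P = 0 := by simp [hR, Matrix.sub_mul, hPP]
  have hPsR : P = 1 - R := by simp [hR]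
  have hRpos := hRh.posSemidef_of_mul_self hRR
  have hτP : τ * P = τ := by
    have := congrArg Matrix.conjTranspose hPτ
    rwa [Matrix.conjTranspose_mul, hPh.eq, hτ.1.1.eq] at this
  -- a Schwarz channel with the invariant state `τ` can only lose weight outside of `P`
  have key : ∀ Φ : SuperOp n, IsSchwarzChannel Φ → Φ τ = τ →
      hsAdjoint Φ R * P = 0 ∧ (R - hsAdjoint Φ R).PosSemidef := by
    intro Φ hΦ hΦτ
    set S := hsAdjoint Φ R with hS
    have hSpos : S.PosSemidef := hΦ.adjoint_posSemidef hRpos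
    have h1 : (τ * S).trace = 0 := by
      rw [hS, ← trace_mul_hsAdjoint hΦ.map_conjTranspose, hΦτ, ← hτP, Matrix.mul_assoc, hPR]
      simp
    have h2 : P * S * P = 0 := by
      have hpsd : (P * S * P).PosSemidef := by
        have := hSpos.mul_mul_conjTranspose_same P
        rwa [hPh.eq] at this
      refine hτpos.eq_zero_of_trace_mul_eq_zero hpsd ?_
      rw [Matrix.add_mul, Matrix.trace_add, ← Matrix.mul_assoc, ← Matrix.mul_assoc, hτP,
        ← Matrix.mul_assoc, ← Matrix.mul_assoc, hRP, Matrix.trace_mul_comm,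
        ← Matrix.mul_assoc, hPτ, h1]
      simp
    have h3 : S * P = 0 ∧ P * S = 0 := hSpos.mul_proj_eq_zero hPh hPP (by
      rw [← hPP, ← Matrix.mul_assoc, Matrix.trace_mul_comm, ← Matrix.mul_assoc, h2]; simp)
    refine ⟨h3.1, ?_⟩
    have h4 : R - S = R * (1 - S) * R := by
      have h5 : S * R = S := by rw [hR, Matrix.mul_sub, h3.1]; simp
      have h6 : R * S = S := by rw [hR, Matrix.sub_mul, h3.2]; simp
      rw [Matrix.mul_sub R, Matrix.sub_mul (R * 1), Matrix.mul_one, hRR, h6, h5]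
    have h7 : (1 - S).PosSemidef := by
      have h8 := hΦ.adjoint_posSemidef (hPh.posSemidef_of_mul_self hPP)
      rwa [hPsR, map_sub, hΦ.adjoint_one] at h8
    rw [h4]
    have := h7.mul_mul_conjTranspose_same R
    rwa [hRh.eq] at this
  have hEτ : E τ = τ := tendsto_nhds_unique (hE.tendsto_prop τ) (by simp [hτinv])
  set S := hsAdjoint E R with hS
  have hSpos : S.PosSemidef := hch.adjoint_posSemidef hRpos
  obtain ⟨hSP, -⟩ := key E hch hEτ
  have hdecr : ∀ t, (S - hsAdjoint (D.prop t) S).PosSemidef := fun t => by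
    have h := hch.adjoint_posSemidef (key _ (D.prop_isSchwarzChannel t) (hτinv t)).2
    rwa [map_sub, hE.adjoint_apply_prop] at h
  -- `S` decreases in the Heisenberg evolution and recurs along `U`
  have hfix : ∀ t, hsAdjoint (D.prop t) S = S := by
    intro t
    have htr : ∀ r, (hsAdjoint (D.prop (t + r)) S).trace ≤ (hsAdjoint (D.prop t) S).trace := by
      intro r
      have h1 : D.prop (r + t) =
          ((D.prop r : Module.End ℂ (Op n)) * D.prop t : Module.End ℂ (Op n)) :=
        LinearMap.ext fun X => D.prop_add r t X
      have h2 := ((D.prop_isSchwarzChannel t).adjoint_posSemidef (hdecr r)).trace_nonneg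
      rw [map_sub, Matrix.trace_sub, sub_nonneg] at h2
      rw [add_comm, h1, hsAdjoint_mul, Module.End.mul_apply]
      exact h2
    have hlim : Filter.Tendsto (fun s => (hsAdjoint (D.prop s) S).trace) U (𝓝 S.trace) := by
      have hc : Continuous fun X : Op n => X.trace := by fun_prop
      have h1 := hc.continuousAt.tendsto.comp (tendsto_hsAdjoint hE.tendsto_prop S)
      have h2 : hsAdjoint E S = S := hE.hsAdjoint_gen.idem R
      rwa [h2] at h1
    have h1 : S.trace ≤ (hsAdjoint (D.prop t) S).trace := by
      refine le_of_tendsto hlim ?_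
      filter_upwards [hE.le_atTop (Filter.eventually_ge_atTop t)] with s hs
      obtain ⟨r, rfl⟩ := exists_add_of_le hs
      exact htr r
    have h2 := (hdecr t).trace_nonneg
    rw [Matrix.trace_sub, sub_nonneg] at h2
    have h3 := (hdecr t).trace_eq_zero_iff.1 (by
      rw [Matrix.trace_sub, sub_eq_zero]; exact le_antisymm h1 h2)
    exact (sub_eq_zero.1 h3).symm
  have hS0 : S = 0 := by
    have hzero : ∀ ρ, IsDensity ρ → (S * ρ).trace = 0 := by
      intro ρ hρ
      let f : Op n →ₗ[ℂ] ℂ := Matrix.traceLinearMap n ℂ ℂ ∘ₗ LinearMap.mulLeft ℂ S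
      have hf : Continuous f := LinearMap.continuous_of_finiteDimensional f
      -- an invariant state with the expectation of `S` in `ρ`
      obtain ⟨ω, ⟨hω, hωf⟩, hωinv⟩ := D.exists_fixed_point
        (K := {ω | IsDensity ω} ∩ f ⁻¹' {f ρ})
        (by
          rintro x ⟨hx, hxf⟩ y ⟨hy, hyf⟩ a b ha hb hab
          have hab' : (a : ℂ) + b = 1 := by exact_mod_cast hab
          refine ⟨⟨(hx.1.smul ha).add (hy.1.smul hb), ?_⟩, ?_⟩
          · rw [Matrix.trace_add, Matrix.trace_smul, Matrix.trace_smul, hx.2, hy.2]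
            simpa using hab'
          · simp only [Set.mem_preimage, Set.mem_singleton_iff] at hxf hyf ⊢
            rw [← Complex.coe_smul a x, ← Complex.coe_smul b y, map_add, map_smul, map_smul,
              hxf, hyf, ← add_smul, hab', one_smul])
        (isCompact_setOf_isDensity.inter_right (isClosed_singleton.preimage hf))
        ⟨ρ, hρ, rfl⟩
        (by
          rintro t x ⟨hx, hxf⟩
          refine ⟨(D.prop_isSchwarzChannel t).isDensity hx, ?_⟩
          simp only [Set.mem_preimage, Set.mem_singleton_iff] at hxf ⊢
          rw [← hxf]
          change (S * D.prop t x).trace = (S * x).trace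
          rw [Matrix.trace_mul_comm,
            trace_mul_hsAdjoint (D.prop_isSchwarzChannel t).map_conjTranspose, hfix,
            Matrix.trace_mul_comm])
      have hPω : P * ω = ω :=
        (opSupport_le_iff hPP).1 ((hτ'.2 ω ⟨hω, hωinv⟩).trans hsupp.ge)
      have h1 : (S * ω).trace = (S * ρ).trace := hωf
      rw [← h1, ← hPω, ← Matrix.mul_assoc, hSP]
      simp
    have h1 : Matrix.traceLinearMap n ℂ ℂ ∘ₗ LinearMap.mulLeft ℂ S = 0 :=
      ext_of_density fun X hX => hzero X hX
    refine Matrix.ext_iff_trace_mul_right.2 fun X => ?_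
    rw [Matrix.zero_mul, Matrix.trace_zero]
    exact LinearMap.congr_fun h1 X
  have hpos : ∀ X : Op n, X.PosSemidef → R * E X = 0 := by
    intro X hX
    refine ((hch.map_posSemidef hX).mul_proj_eq_zero hRh hRR ?_).2
    rw [trace_mul_hsAdjoint hch.map_conjTranspose, ← hS, hS0]
    simp
  have hfin : LinearMap.mulLeft ℂ R ∘ₗ E = 0 := LinearMap.ext_posSemidef fun X hX => hpos X hX
  have := LinearMap.congr_fun hfin X
  simp only [LinearMap.comp_apply, LinearMap.mulLeft_apply, LinearMap.zero_apply, hR,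
    Matrix.sub_mul, Matrix.one_mul, sub_eq_zero] at this
  exact this.symm

end IsAsymptoticProjection

end QMP

/-! ### Multiplicative domains -/

section MultiplicativeDomain

variable {n : Type*} [Fintype n] [DecidableEq n]

omit [DecidableEq n] in
theorem Matrix.PosSemidef.eq_zero_of_add_smul {S H : Op n}
    (h : ∀ t : ℝ, (S + t • H).PosSemidef) : H = 0 := by
  have key : ∀ K : Op n, (∀ t : ℝ, (S + t • K).PosSemidef) → K.PosSemidef := by
    intro K hK
    have h1 : Filter.Tendsto (fun k : ℕ => ((k + 1 : ℝ)⁻¹) • S + K) Filter.atTop (𝓝 K) := by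
      have h2 : Filter.Tendsto (fun k : ℕ => ((k + 1 : ℝ)⁻¹)) Filter.atTop (𝓝 0) := by
        simpa [one_div] using tendsto_one_div_add_atTop_nhds_zero_nat (𝕜 := ℝ)
      have h3 := (h2.smul_const S).add_const K
      rwa [zero_smul, zero_add] at h3
    refine Matrix.PosSemidef.of_tendsto h1 fun k => ?_
    have h4 := (hK (k + 1)).smul (show (0 : ℝ) ≤ (k + 1 : ℝ)⁻¹ by positivity)
    rwa [smul_add, smul_smul, inv_mul_cancel₀ (by positivity), one_smul] at h4
  have h1 := key H h
  have h2 := key (-H) fun t => by simpa using h (-t)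
  refine h1.trace_eq_zero_iff.1 (le_antisymm ?_ h1.trace_nonneg)
  simpa using h2.trace_nonneg

omit [DecidableEq n] in
/-- The multiplicative domain: equality in the Kadison-Schwarz inequality at `A` makes a map
multiplicative on products with `A`. -/
theorem map_conjTranspose_mul_of_schwarz_eq {Ψ : SuperOp n}
    (hstar : ∀ X, Ψ X.conjTranspose = (Ψ X).conjTranspose)
    (hS : ∀ X, (Ψ (X.conjTranspose * X) - (Ψ X).conjTranspose * Ψ X).PosSemidef) {A : Op n}
    (hA : Ψ (A.conjTranspose * A) = (Ψ A).conjTranspose * Ψ A) (X : Op n) :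
    Ψ (A.conjTranspose * X) = (Ψ A).conjTranspose * Ψ X := by
  set M := Ψ (A.conjTranspose * X) - (Ψ A).conjTranspose * Ψ X with hM
  have hMs : M.conjTranspose = Ψ (X.conjTranspose * A) - (Ψ X).conjTranspose * Ψ A := by
    rw [hM, Matrix.conjTranspose_sub, ← hstar, Matrix.conjTranspose_mul, Matrix.conjTranspose_mul,
      Matrix.conjTranspose_conjTranspose, Matrix.conjTranspose_conjTranspose]
  set S := Ψ (X.conjTranspose * X) - (Ψ X).conjTranspose * Ψ X with hSdef
  -- the Schwarz inequality at `X + z A` has no term of second order in `z`, so the linear one is zero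
  have hz : ∀ z : ℂ, (S + (z • M.conjTranspose + star z • M)).PosSemidef := by
    intro z
    have h := hS (X + z • A)
    have e : Ψ ((X + z • A).conjTranspose * (X + z • A)) -
        (Ψ (X + z • A)).conjTranspose * Ψ (X + z • A) = S + (z • M.conjTranspose + star z • M) := by
      rw [hMs, hM, hSdef]
      simp only [Matrix.conjTranspose_add, Matrix.conjTranspose_smul, Matrix.add_mul,
        Matrix.mul_add, Matrix.smul_mul, Matrix.mul_smul, map_add, map_smul, hA, smul_sub, smul_add]
      abel
    rwa [e] at h
  have h1 : M.conjTranspose + M = 0 := Matrix.PosSemidef.eq_zero_of_add_smul (S := S) fun t => by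
    have := hz t
    rwa [Complex.star_def, Complex.conj_ofReal, ← smul_add, Complex.coe_smul] at this
  have h2 : Complex.I • M.conjTranspose - Complex.I • M = 0 :=
    Matrix.PosSemidef.eq_zero_of_add_smul (S := S) fun t => by
      have := hz (t * Complex.I)
      rw [star_mul', Complex.star_def, Complex.conj_ofReal, Complex.conj_I,
        mul_smul, mul_smul, ← smul_add, neg_smul, ← sub_eq_add_neg, Complex.coe_smul] at this
      exact this
  rw [← smul_sub, smul_eq_zero_iff_right Complex.I_ne_zero, sub_eq_zero] at h2
  rw [h2, ← two_smul ℂ, smul_eq_zero_iff_right two_ne_zero] at h1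
  exact sub_eq_zero.1 h1

open scoped MatrixOrder in
theorem IsDensity.one_sub_posSemidef {ρ : Op n} (hρ : IsDensity ρ) : (1 - ρ).PosSemidef := by
  have hsum : ∑ i, hρ.1.1.eigenvalues i = 1 := by
    refine Complex.ofReal_injective (Eq.trans ?_ hρ.2)
    exact (Complex.ofReal_sum _ _).trans hρ.1.1.trace_eq_sum_eigenvalues.symm
  have h1 : cfc (fun x : ℝ => 1 - x) ρ = 1 - ρ := by
    have hρ' : IsSelfAdjoint ρ := hρ.1.1
    rw [cfc_sub (fun _ => (1 : ℝ)) (fun x => x) ρ, cfc_const_one ℝ ρ, cfc_id' ℝ ρ]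
  rw [← h1, ← Matrix.nonneg_iff_posSemidef]
  refine cfc_nonneg fun x hx => ?_
  rw [hρ.1.1.spectrum_real_eq_range_eigenvalues] at hx
  obtain ⟨i, rfl⟩ := hx
  have := Finset.single_le_sum (fun i _ => hρ.1.eigenvalues_nonneg i) (Finset.mem_univ i)
  linarith

end MultiplicativeDomain

/-! ### The recurrent algebra -/

section Corner

variable {n : Type*} [Fintype n] [DecidableEq n]

/-- The Heisenberg adjoint of `Φ`, compressed to the corner of `P`. -/
noncomputable def cornerAdjoint (P : Op n) (Φ : SuperOp n) : SuperOp n :=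
  LinearMap.mulLeftRight ℂ (P, P) ∘ₗ hsAdjoint Φ

theorem cornerAdjoint_apply (P : Op n) (Φ : SuperOp n) (A : Op n) :
    cornerAdjoint P Φ A = P * hsAdjoint Φ A * P := rfl

theorem cornerAdjoint_conjTranspose {P : Op n} (hP : P.IsHermitian) {Φ : SuperOp n}
    (hΦ : IsSchwarzChannel Φ) (A : Op n) :
    cornerAdjoint P Φ A.conjTranspose = (cornerAdjoint P Φ A).conjTranspose := by
  simp only [cornerAdjoint_apply, hΦ.adjoint_conjTranspose, Matrix.conjTranspose_mul, hP.eq,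
    Matrix.mul_assoc]

theorem cornerAdjoint_schwarz {P : Op n} (hP : P.IsHermitian) (hPP : P * P = P) {Φ : SuperOp n}
    (hΦ : IsSchwarzChannel Φ) (A : Op n) :
    (cornerAdjoint P Φ (A.conjTranspose * A) -
      (cornerAdjoint P Φ A).conjTranspose * cornerAdjoint P Φ A).PosSemidef := by
  set B := hsAdjoint Φ A with hB
  have h1 := (hΦ.schwarz A).mul_mul_conjTranspose_same P
  have hR : (1 - P).IsHermitian := Matrix.isHermitian_one.sub hP
  have hRR : (1 - P) * (1 - P) = 1 - P := by simp [Matrix.mul_sub, Matrix.sub_mul, hPP]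
  have h2 := (hR.posSemidef_of_mul_self hRR).conjTranspose_mul_mul_same (B * P)
  have h3 := h1.add h2
  rw [hP.eq] at h3
  convert h3 using 1
  simp only [cornerAdjoint_apply, ← hB, Matrix.conjTranspose_mul, hP.eq, Matrix.mul_sub,
    Matrix.sub_mul, Matrix.mul_one, Matrix.mul_assoc]
  rw [← Matrix.mul_assoc P P, hPP]
  abel

theorem trace_mul_cornerAdjoint {P : Op n} {Φ : SuperOp n} (hΦ : IsSchwarzChannel Φ) {X : Op n}
    (h1 : P * X = X) (h2 : X * P = X) (A : Op n) :
    (X * cornerAdjoint P Φ A).trace = (Φ X * A).trace := by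
  rw [cornerAdjoint_apply, ← Matrix.mul_assoc, ← Matrix.mul_assoc, h2, Matrix.trace_mul_comm,
    ← Matrix.mul_assoc, h1, ← trace_mul_hsAdjoint hΦ.map_conjTranspose]

end Corner

/-- An idempotent channel `E` whose range lives on the range of the projection `P`, with a state `τ`
in its range that is faithful on the range of `P`. -/
structure IsRecurrentProjection {n : Type*} [Fintype n] [DecidableEq n]
    (E : Module.End ℂ (Op n)) (P τ : Op n) : Prop where
  isHermitian : P.IsHermitian
  mul_self : P * P = P
  channel : IsSchwarzChannel E
  idem : ∀ X, E (E X) = E X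
  proj_mul : ∀ X, P * E X = E X
  density : IsDensity τ
  apply_state : E τ = τ
  posDef : (τ + (1 - P)).PosDef

/-- The recurrent algebra: the compression to the range of `P` of the Heisenberg attractor space. -/
noncomputable def recurrentAlgebra {n : Type*} [Fintype n] [DecidableEq n]
    (E : Module.End ℂ (Op n)) (P : Op n) : Submodule ℂ (Op n) :=
  LinearMap.eqLocus (cornerAdjoint P E) LinearMap.id

namespace IsRecurrentProjection

variable {n : Type*} [Fintype n] [DecidableEq n] {E : Module.End ℂ (Op n)} {P τ : Op n}
  (hE : IsRecurrentProjection E P τ)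
include hE

local notation "𝒩" => recurrentAlgebra E P

omit hE in
theorem mem_iff {A : Op n} : A ∈ 𝒩 ↔ cornerAdjoint P E A = A := Iff.rfl

theorem mul_proj (X : Op n) : E X * P = E X := by
  have h := congrArg Matrix.conjTranspose (hE.proj_mul X.conjTranspose)
  rwa [Matrix.conjTranspose_mul, hE.isHermitian.eq, ← hE.channel.map_conjTranspose,
    Matrix.conjTranspose_conjTranspose] at h

theorem proj_mul_state : P * τ = τ := by rw [← hE.apply_state, hE.proj_mul]

theorem state_mul_proj : τ * P = τ := by rw [← hE.apply_state, hE.mul_proj]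

/-- The range of `E` lives on `P`, so `E†` only sees the corner of `P`. Hence compression by `P` loses
no information about the Heisenberg attractor space. -/
theorem adjoint_compress (A : Op n) : hsAdjoint E (P * A * P) = hsAdjoint E A := by
  refine Matrix.ext_iff_trace_mul_left.2 fun X => ?_
  rw [← trace_mul_hsAdjoint hE.channel.map_conjTranspose,
    ← trace_mul_hsAdjoint hE.channel.map_conjTranspose, ← Matrix.mul_assoc, Matrix.trace_mul_comm,
    ← Matrix.mul_assoc, ← Matrix.mul_assoc, hE.proj_mul, hE.mul_proj]

theorem adjoint_idem (A : Op n) : hsAdjoint E (hsAdjoint E A) = hsAdjoint E A := by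
  have h : E * E = E := LinearMap.ext hE.idem
  have h1 := hsAdjoint_mul E E
  rw [h] at h1
  exact (LinearMap.congr_fun h1 A).symm

theorem corner_mem (A : Op n) : cornerAdjoint P E A ∈ 𝒩 := by
  rw [mem_iff, cornerAdjoint_apply, cornerAdjoint_apply, hE.adjoint_compress, hE.adjoint_idem]

theorem adjoint_corner_mem {A : Op n} (hA : hsAdjoint E A = A) : P * A * P ∈ 𝒩 := by
  rw [← hA]; exact hE.corner_mem A

theorem proj_mul_of_mem {A : Op n} (hA : A ∈ 𝒩) : P * A = A := by
  rw [← mem_iff.1 hA, cornerAdjoint_apply, ← Matrix.mul_assoc, ← Matrix.mul_assoc, hE.mul_self]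

theorem mul_proj_of_mem {A : Op n} (hA : A ∈ 𝒩) : A * P = A := by
  rw [← mem_iff.1 hA, cornerAdjoint_apply, Matrix.mul_assoc, hE.mul_self]

theorem proj_mem : P ∈ 𝒩 := by
  have h := hE.adjoint_compress 1
  rw [Matrix.mul_one, hE.mul_self, hE.channel.adjoint_one] at h
  rw [mem_iff, cornerAdjoint_apply, h, Matrix.mul_one, hE.mul_self]

theorem conjTranspose_mem {A : Op n} (hA : A ∈ 𝒩) : A.conjTranspose ∈ 𝒩 := by
  rw [mem_iff, cornerAdjoint_conjTranspose hE.isHermitian hE.channel, mem_iff.1 hA]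

/-- A positive operator in the corner of `P` with zero expectation in `τ` vanishes. -/
theorem eq_zero_of_trace_state {A : Op n} (hA : A.PosSemidef) (hPA : P * A = A)
    (h : (τ * A).trace = 0) : A = 0 := by
  refine hE.posDef.eq_zero_of_trace_mul_eq_zero hA ?_
  rw [Matrix.add_mul, Matrix.trace_add, h, Matrix.sub_mul, hPA, Matrix.one_mul, sub_self]
  simp

/-- The faithful state `τ`, invariant under `E`, turns the Kadison-Schwarz inequality at a fixed point
into an equality. -/
theorem corner_schwarz_eq {A : Op n} (hA : A ∈ 𝒩) :
    cornerAdjoint P E (A.conjTranspose * A) =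
      (cornerAdjoint P E A).conjTranspose * cornerAdjoint P E A := by
  refine sub_eq_zero.1 (hE.eq_zero_of_trace_state
    (cornerAdjoint_schwarz hE.isHermitian hE.mul_self hE.channel A) ?_ ?_)
  · rw [mem_iff.1 hA, Matrix.mul_sub, hE.proj_mul_of_mem (hE.corner_mem _), ← Matrix.mul_assoc,
      hE.proj_mul_of_mem (hE.conjTranspose_mem hA)]
  · rw [Matrix.mul_sub, Matrix.trace_sub, trace_mul_cornerAdjoint hE.channel hE.proj_mul_state
      hE.state_mul_proj, hE.apply_state, mem_iff.1 hA, sub_self]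

theorem corner_mul {A : Op n} (hA : A ∈ 𝒩) (X : Op n) :
    cornerAdjoint P E (A * X) = A * cornerAdjoint P E X := by
  have h := map_conjTranspose_mul_of_schwarz_eq
    (cornerAdjoint_conjTranspose hE.isHermitian hE.channel)
    (cornerAdjoint_schwarz hE.isHermitian hE.mul_self hE.channel)
    (hE.corner_schwarz_eq (hE.conjTranspose_mem hA)) X
  rwa [mem_iff.1 (hE.conjTranspose_mem hA), Matrix.conjTranspose_conjTranspose] at h

theorem corner_mul_right {A : Op n} (hA : A ∈ 𝒩) (X : Op n) :
    cornerAdjoint P E (X * A) = cornerAdjoint P E X * A := by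
  have h := congrArg Matrix.conjTranspose (hE.corner_mul (hE.conjTranspose_mem hA) X.conjTranspose)
  rwa [← cornerAdjoint_conjTranspose hE.isHermitian hE.channel, Matrix.conjTranspose_mul,
    Matrix.conjTranspose_mul, ← cornerAdjoint_conjTranspose hE.isHermitian hE.channel,
    Matrix.conjTranspose_conjTranspose, Matrix.conjTranspose_conjTranspose] at h

theorem mul_mem {A B : Op n} (hA : A ∈ 𝒩) (hB : B ∈ 𝒩) : A * B ∈ 𝒩 := by
  rw [mem_iff, hE.corner_mul hA, mem_iff.1 hB]

/-- `E` is a bimodule map over the recurrent algebra: it is dual to a conditional expectation. -/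
theorem apply_mul {A X : Op n} (hA : A ∈ 𝒩) (h1 : P * X = X) (h2 : X * P = X) :
    E (A * X) = A * E X := by
  refine Matrix.ext_iff_trace_mul_right.2 fun B => ?_
  have h3 : P * (A * X) = A * X := by rw [← Matrix.mul_assoc, hE.proj_mul_of_mem hA]
  have h4 : A * X * P = A * X := by rw [Matrix.mul_assoc, h2]
  rw [← trace_mul_cornerAdjoint hE.channel h3 h4, Matrix.mul_assoc, Matrix.trace_mul_comm,
    Matrix.mul_assoc, ← hE.corner_mul_right hA, trace_mul_cornerAdjoint hE.channel h1 h2,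
    ← Matrix.mul_assoc, Matrix.trace_mul_comm, ← Matrix.mul_assoc]

theorem apply_mul_right {A X : Op n} (hA : A ∈ 𝒩) (h1 : P * X = X) (h2 : X * P = X) :
    E (X * A) = E X * A := by
  have h := hE.apply_mul (X := X.conjTranspose) (hE.conjTranspose_mem hA)
    (by rw [← hE.isHermitian.eq, ← Matrix.conjTranspose_mul, h2])
    (by nth_rw 1 [← hE.isHermitian.eq]; rw [← Matrix.conjTranspose_mul, h1])
  rw [← Matrix.conjTranspose_mul, hE.channel.map_conjTranspose, hE.channel.map_conjTranspose,
    ← Matrix.conjTranspose_mul] at h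
  exact Matrix.conjTranspose_injective h

theorem apply_of_mem {A : Op n} (hA : A ∈ 𝒩) : E A = A * E P := by
  rw [← hE.apply_mul hA hE.mul_self hE.mul_self, hE.mul_proj_of_mem hA]

/-- The reference operator `E P` lies in the commutant of the recurrent algebra. -/
theorem commute_reference {A : Op n} (hA : A ∈ 𝒩) : Commute A (E P) := by
  have h := hE.apply_mul_right hA hE.mul_self hE.mul_self
  rw [hE.proj_mul_of_mem hA, hE.apply_of_mem hA] at h
  exact h

/-- The reference operator is positive definite on the range of `P`, since `E P ≥ E τ = τ`. -/
theorem reference_posDef : (E P + (1 - P)).PosDef := by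
  have h1 : (P - τ).PosSemidef := by
    have h := hE.density.one_sub_posSemidef.mul_mul_conjTranspose_same P
    rwa [hE.isHermitian.eq, Matrix.mul_sub, Matrix.sub_mul, Matrix.mul_one, hE.mul_self,
      hE.proj_mul_state, hE.state_mul_proj] at h
  have h2 := hE.channel.map_posSemidef h1
  rw [map_sub, hE.apply_state] at h2
  have h3 := hE.posDef.add_posSemidef h2
  convert h3 using 1
  abel

theorem eq_of_mul_reference_eq {A B : Op n} (hA : A ∈ 𝒩) (hB : B ∈ 𝒩) (h : A * E P = B * E P) :
    A = B := by
  refine hE.reference_posDef.isUnit.mul_right_cancel ?_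
  rw [Matrix.mul_add, Matrix.mul_add, h, Matrix.mul_sub, Matrix.mul_sub, hE.mul_proj_of_mem hA,
    hE.mul_proj_of_mem hB, Matrix.mul_one, Matrix.mul_one, sub_self, sub_self]

/-- Every operator in the range of `E` is the product of an element of the recurrent algebra and
the reference operator. -/
theorem exists_eq_mul_reference {X : Op n} (hX : E X = X) : ∃ A ∈ 𝒩, X = A * E P := by
  -- a functional that vanishes on `𝒩 * E P` pairs to zero with the whole range of `E`
  by_contra! hcon
  have hnot : X ∉ (𝒩).map (LinearMap.mulRight ℂ (E P)) := by
    rintro ⟨A, hA, rfl⟩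
    exact hcon A hA rfl
  obtain ⟨f, hfX, hf⟩ := Submodule.exists_le_ker_of_notMem hnot
  obtain ⟨Y, hY⟩ := exists_trace_eq f
  set B := Y.conjTranspose with hB
  have hPX : P * X = X := by rw [← hX, hE.proj_mul]
  have hXP : X * P = X := by rw [← hX, hE.mul_proj]
  have hzero : ∀ A ∈ 𝒩, (cornerAdjoint P E B * A).trace = 0 := by
    intro A hA
    rw [Matrix.trace_mul_comm, trace_mul_cornerAdjoint hE.channel (hE.proj_mul_of_mem hA)
      (hE.mul_proj_of_mem hA), hE.apply_of_mem hA, Matrix.trace_mul_comm, hY]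
    exact hf ⟨A, hA, rfl⟩
  have hFB : cornerAdjoint P E B = 0 := Matrix.trace_mul_conjTranspose_self_eq_zero_iff.1
    (hzero _ (hE.conjTranspose_mem (hE.corner_mem B)))
  apply hfX
  rw [← hY, Matrix.trace_mul_comm, ← hX, ← trace_mul_cornerAdjoint hE.channel hPX hXP, hFB]
  simp

end IsRecurrentProjection

/-! ### Automorphic evolution of the recurrent algebra -/

theorem IsSchwarzChannel.mul {n : Type*} [Fintype n] [DecidableEq n] {Φ Ψ : Module.End ℂ (Op n)}
    (hΦ : IsSchwarzChannel Φ) (hΨ : IsSchwarzChannel Ψ) :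
    IsSchwarzChannel (Φ * Ψ : Module.End ℂ (Op n)) where
  map_conjTranspose X := by
    rw [Module.End.mul_apply, Module.End.mul_apply, hΨ.map_conjTranspose, hΦ.map_conjTranspose]
  trace_map X := by rw [Module.End.mul_apply, hΦ.trace_map, hΨ.trace_map]
  schwarz A := by
    have h := (hΨ.adjoint_posSemidef (hΦ.schwarz A)).add (hΨ.schwarz (hsAdjoint Φ A))
    rw [map_sub, sub_add_sub_cancel] at h
    rwa [hsAdjoint_mul]

namespace QMP

variable {n : Type*} [Fintype n] [DecidableEq n] (D : QMP n)

/-- The Heisenberg evolution on the recurrent algebra. -/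
noncomputable def cornerEvolution (E : Module.End ℂ (Op n)) (P : Op n) (t : D.Time) : SuperOp n :=
  cornerAdjoint P ((D.prop t : Module.End ℂ (Op n)) * E : Module.End ℂ (Op n))

namespace IsAsymptoticProjection

variable {D} {E : Module.End ℂ (Op n)} {U : Filter D.Time} {P τ : Op n}
  (hE : D.IsAsymptoticProjection D.gen E U)

include hE in
theorem exists_isRecurrentProjection (hP : D.IsTProjector P) :
    ∃ τ, IsRecurrentProjection E P τ ∧ ∀ t, D.prop t τ = τ := by
  have := hE.neBot
  obtain ⟨τ, hτ, hτinv, hPτ, hτpos⟩ := exists_faithful_invariant hP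
  exact ⟨τ, ⟨hP.1, hP.2.1, hE.isSchwarzChannel, hE.idem, hE.proj_mul_apply hP, hτ,
    tendsto_nhds_unique (hE.tendsto_prop τ) (by simp [hτinv]), hτpos⟩, hτinv⟩

variable (hr : IsRecurrentProjection E P τ) (hτ : ∀ t, D.prop t τ = τ)

local notation "𝒩" => recurrentAlgebra E P
local notation "β" => cornerEvolution D E P

include hE in
theorem cornerEvolution_apply (t : D.Time) (A : Op n) :
    β t A = P * hsAdjoint (D.prop t) (hsAdjoint E A) * P := by
  rw [cornerEvolution, cornerAdjoint_apply, hsAdjoint_mul, Module.End.mul_apply,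
    hE.adjoint_apply_prop]

include hE hr in
theorem cornerEvolution_mem (t : D.Time) (A : Op n) : β t A ∈ 𝒩 := by
  rw [hE.cornerEvolution_apply, ← hE.adjoint_apply_prop]
  exact hr.corner_mem _

include hr in
theorem step_isSchwarzChannel (t : D.Time) :
    IsSchwarzChannel ((D.prop t : Module.End ℂ (Op n)) * E : Module.End ℂ (Op n)) :=
  (D.prop_isSchwarzChannel t).mul hr.channel

include hr in
theorem cornerEvolution_conjTranspose (t : D.Time) (A : Op n) :
    β t A.conjTranspose = (β t A).conjTranspose :=
  cornerAdjoint_conjTranspose hr.isHermitian (step_isSchwarzChannel hr t) A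

include hr in
theorem cornerEvolution_schwarz (t : D.Time) (A : Op n) :
    (β t (A.conjTranspose * A) - (β t A).conjTranspose * β t A).PosSemidef :=
  cornerAdjoint_schwarz hr.isHermitian hr.mul_self (step_isSchwarzChannel hr t) A

include hE hr in
theorem cornerEvolution_cornerEvolution (s t : D.Time) (A : Op n) :
    β s (β t A) = β (t + s) A := by
  have h1 : D.prop (t + s) = ((D.prop t : Module.End ℂ (Op n)) * D.prop s : Module.End ℂ (Op n)) :=
    LinearMap.ext fun X => D.prop_add t s X
  rw [hE.cornerEvolution_apply, hE.cornerEvolution_apply, hE.cornerEvolution_apply,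
    hr.adjoint_compress, hE.adjoint_apply_prop, hr.adjoint_idem, h1, hsAdjoint_mul,
    Module.End.mul_apply]

include hE hr in
theorem tendsto_cornerEvolution (A : Op n) :
    Filter.Tendsto (fun t => β t A) U (𝓝 (cornerAdjoint P E A)) := by
  simp only [hE.cornerEvolution_apply]
  have h := tendsto_hsAdjoint hE.tendsto_prop (hsAdjoint E A)
  rw [hr.adjoint_idem] at h
  have hc : Continuous fun X : Op n => P * X * P := by fun_prop
  exact hc.continuousAt.tendsto.comp h

include hr hτ in
theorem trace_state_cornerEvolution (t : D.Time) (A : Op n) :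
    (τ * β t A).trace = (τ * A).trace := by
  rw [cornerEvolution, trace_mul_cornerAdjoint (step_isSchwarzChannel hr t) hr.proj_mul_state
    hr.state_mul_proj, Module.End.mul_apply, hr.apply_state, hτ]

include hE hr hτ in
/-- Equality in the Kadison-Schwarz inequality: the `τ`-norm of `β t A` decreases in `t` and
returns to its initial value along `U`. -/
theorem cornerEvolution_schwarz_eq (t : D.Time) {A : Op n} (hA : A ∈ 𝒩) :
    β t (A.conjTranspose * A) = (β t A).conjTranspose * β t A := by
  have := hE.neBot
  have hstep : ∀ s (B : Op n), (τ * ((β s B).conjTranspose * β s B)).trace ≤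
      (τ * (B.conjTranspose * B)).trace := by
    intro s B
    have h := hr.density.1.trace_mul_nonneg (cornerEvolution_schwarz hr s B)
    rwa [Matrix.mul_sub, Matrix.trace_sub, trace_state_cornerEvolution hr hτ, sub_nonneg] at h
  have hlim : Filter.Tendsto (fun s => (τ * ((β s A).conjTranspose * β s A)).trace) U
      (𝓝 (τ * (A.conjTranspose * A)).trace) := by
    have hc : Continuous fun X : Op n => (τ * (X.conjTranspose * X)).trace := by fun_prop
    have h := hE.tendsto_cornerEvolution hr A
    rw [IsRecurrentProjection.mem_iff.1 hA] at h
    exact hc.continuousAt.tendsto.comp h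
  have hge : (τ * (A.conjTranspose * A)).trace ≤ (τ * ((β t A).conjTranspose * β t A)).trace := by
    refine le_of_tendsto hlim ?_
    filter_upwards [hE.le_atTop (Filter.eventually_ge_atTop t)] with s hs
    obtain ⟨r, rfl⟩ := exists_add_of_le hs
    rw [← hE.cornerEvolution_cornerEvolution hr]
    exact hstep r _
  have hmem := hE.cornerEvolution_mem hr t A
  refine sub_eq_zero.1 (hr.eq_zero_of_trace_state (cornerEvolution_schwarz hr t A) ?_ ?_)
  · rw [Matrix.mul_sub, hr.proj_mul_of_mem (hE.cornerEvolution_mem hr t _), ← Matrix.mul_assoc,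
      hr.proj_mul_of_mem (hr.conjTranspose_mem hmem)]
  · rw [Matrix.mul_sub, Matrix.trace_sub, trace_state_cornerEvolution hr hτ, sub_eq_zero]
    exact le_antisymm hge (hstep t A)

include hE hr hτ in
theorem cornerEvolution_mul (t : D.Time) {A : Op n} (hA : A ∈ 𝒩) (X : Op n) :
    β t (A * X) = β t A * β t X := by
  have h := map_conjTranspose_mul_of_schwarz_eq (cornerEvolution_conjTranspose hr t)
    (cornerEvolution_schwarz hr t)
    (hE.cornerEvolution_schwarz_eq hr hτ t (hr.conjTranspose_mem hA)) X
  rwa [← cornerEvolution_conjTranspose hr, Matrix.conjTranspose_conjTranspose] at h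

include hE hr in
theorem cornerEvolution_proj (t : D.Time) : β t P = P := by
  have h := hr.adjoint_compress 1
  rw [Matrix.mul_one, hr.mul_self, hr.channel.adjoint_one] at h
  rw [hE.cornerEvolution_apply, h, (D.prop_isSchwarzChannel t).adjoint_one, Matrix.mul_one,
    hr.mul_self]

include hE hr in
theorem cornerEvolution_injOn (t : D.Time) {A : Op n} (hA : A ∈ 𝒩) (h : β t A = 0) : A = 0 := by
  rw [hE.cornerEvolution_apply] at h
  have h1 := hr.adjoint_compress (hsAdjoint (D.prop t) (hsAdjoint E A))
  rw [h, map_zero, hE.adjoint_apply_prop, hr.adjoint_idem] at h1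
  have h2 := hE.eq_zero_of_adjoint_prop_eq_zero (hr.adjoint_idem A) h1.symm
  rw [← IsRecurrentProjection.mem_iff.1 hA, cornerAdjoint_apply, h2]
  simp

include hE hr in
theorem exists_cornerEvolution_eq (t : D.Time) {A : Op n} (hA : A ∈ 𝒩) (hAh : A.IsHermitian) :
    ∃ B ∈ 𝒩, B.IsHermitian ∧ β t B = A := by
  let f : 𝒩 →ₗ[ℂ] 𝒩 := (β t).restrict fun A _ => hE.cornerEvolution_mem hr t A
  have hinj : Function.Injective f := by
    rw [injective_iff_map_eq_zero]
    intro A hA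
    exact Subtype.ext (hE.cornerEvolution_injOn hr t A.2 (congrArg Subtype.val hA))
  obtain ⟨⟨B, hB⟩, hBA⟩ := LinearMap.injective_iff_surjective.1 hinj ⟨A, hA⟩
  have hBA' : β t B = A := congrArg Subtype.val hBA
  refine ⟨B, hB, ?_, hBA'⟩
  refine sub_eq_zero.1 (hE.cornerEvolution_injOn hr t ((𝒩).sub_mem (hr.conjTranspose_mem hB) hB) ?_)
  rw [map_sub, cornerEvolution_conjTranspose hr, hBA', hAh.eq, sub_self]

include hE hr hτ in
/-- The Schrödinger evolution intertwines multiplication by `β t A` and by `A`. -/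
theorem prop_mul_cornerEvolution (t : D.Time) {X A : Op n} (hX : E X = X) (hA : A ∈ 𝒩) :
    D.prop t (X * β t A) = D.prop t X * A := by
  have hPX : P * X = X := by rw [← hX, hr.proj_mul]
  have hXP : X * P = X := by rw [← hX, hr.mul_proj]
  have hβ := hE.cornerEvolution_mem hr t A
  have hmem : E (X * β t A) = X * β t A := by rw [hr.apply_mul_right hβ hPX hXP, hX]
  refine Matrix.ext_iff_trace_mul_right.2 fun B => ?_
  have e1 : ∀ Y, E Y = Y → ∀ B, (D.prop t Y * B).trace = (Y * β t B).trace := by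
    intro Y hY B
    have hPY : P * Y = Y := by rw [← hY, hr.proj_mul]
    have hYP : Y * P = Y := by rw [← hY, hr.mul_proj]
    rw [cornerEvolution, trace_mul_cornerAdjoint (step_isSchwarzChannel hr t) hPY hYP,
      Module.End.mul_apply, hY]
  rw [e1 _ hmem, Matrix.mul_assoc, ← hE.cornerEvolution_mul hr hτ t hA, ← e1 _ hX,
    Matrix.mul_assoc]

include hE hr hτ in
theorem prop_cornerEvolution_mul (t : D.Time) {X A : Op n} (hX : E X = X) (hA : A ∈ 𝒩) :
    D.prop t (β t A * X) = A * D.prop t X := by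
  have hX' : E X.conjTranspose = X.conjTranspose := by rw [hr.channel.map_conjTranspose, hX]
  have h := hE.prop_mul_cornerEvolution hr hτ t hX' (hr.conjTranspose_mem hA)
  rw [cornerEvolution_conjTranspose hr, ← Matrix.conjTranspose_mul,
    (D.prop_isSchwarzChannel t).map_conjTranspose, (D.prop_isSchwarzChannel t).map_conjTranspose,
    ← Matrix.conjTranspose_mul] at h
  exact Matrix.conjTranspose_injective h

end IsAsymptoticProjection

end QMP

/-! ### Exponentials and logarithms in the recurrent algebra -/

section Exponential

variable {n : Type*} [Fintype n] [DecidableEq n]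

open scoped Matrix.Norms.L2Operator in
theorem exp_hasSum (K : Op n) :
    HasSum (fun k : ℕ => ((k.factorial : ℂ)⁻¹) • K ^ k) (NormedSpace.exp K) :=
  NormedSpace.exp_series_hasSum_exp' (𝕂 := ℂ) K

theorem exp_mul_exp_neg (K : Op n) : NormedSpace.exp K * NormedSpace.exp (-K) = 1 := by
  rw [← Matrix.exp_add_of_commute _ _ ((Commute.refl K).neg_right), add_neg_cancel,
    NormedSpace.exp_zero]

theorem exp_commute {K B : Op n} (h : Commute K B) : Commute (NormedSpace.exp K) B := by
  have h1 := exp_hasSum K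
  have h2 := h1.mul_right B
  have h3 := h1.mul_left B
  have e : (fun k : ℕ => ((k.factorial : ℂ)⁻¹) • K ^ k * B) =
      fun k : ℕ => B * ((k.factorial : ℂ)⁻¹) • K ^ k := by
    funext k
    rw [Matrix.smul_mul, Matrix.mul_smul, (h.pow_left k).eq]
  rw [e] at h2
  exact h2.unique h3

theorem cfc_mul_compl_of_mul_eq (f : ℝ → ℝ) {K P : Op n} (hK : K.IsHermitian)
    (hKP : K * P = K) (hPK : P * K = K) : cfc f K * (1 - P) = f 0 • (1 - P) := by
  have hc : Commute K (1 - P) := (Commute.one_right _).sub_right (hKP.trans hPK.symm)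
  have h := cfc_mul_of_mul_eq f hK (Matrix.isHermitian_zero (n := n) (α := ℂ)) hc
    (by rw [Matrix.mul_sub, hKP]; simp)
  rw [h, cfc_apply_zero, Algebra.algebraMap_eq_smul_one, Matrix.smul_mul, Matrix.one_mul]

theorem exp_mul_compl {K P : Op n} (hK : K.IsHermitian) (hKP : K * P = K) (hPK : P * K = K) :
    NormedSpace.exp K * (1 - P) = 1 - P := by
  rw [← cfc_exp hK, cfc_mul_compl_of_mul_eq _ hK hKP hPK, Real.exp_zero, one_smul]

theorem exp_eq_proj_mul_exp_add {K P : Op n} (hK : K.IsHermitian) (hKP : K * P = K)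
    (hPK : P * K = K) : NormedSpace.exp K = P * NormedSpace.exp K + (1 - P) := by
  have hc : Commute K P := hKP.trans hPK.symm
  rw [← exp_mul_compl hK hKP hPK, ← (exp_commute hc).eq, ← Matrix.mul_add]
  simp

end Exponential

namespace IsRecurrentProjection

variable {n : Type*} [Fintype n] [DecidableEq n] {E : Module.End ℂ (Op n)} {P τ : Op n}
  (hE : IsRecurrentProjection E P τ)
include hE

local notation "𝒩" => recurrentAlgebra E P

/-- The real subalgebra of operators that commute with `P` and whose restriction to the range of `P`
belongs to the recurrent algebra. Unlike the recurrent algebra itself it contains `1`, so the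
functional calculus stays in it. -/
noncomputable def unitization : Subalgebra ℝ (Op n) where
  carrier := {A | Commute A P ∧ A * P ∈ 𝒩}
  mul_mem' {A B} hA hB := ⟨hA.1.mul_left hB.1, by
    have h : A * B * P = A * P * (B * P) := by
      rw [hB.1.eq, Matrix.mul_assoc A P, ← Matrix.mul_assoc P P, hE.mul_self, ← hB.1.eq,
        Matrix.mul_assoc]
    rw [h]
    exact hE.mul_mem hA.2 hB.2⟩
  add_mem' {A B} hA hB := ⟨hA.1.add_left hB.1, by
    rw [Matrix.add_mul]; exact (𝒩).add_mem hA.2 hB.2⟩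
  algebraMap_mem' r := ⟨Algebra.commutes r P, by
    rw [Algebra.algebraMap_eq_smul_one, Matrix.smul_mul, Matrix.one_mul, ← Complex.coe_smul]
    exact (𝒩).smul_mem _ hE.proj_mem⟩

theorem mem_unitization {A : Op n} (hA : A ∈ 𝒩) : A ∈ hE.unitization :=
  ⟨(hE.mul_proj_of_mem hA).trans (hE.proj_mul_of_mem hA).symm, by rwa [hE.mul_proj_of_mem hA]⟩

theorem cfc_mul_proj_mem (f : ℝ → ℝ) {A : Op n} (hA : A ∈ 𝒩) (hAh : A.IsHermitian) :
    cfc f A * P ∈ 𝒩 :=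
  (cfc_mem_subalgebra f hAh (hE.mem_unitization hA)).2

theorem cfc_mem {f : ℝ → ℝ} (hf : f 0 = 0) {A : Op n} (hA : A ∈ 𝒩) (hAh : A.IsHermitian) :
    cfc f A ∈ 𝒩 := by
  have h := cfc_mul_compl_of_mul_eq f hAh (hE.mul_proj_of_mem hA) (hE.proj_mul_of_mem hA)
  rw [hf, zero_smul, Matrix.mul_sub, Matrix.mul_one, sub_eq_zero] at h
  rw [h]
  exact hE.cfc_mul_proj_mem f hA hAh

theorem proj_mul_exp_mem {K : Op n} (hK : K ∈ 𝒩) (hKh : K.IsHermitian) :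
    P * NormedSpace.exp K ∈ 𝒩 := by
  have hc : Commute K P := (hE.mul_proj_of_mem hK).trans (hE.proj_mul_of_mem hK).symm
  rw [← (exp_commute hc).eq, ← cfc_exp hKh]
  exact hE.cfc_mul_proj_mem _ hK hKh

theorem exp_eq_add {K : Op n} (hK : K ∈ 𝒩) (hKh : K.IsHermitian) :
    NormedSpace.exp K = P * NormedSpace.exp K + (1 - P) :=
  exp_eq_proj_mul_exp_add hKh (hE.mul_proj_of_mem hK) (hE.proj_mul_of_mem hK)

omit hE in
/-- The logarithm of the reference operator `E P` on the range of `P`, extended by zero: adding `1 - P`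
under the logarithm contributes `log 1 = 0`. -/
noncomputable def _root_.referenceLog (E : Module.End ℂ (Op n)) (P : Op n) : Op n :=
  opLog (E P + (1 - P))

local notation "ℋ" => referenceLog E P

omit hE in
theorem _root_.referenceLog_isHermitian (E : Module.End ℂ (Op n)) (P : Op n) :
    (referenceLog E P).IsHermitian := opLog_isHermitian _

theorem exp_referenceLog : NormedSpace.exp ℋ = E P + (1 - P) := exp_opLog hE.reference_posDef

theorem commute_reference_compl {A : Op n} (hA : A ∈ 𝒩) : Commute A (E P + (1 - P)) :=
  (hE.commute_reference hA).add_right ((Commute.one_right A).sub_right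
    ((hE.mul_proj_of_mem hA).trans (hE.proj_mul_of_mem hA).symm))

theorem commute_referenceLog {A : Op n} (hA : A ∈ 𝒩) : Commute A ℋ :=
  (opLog_mul_commute (hE.commute_reference_compl hA).symm).symm

theorem referenceLog_mul_proj : ℋ * P = ℋ := by
  have hc : Commute (E P + (1 - P)) (1 - P) := by
    rw [Commute, SemiconjBy]
    simp [Matrix.mul_sub, Matrix.sub_mul, Matrix.add_mul, Matrix.mul_add, hE.mul_proj, hE.proj_mul]
  have h := cfc_mul_of_mul_eq Real.log hE.reference_posDef.1
    (Matrix.isHermitian_one (n := n) (α := ℂ)) hc (by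
      simp [Matrix.mul_sub, Matrix.sub_mul, Matrix.add_mul, hE.mul_proj, hE.mul_self])
  have h1 : cfc Real.log (1 : Op n) = 0 := by
    rw [cfc_apply_one, Real.log_one, map_zero]
  rw [h1, Matrix.zero_mul, Matrix.mul_sub, Matrix.mul_one, sub_eq_zero] at h
  exact h.symm

theorem proj_mul_referenceLog : P * ℋ = ℋ := by
  rw [(hE.commute_referenceLog hE.proj_mem).eq, hE.referenceLog_mul_proj]

theorem proj_mul_exp_referenceLog : P * NormedSpace.exp ℋ = E P := by
  rw [hE.exp_referenceLog, Matrix.mul_add, Matrix.mul_sub, hE.proj_mul, hE.mul_self]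
  simp

/-- Adding the logarithm of the reference operator multiplies the exponential by it. -/
theorem proj_mul_exp_add_referenceLog {K : Op n} (hK : K ∈ 𝒩) :
    P * NormedSpace.exp (K + ℋ) = P * NormedSpace.exp K * E P := by
  have hc : Commute K P := (hE.mul_proj_of_mem hK).trans (hE.proj_mul_of_mem hK).symm
  have h1 : P * NormedSpace.exp K = P * NormedSpace.exp K * P := by
    rw [Matrix.mul_assoc, (exp_commute hc).eq, ← Matrix.mul_assoc, hE.mul_self]
  rw [Matrix.exp_add_of_commute _ _ (hE.commute_referenceLog hK), ← Matrix.mul_assoc, h1,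
    Matrix.mul_assoc _ P, hE.proj_mul_exp_referenceLog, ← h1]

/-- A positive operator in the range of `E` is the product of the reference operator and a positive
element of the recurrent algebra. -/
theorem exists_posSemidef_eq_mul_reference {X : Op n} (hX : X.PosSemidef) (hEX : E X = X) :
    ∃ A ∈ 𝒩, A.PosSemidef ∧ X = A * E P := by
  obtain ⟨A, hA, rfl⟩ := hE.exists_eq_mul_reference hEX
  refine ⟨A, hA, ?_, rfl⟩
  -- `S = (E P)^(-1/2)` on the range of `P`, and `A = S X S`
  set S := NormedSpace.exp (-((1 / 2 : ℝ) • ℋ)) with hS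
  have hHh : ((1 / 2 : ℝ) • ℋ).IsHermitian := by
    rw [Matrix.IsHermitian, Matrix.conjTranspose_smul, (referenceLog_isHermitian E P).eq,
      star_trivial]
  have hSh : S.IsHermitian := (exp_posDef hHh.neg).1
  have hAS : Commute A S :=
    (exp_commute ((hE.commute_referenceLog hA).symm.smul_left (1 / 2 : ℝ)).neg_left).symm
  have hSS : S * (E P + (1 - P)) * S = 1 := by
    have h1 : NormedSpace.exp ℋ = NormedSpace.exp ((1 / 2 : ℝ) • ℋ) *
        NormedSpace.exp ((1 / 2 : ℝ) • ℋ) := by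
      rw [← Matrix.exp_add_of_commute _ _ (Commute.refl _), ← add_smul]
      norm_num
    have h2 := exp_mul_exp_neg ((1 / 2 : ℝ) • ℋ)
    have h3 := exp_mul_exp_neg (-((1 / 2 : ℝ) • ℋ))
    rw [neg_neg] at h3
    rw [← hE.exp_referenceLog, h1, ← Matrix.mul_assoc, h3, Matrix.one_mul, h2]
  have h1 : S * (A * E P) * S = A := by
    have h2 : A * E P = A * (E P + (1 - P)) := by
      rw [Matrix.mul_add, Matrix.mul_sub, hE.mul_proj_of_mem hA]
      simp
    rw [h2, ← Matrix.mul_assoc, ← hAS.eq, Matrix.mul_assoc, Matrix.mul_assoc, ← Matrix.mul_assoc S,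
      hSS, Matrix.mul_one]
  have h3 := hX.mul_mul_conjTranspose_same S
  rwa [hSh.eq, h1] at h3

/-- Logarithms of positive operators `A * E P` in the range of `E`. Here `Q` is the support projection
of `A` and of `A * E P`; the last clause says that `Q` is orthogonal to the kernel projection of
`A * E P`. -/
theorem exists_log {A : Op n} (hA : A ∈ 𝒩) (hpos : A.PosSemidef) :
    ∃ Q ∈ 𝒩, ∃ K ∈ 𝒩, Q.IsHermitian ∧ Q * Q = Q ∧ K.IsHermitian ∧ K * Q = K ∧ A * Q = A ∧
      NormedSpace.exp K = A + (1 - Q) ∧ opLog (A * E P) = (K + ℋ) * Q ∧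
      cfc (fun x : ℝ => if x = 0 then 1 else 0) (A * E P) * Q = 0 := by
  have hcont : ∀ (B : Op n) (f : ℝ → ℝ), ContinuousOn f (spectrum ℝ B) := fun B f =>
    Matrix.finite_real_spectrum.continuousOn f
  have hAs : IsSelfAdjoint A := hpos.1
  set Q := cfc (fun x : ℝ => if x = 0 then 0 else 1) A with hQ
  set K := opLog A with hK
  have hQh : Q.IsHermitian := cfc_predicate _ A
  have hQmem : Q ∈ 𝒩 := hE.cfc_mem (by simp) hA hpos.1
  have hKmem : K ∈ 𝒩 := hE.cfc_mem Real.log_zero hA hpos.1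
  have hKh : K.IsHermitian := opLog_isHermitian A
  have hQQ : Q * Q = Q := by
    rw [hQ, ← cfc_mul _ _ A (hcont _ _) (hcont _ _)]
    congr 1; funext x; split_ifs <;> simp
  have hKQ : K * Q = K := by
    rw [hK, opLog, hQ, ← cfc_mul _ _ A (hcont _ _) (hcont _ _)]
    congr 1; funext x; split_ifs with h <;> simp [h]
  have hAQ : A * Q = A := by
    have hid : cfc (fun x : ℝ => x) A = A := cfc_id' ℝ A
    nth_rw 1 [← hid]
    rw [hQ, ← cfc_mul _ _ A (hcont _ _) (hcont _ _)]
    conv_rhs => rw [← hid]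
    congr 1; funext x; split_ifs with h <;> simp [h]
  have hexp : NormedSpace.exp K = A + (1 - Q) := by
    have hid : cfc (fun x : ℝ => x) A = A := cfc_id' ℝ A
    have h1 : cfc (fun x : ℝ => x + (1 - if x = 0 then 0 else 1)) A = A + (1 - Q) := by
      rw [cfc_add A _ _ (hcont _ _) (hcont _ _), cfc_sub _ _ A (hcont _ _) (hcont _ _), hid,
        cfc_const_one ℝ A]
    rw [← cfc_exp hKh, hK, opLog, ← cfc_comp' Real.exp Real.log A
      ((Matrix.finite_real_spectrum.image _).continuousOn _) (hcont _ _), ← h1]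
    refine cfc_congr fun x hx => ?_
    have hx0 : 0 ≤ x := by
      rw [hpos.1.spectrum_real_eq_range_eigenvalues] at hx
      obtain ⟨i, rfl⟩ := hx
      exact hpos.eigenvalues_nonneg i
    rcases hx0.eq_or_lt with rfl | h
    · simp
    · simp [Real.exp_log h, h.ne']
  have hKH : (K + ℋ).IsHermitian := hKh.add (referenceLog_isHermitian E P)
  have hcQ : Commute (K + ℋ) Q := by
    refine Commute.add_left ?_ (hE.commute_referenceLog hQmem).symm
    rw [Commute, SemiconjBy, hKQ]
    have := congrArg Matrix.conjTranspose hKQ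
    rwa [Matrix.conjTranspose_mul, hKh.eq, hQh.eq, eq_comm] at this
  have hprod : A * E P = NormedSpace.exp (K + ℋ) * Q := by
    have h1 : NormedSpace.exp ℋ * Q = E P * Q := by
      rw [hE.exp_referenceLog, Matrix.add_mul, Matrix.sub_mul, hE.proj_mul_of_mem hQmem]
      simp
    have hQA : Q * A = A := by
      have := congrArg Matrix.conjTranspose hAQ
      rwa [Matrix.conjTranspose_mul, hpos.1.eq, hQh.eq] at this
    rw [Matrix.exp_add_of_commute _ _ (hE.commute_referenceLog hKmem), Matrix.mul_assoc, h1,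
      ← (hE.commute_reference hQmem).eq, ← Matrix.mul_assoc, hexp, Matrix.add_mul, Matrix.sub_mul,
      hQQ, hAQ]
    simp
  have hpd := exp_posDef hKH
  have hcE : Commute (NormedSpace.exp (K + ℋ)) Q := exp_commute hcQ
  refine ⟨Q, hQmem, K, hKmem, hQh, hQQ, hKh, hKQ, hAQ, hexp, ?_, ?_⟩
  · rw [hprod, opLog_mul_proj hpd.1 hQh hQQ hcE, opLog_exp hKH]
  · have hh : (NormedSpace.exp (K + ℋ) * Q).IsHermitian := by
      rw [Matrix.IsHermitian, Matrix.conjTranspose_mul, hpd.1.eq, hQh.eq, hcE.eq]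
    rw [hprod, cfc_mul_of_mul_eq _ hh hpd.1 (hcE.mul_left (Commute.refl Q))
      (by rw [Matrix.mul_assoc, hQQ])]
    have h0 : cfc (fun x : ℝ => if x = 0 then 1 else 0) (NormedSpace.exp (K + ℋ)) = 0 := by
      rw [← cfc_const_zero ℝ (NormedSpace.exp (K + ℋ))]
      refine cfc_congr fun x hx => ?_
      rw [hpd.1.spectrum_real_eq_range_eigenvalues] at hx
      obtain ⟨i, rfl⟩ := hx
      simp [(hpd.eigenvalues_pos i).ne']
    rw [h0, Matrix.zero_mul]

/-- Logarithms of operators in the range of `E` that are strictly positive on the range of `P`. -/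
theorem exists_log_of_posDef {X : Op n} (hX : X.PosSemidef) (hEX : E X = X)
    (hpd : (X + (1 - P)).PosDef) :
    ∃ K ∈ 𝒩, K.IsHermitian ∧ X = P * NormedSpace.exp K * E P ∧ opLog X = K + ℋ := by
  obtain ⟨A, hA, hApos, rfl⟩ := hE.exists_posSemidef_eq_mul_reference hX hEX
  obtain ⟨Q, hQ, K, hK, hQh, hQQ, hKh, hKQ, hAQ, hexp, hlog, -⟩ := hE.exists_log hA hApos
  have hQP : Q = P := by
    have h1 : (A * E P + (1 - P)) * (P - Q) = 0 := by
      have e1 : A * E P * P = A * E P := by rw [Matrix.mul_assoc, hE.mul_proj]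
      have e2 : A * E P * Q = A * E P := by
        rw [Matrix.mul_assoc, ← (hE.commute_reference hQ).eq, ← Matrix.mul_assoc, hAQ]
      simp only [Matrix.add_mul, Matrix.sub_mul, Matrix.mul_sub, Matrix.one_mul, hE.mul_self,
        hE.proj_mul_of_mem hQ, e1, e2]
      simp
    have h2 := hpd.isUnit.mul_left_cancel (h1.trans (Matrix.mul_zero _).symm)
    exact (sub_eq_zero.1 h2).symm
  subst hQP
  refine ⟨K, hK, hKh, ?_, ?_⟩
  · rw [hexp, Matrix.mul_add, Matrix.mul_sub, hE.proj_mul_of_mem hA, hE.mul_self]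
    simp
  · rw [hlog, Matrix.add_mul, hKQ, hE.referenceLog_mul_proj]

theorem exp_mul_reference_injective {K L : Op n} (hK : K ∈ 𝒩) (hKh : K.IsHermitian) (hL : L ∈ 𝒩)
    (hLh : L.IsHermitian) (h : P * NormedSpace.exp K * E P = P * NormedSpace.exp L * E P) :
    K = L := by
  have h1 := hE.eq_of_mul_reference_eq (hE.proj_mul_exp_mem hK hKh) (hE.proj_mul_exp_mem hL hLh) h
  rw [← opLog_exp hKh, ← opLog_exp hLh, hE.exp_eq_add hK hKh, hE.exp_eq_add hL hLh, h1]

theorem exp_mul_reference_mem {K : Op n} (hK : K ∈ 𝒩) (hKh : K.IsHermitian) :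
    E (P * NormedSpace.exp K * E P) = P * NormedSpace.exp K * E P := by
  rw [hE.apply_mul (hE.proj_mul_exp_mem hK hKh) (hE.proj_mul P) (hE.mul_proj P), hE.idem]

end IsRecurrentProjection

/-! ### Exponentials along trajectories -/

namespace QMP

namespace IsAsymptoticProjection

variable {n : Type*} [Fintype n] [DecidableEq n] {D : QMP n} {E : Module.End ℂ (Op n)}
  {U : Filter D.Time} {P τ : Op n} (hE : D.IsAsymptoticProjection D.gen E U)
  (hr : IsRecurrentProjection E P τ) (hτ : ∀ t, D.prop t τ = τ)

local notation "𝒩" => recurrentAlgebra E P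
local notation "β" => cornerEvolution D E P

include hE hr hτ in
theorem cornerEvolution_exp (t : D.Time) {K : Op n} (hK : K ∈ 𝒩) :
    β t (P * NormedSpace.exp K) = P * NormedSpace.exp (β t K) := by
  have hpow : ∀ k : ℕ, P * K ^ k ∈ 𝒩 ∧ β t (P * K ^ k) = P * β t K ^ k := by
    intro k
    induction k with
    | zero => simp [hr.proj_mem, hE.cornerEvolution_proj hr]
    | succ k ih =>
      rw [pow_succ, pow_succ, ← Matrix.mul_assoc, ← Matrix.mul_assoc]
      exact ⟨hr.mul_mem ih.1 hK, by rw [hE.cornerEvolution_mul hr hτ t ih.1, ih.2]⟩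
  have h1 := ((exp_hasSum K).mul_left P).map (β t)
    (LinearMap.continuous_of_finiteDimensional (β t))
  have h2 := (exp_hasSum (β t K)).mul_left P
  have e : (β t ∘ fun k : ℕ => P * ((k.factorial : ℂ)⁻¹ • K ^ k)) =
      fun k : ℕ => P * ((k.factorial : ℂ)⁻¹ • β t K ^ k) := by
    funext k
    rw [Function.comp_apply, Matrix.mul_smul, map_smul, (hpow k).2, Matrix.mul_smul]
  rw [e] at h1
  exact h1.unique h2

include hE hr hτ in
/-- The evolution of Gibbs operators. If `A₀` and `A` are the (reduced) logarithms of a trajectory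
at times `0` and `t`, then adding a constant of motion to the logarithm commutes with the evolution.
Since the reference operator need not be invariant, `A` differs from the evolved `A₀` by a central
term `A - B`. -/
theorem prop_exp_add (t : D.Time) {A₀ A V : Op n} (hA₀ : A₀ ∈ 𝒩) (hA₀h : A₀.IsHermitian)
    (hA : A ∈ 𝒩) (hAh : A.IsHermitian) (hV : V ∈ 𝒩) (hVh : V.IsHermitian)
    (h : D.prop t (P * NormedSpace.exp A₀ * E P) = P * NormedSpace.exp A * E P) :
    D.prop t (P * NormedSpace.exp (A₀ + β t V) * E P) = P * NormedSpace.exp (A + V) * E P := by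
  obtain ⟨B, hB, hBh, rfl⟩ := hE.exists_cornerEvolution_eq hr t hA₀ hA₀h
  have hEP : E (E P) = E P := hr.idem P
  obtain ⟨z, hz, hzP⟩ := hr.exists_eq_mul_reference (X := D.prop t (E P))
    (by rw [hE.apply_prop, hEP])
  -- `z` is central in the recurrent algebra
  have hcentral : ∀ y ∈ 𝒩, Commute z y := by
    intro y hy
    have h1 := hE.prop_mul_cornerEvolution hr hτ t hEP hy
    have h2 := hE.prop_cornerEvolution_mul hr hτ t hEP hy
    rw [(hr.commute_reference (hE.cornerEvolution_mem hr t y)).eq, h1, hzP, Matrix.mul_assoc,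
      ← (hr.commute_reference hy).eq, ← Matrix.mul_assoc, ← Matrix.mul_assoc] at h2
    exact hr.eq_of_mul_reference_eq (hr.mul_mem hz hy) (hr.mul_mem hy hz) h2
  have hstep : ∀ K ∈ 𝒩, K.IsHermitian → D.prop t (P * NormedSpace.exp (β t K) * E P) =
      z * (P * NormedSpace.exp K) * E P := by
    intro K hK hKh
    rw [← hE.cornerEvolution_exp hr hτ t hK,
      hE.prop_cornerEvolution_mul hr hτ t hEP (hr.proj_mul_exp_mem hK hKh), hzP, ← Matrix.mul_assoc,
      ← (hcentral _ (hr.proj_mul_exp_mem hK hKh)).eq]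
  have hzB : z * NormedSpace.exp B = P * NormedSpace.exp A := by
    have h1 := hstep B hB hBh
    rw [h] at h1
    have h2 := hr.eq_of_mul_reference_eq (hr.proj_mul_exp_mem hA hAh)
      (hr.mul_mem hz (hr.proj_mul_exp_mem hB hBh)) h1
    rw [h2, ← Matrix.mul_assoc, hr.mul_proj_of_mem hz]
  -- centrality of `z` shows that `exp A` commutes with `B`, hence so does its logarithm `A`
  have hAB : Commute A B := by
    have h1 : Commute (NormedSpace.exp A) B := by
      rw [hr.exp_eq_add hA hAh, ← hzB]
      refine ((hcentral B hB).mul_left (exp_commute (Commute.refl B))).add_left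
        ((Commute.one_left B).sub_left ?_)
      exact (hr.proj_mul_of_mem hB).trans (hr.mul_proj_of_mem hB).symm
    have h2 := opLog_mul_commute h1
    rwa [opLog_exp hAh] at h2
  set ζ := A - B with hζ
  have hζmem : ζ ∈ 𝒩 := (𝒩).sub_mem hA hB
  have hζh : ζ.IsHermitian := hAh.sub hBh
  have hPζ : P * NormedSpace.exp ζ = z := by
    have h1 : NormedSpace.exp ζ = NormedSpace.exp A * NormedSpace.exp (-B) := by
      rw [hζ, sub_eq_add_neg, Matrix.exp_add_of_commute _ _ hAB.neg_right]
    rw [h1, ← Matrix.mul_assoc, ← hzB, Matrix.mul_assoc, exp_mul_exp_neg, Matrix.mul_one]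
  have hζc : ∀ y ∈ 𝒩, Commute ζ y := by
    intro y hy
    have h1 : Commute (NormedSpace.exp ζ) y := by
      rw [hr.exp_eq_add hζmem hζh, hPζ]
      refine (hcentral y hy).add_left ((Commute.one_left y).sub_left ?_)
      exact (hr.proj_mul_of_mem hy).trans (hr.mul_proj_of_mem hy).symm
    have h2 := opLog_mul_commute h1
    rwa [opLog_exp hζh] at h2
  have hBV : B + V ∈ 𝒩 := (𝒩).add_mem hB hV
  rw [← map_add, hstep _ hBV (hBh.add hVh), ← Matrix.mul_assoc, hr.mul_proj_of_mem hz, ← hPζ,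
    Matrix.mul_assoc P, ← Matrix.exp_add_of_commute _ _ (hζc _ hBV)]
  congr 3
  rw [hζ]
  abel

end IsAsymptoticProjection

/-! ### Constants of motion -/

section Constants

variable {n : Type*} [Fintype n] [DecidableEq n] {D : QMP n} {E : Module.End ℂ (Op n)}
  {U : Filter D.Time} {P τ : Op n} (hE : D.IsAsymptoticProjection D.gen E U)
  (hr : IsRecurrentProjection E P τ)

/-- Constants of motion are the trajectories of the Heisenberg evolution, run backwards. -/
theorem adjoint_prop_constant {C : D.Time → Op n} (hC : C ∈ D.constantsOfMotion) (t s : D.Time) :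
    hsAdjoint (D.prop t) (C (t + s)) = C s := by
  have h : Matrix.traceLinearMap n ℂ ℂ ∘ₗ LinearMap.mulRight ℂ (hsAdjoint (D.prop t) (C (t + s))) =
      Matrix.traceLinearMap n ℂ ℂ ∘ₗ LinearMap.mulRight ℂ (C s) := by
    refine ext_of_density fun X hX => ?_
    have h1 := hC.2.2 X hX t s
    rw [Matrix.trace_mul_comm,
      trace_mul_hsAdjoint (D.prop_isSchwarzChannel t).map_conjTranspose,
      Matrix.trace_mul_comm (C s)] at h1
    exact h1
  exact Matrix.ext_iff_trace_mul_left.2 fun X => LinearMap.congr_fun h X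

include hE in
theorem IsAsymptoticProjection.adjoint_constant {C : D.Time → Op n} (hC : C ∈ D.constantsOfMotion)
    (t : D.Time) : hsAdjoint E (C t) = C t :=
  hE.mem_dualAttractorSpace_iff.1 (hC.2.1 t)

include hE in
/-- A constant of motion is determined by its value at one time. -/
theorem IsAsymptoticProjection.constant_eq_zero {C : D.Time → Op n}
    (hC : C ∈ D.constantsOfMotion) {t : D.Time} (h : C t = 0) : C = 0 := by
  have h0 : C 0 = 0 := by
    have h1 := adjoint_prop_constant hC t 0
    rw [add_zero, h, map_zero] at h1
    exact h1.symm
  funext s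
  have h1 := adjoint_prop_constant hC s 0
  rw [add_zero, h0] at h1
  exact hE.eq_zero_of_adjoint_prop_eq_zero (hE.adjoint_constant hC s) h1

include hE in
/-- Every Hermitian element of the Heisenberg attractor space is the value of a constant of motion at
a given time: the Heisenberg evolution is invertible on the attractor space. -/
theorem IsAsymptoticProjection.exists_constant (t : D.Time) {Y : Op n} (hYh : Y.IsHermitian)
    (hY : hsAdjoint E Y = Y) : ∃ C ∈ D.constantsOfMotion, C t = Y := by
  have hEE := hE.hsAdjoint_gen.idem
  let W := LinearMap.range (hsAdjoint E)
  have hW : ∀ {A}, A ∈ W ↔ hsAdjoint E A = A := fun {A} =>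
    ⟨fun ⟨B, hB⟩ => by rw [← hB, hEE], fun h => ⟨A, h⟩⟩
  have hmaps : ∀ s, ∀ A ∈ W, hsAdjoint (D.prop s) A ∈ W := fun s A hA => by
    rw [hW, hE.adjoint_apply_prop, hW.1 hA]
  have hex : ∀ s, ∃ A, hsAdjoint E A = A ∧ hsAdjoint (D.prop s) A = hsAdjoint (D.prop t) Y := by
    intro s
    let f : W →ₗ[ℂ] W := (hsAdjoint (D.prop s)).restrict (hmaps s)
    have hinj : Function.Injective f := by
      rw [injective_iff_map_eq_zero]
      intro A hA
      exact Subtype.ext (hE.eq_zero_of_adjoint_prop_eq_zero (hW.1 A.2) (congrArg Subtype.val hA))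
    obtain ⟨⟨B, hB⟩, hBA⟩ := LinearMap.injective_iff_surjective.1 hinj ⟨_, hmaps t Y (hW.2 hY)⟩
    exact ⟨B, hW.1 hB, congrArg Subtype.val hBA⟩
  choose C hCE hC using hex
  have hinj : ∀ s A B, hsAdjoint E A = A → hsAdjoint E B = B →
      hsAdjoint (D.prop s) A = hsAdjoint (D.prop s) B → A = B := by
    intro s A B hA hB h
    refine sub_eq_zero.1 (hE.eq_zero_of_adjoint_prop_eq_zero (t := s) ?_ ?_)
    · rw [map_sub, hA, hB]
    · rw [map_sub, h, sub_self]
  have hch := hE.isSchwarzChannel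
  refine ⟨C, ⟨fun s => ?_, fun s => hE.mem_dualAttractorSpace_iff.2 (hCE s), ?_⟩,
    hinj t _ _ (hCE t) hY (hC t)⟩
  · refine hinj s _ _ (by rw [hch.adjoint_conjTranspose, hCE]) (hCE s) ?_
    rw [(D.prop_isSchwarzChannel s).adjoint_conjTranspose, hC,
      ← (D.prop_isSchwarzChannel t).adjoint_conjTranspose, hYh.eq]
  · intro ρ hρ r s
    have h1 : D.prop (r + s) =
        ((D.prop r : Module.End ℂ (Op n)) * D.prop s : Module.End ℂ (Op n)) :=
      LinearMap.ext fun X => D.prop_add r s X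
    have h2 : hsAdjoint (D.prop r) (C (r + s)) = C s := by
      refine hinj s _ _ (by rw [hE.adjoint_apply_prop, hCE]) (hCE s) ?_
      have h3 := hC (r + s)
      rw [h1, hsAdjoint_mul, Module.End.mul_apply] at h3
      rw [h3, hC]
    rw [Matrix.trace_mul_comm, trace_mul_hsAdjoint (D.prop_isSchwarzChannel r).map_conjTranspose,
      h2, Matrix.trace_mul_comm]

variable {d : ℕ} {C : Fin d → D.Time → Op n} (hC : D.IsBasisOfConstants C)

include hC in
theorem IsBasisOfConstants.mem (j : Fin d) : C j ∈ D.constantsOfMotion := by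
  rw [← hC.2]
  exact Submodule.subset_span ⟨j.succ, by simp⟩

include hC in
theorem IsBasisOfConstants.one_mem : (fun _ => 1) ∈ D.constantsOfMotion := by
  rw [← hC.2]
  exact Submodule.subset_span ⟨0, by simp⟩

include hE hC in
theorem IsAsymptoticProjection.exists_eq_sum_constants (t : D.Time) {Y : Op n}
    (hYh : Y.IsHermitian) (hY : hsAdjoint E Y = Y) :
    ∃ (κ : ℝ) (γ : Fin d → ℝ), Y = κ • (1 : Op n) + ∑ j, γ j • C j t := by
  obtain ⟨B, hB, rfl⟩ := hE.exists_constant t hYh hY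
  rw [← hC.2, Submodule.mem_span_range_iff_exists_fun] at hB
  obtain ⟨g, rfl⟩ := hB
  refine ⟨g 0, fun j => g j.succ, ?_⟩
  rw [Fin.sum_univ_succ]
  simp [Finset.sum_apply]

include hE hr hC in
/-- The compressed constants of motion span the Hermitian part of the recurrent algebra. -/
theorem IsAsymptoticProjection.exists_eq_sum_compressed (t : D.Time) {A : Op n}
    (hAh : A.IsHermitian) (hA : A ∈ recurrentAlgebra E P) :
    ∃ (κ : ℝ) (γ : Fin d → ℝ), A = κ • P + ∑ j, γ j • (P * C j t * P) := by
  obtain ⟨κ, γ, h⟩ := hE.exists_eq_sum_constants hC t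
    (show (hsAdjoint E A).IsHermitian by
      rw [Matrix.IsHermitian, ← hr.channel.adjoint_conjTranspose, hAh.eq]) (hr.adjoint_idem A)
  refine ⟨κ, γ, ?_⟩
  rw [← IsRecurrentProjection.mem_iff.1 hA, cornerAdjoint_apply, h, Matrix.mul_add, Matrix.add_mul,
    Matrix.mul_smul, Matrix.smul_mul, Matrix.mul_one, hr.mul_self, Finset.mul_sum, Finset.sum_mul]
  simp only [Matrix.mul_smul, Matrix.smul_mul]

include hE hr hC in
theorem IsAsymptoticProjection.compressed_independent (t : D.Time) {κ : ℝ} {γ : Fin d → ℝ}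
    (h : κ • P + ∑ j, γ j • (P * C j t * P) = 0) : κ = 0 ∧ γ = 0 := by
  set B : D.Time → Op n := κ • (fun _ : D.Time => (1 : Op n)) + ∑ j, γ j • C j
    with hB
  have hBmem : B ∈ D.constantsOfMotion := Submodule.add_mem _
    (Submodule.smul_mem _ _ hC.one_mem)
    (Submodule.sum_mem _ fun j _ => Submodule.smul_mem _ _ (hC.mem j))
  have hBt : P * B t * P = 0 := by
    rw [← h, hB]
    simp [Finset.sum_apply, Matrix.mul_add, Matrix.add_mul, hr.mul_self, Finset.mul_sum,
      Finset.sum_mul]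
  have hB0 : B = 0 := by
    refine hE.constant_eq_zero hBmem (t := t) ?_
    rw [← hE.adjoint_constant hBmem t, ← hr.adjoint_compress, hBt, map_zero]
  have hli := Fintype.linearIndependent_iff.1 hC.1 (Fin.cons κ γ) (by
    rw [Fin.sum_univ_succ]
    simpa [hB] using hB0)
  exact ⟨hli 0, funext fun j => hli j.succ⟩

end Constants

end QMP

/-! ### The Pythagorean identity for the relative entropy -/

namespace IsRecurrentProjection

variable {n : Type*} [Fintype n] [DecidableEq n] {E : Module.End ℂ (Op n)} {P τ : Op n}
  (hE : IsRecurrentProjection E P τ)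
include hE

local notation "𝒩" => recurrentAlgebra E P
local notation "ℋ" => referenceLog E P

omit hE in
theorem _root_.mul_exp_smul_proj {R : Op n} (hR : R.IsHermitian) (hRR : R * R = R) (κ : ℝ) :
    R * NormedSpace.exp (κ • R) = Real.exp κ • R := by
  have hκ : (κ • R).IsHermitian := by
    rw [Matrix.IsHermitian, Matrix.conjTranspose_smul, hR.eq, star_trivial]
  have hκ1 : (algebraMap ℝ (Op n) κ).IsHermitian := by
    rw [Algebra.algebraMap_eq_smul_one, Matrix.IsHermitian, Matrix.conjTranspose_smul,
      Matrix.conjTranspose_one, star_trivial]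
  have hc : Commute (κ • R) R := (Commute.refl R).smul_left κ
  rw [← (exp_commute hc).eq, ← cfc_exp hκ, cfc_mul_of_mul_eq Real.exp hκ hκ1 hc
    (by rw [Algebra.algebraMap_eq_smul_one, Matrix.smul_mul, Matrix.smul_mul, hRR, Matrix.one_mul]),
    cfc_algebraMap, Algebra.algebraMap_eq_smul_one, Matrix.smul_mul, Matrix.one_mul]

omit hE in
theorem real_smul_mem (r : ℝ) {A : Op n} (hA : A ∈ 𝒩) : r • A ∈ 𝒩 := by
  rw [← Complex.coe_smul]; exact (𝒩).smul_mem _ hA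

omit hE [Fintype n] [DecidableEq n] in
theorem _root_.Matrix.IsHermitian.real_smul {A : Op n} (hA : A.IsHermitian) (r : ℝ) :
    (r • A).IsHermitian := by
  rw [Matrix.IsHermitian, Matrix.conjTranspose_smul, hA.eq, star_trivial]

/-- Adding a multiple of `P` to the exponent is a normalization. -/
theorem exp_add_smul_proj {K : Op n} (hK : K ∈ 𝒩) (κ : ℝ) :
    P * NormedSpace.exp (K + κ • P) * E P = Real.exp κ • (P * NormedSpace.exp K * E P) := by
  have hc : Commute K P := (hE.mul_proj_of_mem hK).trans (hE.proj_mul_of_mem hK).symm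
  rw [Matrix.exp_add_of_commute _ _ (hc.smul_right κ),
    ← (exp_commute (exp_commute (hc.smul_right κ)).symm).eq, ← Matrix.mul_assoc,
    mul_exp_smul_proj hE.isHermitian hE.mul_self, Matrix.smul_mul, Matrix.smul_mul]

theorem exp_mul_reference_posSemidef {K : Op n} (hK : K ∈ 𝒩) (hKh : K.IsHermitian) :
    (P * NormedSpace.exp K * E P).PosSemidef := by
  have hS : (K + ℋ).IsHermitian := hKh.add (referenceLog_isHermitian E P)
  have hc : Commute (K + ℋ) P := Commute.add_left
    ((hE.mul_proj_of_mem hK).trans (hE.proj_mul_of_mem hK).symm)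
    (hE.referenceLog_mul_proj.trans hE.proj_mul_referenceLog.symm)
  have h := (exp_posDef hS).posSemidef.mul_mul_conjTranspose_same P
  rwa [hE.isHermitian.eq, Matrix.mul_assoc, (exp_commute hc).eq, ← Matrix.mul_assoc, hE.mul_self,
    hE.proj_mul_exp_add_referenceLog hK] at h

theorem exp_mul_reference_trace_pos {K : Op n} (hK : K ∈ 𝒩) (hKh : K.IsHermitian) :
    0 < (P * NormedSpace.exp K * E P).trace := by
  have hpos := hE.exp_mul_reference_posSemidef hK hKh
  refine lt_of_le_of_ne hpos.trace_nonneg fun h0 => ?_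
  have h1 := hpos.trace_eq_zero_iff.1 h0.symm
  rw [← hE.proj_mul_exp_add_referenceLog hK] at h1
  have hP0 : P = 0 := by
    have h2 := congrArg (· * NormedSpace.exp (-(K + ℋ))) h1
    simpa only [Matrix.mul_assoc, exp_mul_exp_neg, Matrix.mul_one, Matrix.zero_mul] using h2
  have h3 := hE.density.2
  rw [← hE.proj_mul_state, hP0] at h3
  simp at h3

/-- The Pythagorean identity behind the minimum relative entropy principle: if `E ω = ρ`, then
`S(ω|σ) - S(ρ|σ) = S(ω|ρ)`, which is positive for `ω ≠ ρ` by Klein's inequality. -/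
theorem relEntropy_lt {σ ρ ω : Op n} (hσ : σ.PosSemidef) (hEσ : E σ = σ)
    (hσP : opSupport σ = opSupport P) (hρ : IsDensity ρ) (hω : IsDensity ω) (hωρ : E ω = ρ)
    (hne : ω ≠ ρ) : relEntropy ρ σ < relEntropy ω σ := by
  have hEρ : E ρ = ρ := by rw [← hωρ, hE.idem]
  have hPρ : P * ρ = ρ := by rw [← hEρ, hE.proj_mul]
  have hρP : ρ * P = ρ := by rw [← hEρ, hE.mul_proj]
  rw [relEntropy, relEntropy, hσP, if_pos ((opSupport_le_iff hE.mul_self).2 hPρ)]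
  split_ifs with hsupp
  swap
  · exact EReal.coe_lt_top _
  have hPω := (opSupport_le_iff hE.mul_self).1 hsupp
  have hωP : ω * P = ω := by
    have := congrArg Matrix.conjTranspose hPω
    rwa [Matrix.conjTranspose_mul, hE.isHermitian.eq, hω.1.1.eq] at this
  obtain ⟨B, hB, hBh, -, hlogσ⟩ := hE.exists_log_of_posDef hσ hEσ
    (posDef_add_compl_of_opSupport_eq hσ hE.isHermitian hE.mul_self hσP)
  obtain ⟨A, hA, hApos, hρA⟩ := hE.exists_posSemidef_eq_mul_reference hρ.1 hEρ
  obtain ⟨Q, hQ, K, hK, hQh, hQQ, hKh, hKQ, hAQ, -, hlogρ, hker⟩ := hE.exists_log hA hApos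
  rw [← hρA] at hlogρ hker
  have hρQ : ρ * Q = ρ := by
    rw [hρA, Matrix.mul_assoc, ← (hE.commute_reference hQ).eq, ← Matrix.mul_assoc, hAQ]
  have hQρ : Q * ρ = ρ := by
    have := congrArg Matrix.conjTranspose hρQ
    rwa [Matrix.conjTranspose_mul, hQh.eq, hρ.1.1.eq] at this
  have hexp : ∀ X, P * X = X → X * P = X → E X = ρ → ∀ Y ∈ 𝒩, (X * Y).trace = (ρ * Y).trace := by
    intro X h1 h2 h3 Y hY
    rw [← h3, ← trace_mul_cornerAdjoint hE.channel h1 h2, mem_iff.1 hY]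
  -- `ω` has the same vanishing expectation of `P - Q` as `ρ`, so it lives on the support of `ρ`
  have hωPQ := hω.1.mul_proj_eq_zero (hE.isHermitian.sub hQh) (by
    simp only [Matrix.mul_sub, Matrix.sub_mul, hE.mul_self, hQQ, hE.mul_proj_of_mem hQ,
      hE.proj_mul_of_mem hQ]
    abel) (by
    rw [hexp ω hPω hωP hωρ _ ((𝒩).sub_mem hE.proj_mem hQ), Matrix.mul_sub, hρP, hρQ, sub_self]
    simp)
  have hωQ : ω * Q = ω := by
    have := hωPQ.1
    rwa [Matrix.mul_sub, hωP, sub_eq_zero, eq_comm] at this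
  have hQω : Q * ω = ω := by
    have := hωPQ.2
    rwa [Matrix.sub_mul, hPω, sub_eq_zero, eq_comm] at this
  -- on the support of `ρ` the operator `ln ρ - ln σ` agrees with `K - B`, an element of `𝒩`
  have hcross : ∀ X, P * X = X → X * P = X → X * Q = X → Q * X = X → E X = ρ →
      (X * (opLog ρ - opLog σ)).trace = (ρ * (K - B)).trace := by
    intro X h1 h2 h3 h4 h5
    have e : (X * ((K + ℋ) * Q)).trace = (X * (K + ℋ)).trace := by
      rw [← Matrix.mul_assoc, Matrix.trace_mul_comm, ← Matrix.mul_assoc, h4]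
    rw [← hexp X h1 h2 h5 _ ((𝒩).sub_mem hK hB), hlogρ, hlogσ, Matrix.mul_sub, Matrix.trace_sub, e,
      ← Matrix.trace_sub, ← Matrix.mul_sub, add_sub_add_right_eq_sub]
  have h1 := hcross ω hPω hωP hωQ hQω hωρ
  have h2 := hcross ρ hPρ hρP hρQ hQρ hEρ
  have hklein := klein_inequality hω.1 hρ.1 (hω.2.trans hρ.2.symm) (by
    rw [← hQω, Matrix.mul_assoc, Matrix.trace_mul_comm, Matrix.mul_assoc, hker]
    simp) hne
  have h3 : (ω * (opLog ω - opLog σ)).trace =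
      (ω * (opLog ω - opLog ρ)).trace + (ρ * (opLog ρ - opLog σ)).trace := by
    rw [h2, ← h1, ← Matrix.trace_add, ← Matrix.mul_add, sub_add_sub_cancel]
  rw [h3, Complex.add_re, EReal.coe_lt_coe_iff]
  linarith

end IsRecurrentProjection

/-! ### Gibbs operators -/

namespace QMP

/-- `σ` evolves under the process, and `A t` is the logarithm of `σ t` minus the logarithm of the
reference operator, as a Hermitian element of the recurrent algebra. -/
structure IsReducedLog {n : Type*} [Fintype n] [DecidableEq n] {D : QMP n}
    (E : Module.End ℂ (Op n)) (P : Op n) (σ A : D.Time → Op n) : Prop where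
  mem : ∀ t, A t ∈ recurrentAlgebra E P
  isHermitian : ∀ t, (A t).IsHermitian
  eq_exp : ∀ t, σ t = P * NormedSpace.exp (A t) * E P
  opLog_eq : ∀ t, opLog (σ t) = A t + referenceLog E P
  evolve : ∀ t, σ t = D.prop t (σ 0)

section Gibbs

variable {n : Type*} [Fintype n] [DecidableEq n] {D : QMP n} {E : Module.End ℂ (Op n)}
  {U : Filter D.Time} {P τ : Op n} (hE : D.IsAsymptoticProjection D.gen E U)
  (hr : IsRecurrentProjection E P τ) (hτ : ∀ t, D.prop t τ = τ)

local notation "𝒩" => recurrentAlgebra E P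
local notation "ℋ" => referenceLog E P

include hE in
theorem IsAsymptoticProjection.trajectory_isDensity {ρ₀ : Op n} (hρ₀ : IsDensity ρ₀) (t : D.Time) :
    IsDensity (D.prop t (E ρ₀)) :=
  (D.prop_isSchwarzChannel t).isDensity (hE.isSchwarzChannel.isDensity hρ₀)

include hE in
theorem IsAsymptoticProjection.apply_trajectory (ρ₀ : Op n) (t : D.Time) :
    E (D.prop t (E ρ₀)) = D.prop t (E ρ₀) := by
  rw [hE.apply_prop, hE.idem]

include hE hr in
theorem IsTTrajectory.exists_isReducedLog {σ : D.Time → Op n} (hσ : D.IsTTrajectory P σ) :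
    ∃ A, IsReducedLog E P σ A := by
  obtain ⟨⟨σ₀, hσ₀, htraj⟩, hsupp⟩ := hσ
  have heq := hE.eq_prop_of_isAsymptoticTrajectory htraj
  have hex : ∀ t, ∃ K ∈ 𝒩, K.IsHermitian ∧ σ t = P * NormedSpace.exp K * E P ∧
      opLog (σ t) = K + ℋ := by
    intro t
    have hd := hE.trajectory_isDensity hσ₀ t
    rw [← heq] at hd
    exact hr.exists_log_of_posDef hd.1 (by rw [heq, hE.apply_trajectory])
      (posDef_add_compl_of_opSupport_eq hd.1 hr.isHermitian hr.mul_self (hsupp t))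
  choose A h1 h2 h3 h4 using hex
  exact ⟨A, h1, h2, h3, h4, fun t => by rw [heq t, heq 0, prop_zero]⟩

variable {d : ℕ} {C : Fin d → D.Time → Op n} (hC : D.IsBasisOfConstants C)
  {σ A : D.Time → Op n} (hA : IsReducedLog E P σ A)

/-- The part `-∑ j, γ j • P C_j(t) P` of the exponent of the Gibbs operator. -/
noncomputable def gibbsShift (P : Op n) (C : Fin d → D.Time → Op n) (γ : Fin d → ℝ) (t : D.Time) :
    Op n := -∑ j, γ j • (P * C j t * P)

include hE hr hC in
theorem gibbsShift_mem (γ : Fin d → ℝ) (t : D.Time) :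
    gibbsShift P C γ t ∈ 𝒩 ∧ (gibbsShift P C γ t).IsHermitian := by
  constructor
  · refine (𝒩).neg_mem ((𝒩).sum_mem fun j _ =>
      IsRecurrentProjection.real_smul_mem _ (hr.adjoint_corner_mem ?_))
    exact hE.adjoint_constant (hC.mem j) t
  · refine Matrix.IsHermitian.neg ?_
    rw [Matrix.IsHermitian, Matrix.conjTranspose_sum]
    refine Finset.sum_congr rfl fun j _ => ?_
    rw [Matrix.conjTranspose_smul, star_trivial, Matrix.conjTranspose_mul, Matrix.conjTranspose_mul,
      hr.isHermitian.eq, ((hC.mem j).1 t).eq, Matrix.mul_assoc]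

include hE hr hC in
theorem cornerEvolution_gibbsShift (γ : Fin d → ℝ) (t : D.Time) :
    cornerEvolution D E P t (gibbsShift P C γ t) = gibbsShift P C γ 0 := by
  rw [gibbsShift, gibbsShift, map_neg, map_sum]
  congr 1
  refine Finset.sum_congr rfl fun j _ => ?_
  have h := adjoint_prop_constant (hC.mem j) t 0
  rw [add_zero] at h
  rw [LinearMap.map_smul_of_tower, hE.cornerEvolution_apply, hr.adjoint_compress,
    hE.adjoint_constant (hC.mem j), h]

include hE hr hC hA in
theorem gibbsOp_eq (γ : Fin d → ℝ) (t : D.Time) : D.gibbsOp σ P C γ t =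
    P * NormedSpace.exp (A t + gibbsShift P C γ t) * E P := by
  rw [gibbsOp, hA.opLog_eq, ← hr.proj_mul_exp_add_referenceLog
    ((𝒩).add_mem (hA.mem t) (gibbsShift_mem hE hr hC γ t).1), gibbsShift]
  congr 2
  abel

include hE hr hτ hC hA in
/-- The Gibbs operators evolve as a trajectory of the process. -/
theorem prop_gibbsOp (γ : Fin d → ℝ) (t : D.Time) :
    D.prop t (D.gibbsOp σ P C γ 0) = D.gibbsOp σ P C γ t := by
  rw [gibbsOp_eq hE hr hC hA, gibbsOp_eq hE hr hC hA, ← cornerEvolution_gibbsShift hE hr hC γ t]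
  exact hE.prop_exp_add hr hτ t (hA.mem 0) (hA.isHermitian 0) (hA.mem t) (hA.isHermitian t)
    (gibbsShift_mem hE hr hC γ t).1 (gibbsShift_mem hE hr hC γ t).2
    (by rw [← hA.eq_exp, ← hA.eq_exp, ← hA.evolve])

include hE hr hC hA in
theorem gibbsOp_mem (γ : Fin d → ℝ) : E (D.gibbsOp σ P C γ 0) = D.gibbsOp σ P C γ 0 := by
  have hV := gibbsShift_mem hE hr hC γ 0
  rw [gibbsOp_eq hE hr hC hA, hr.exp_mul_reference_mem ((𝒩).add_mem (hA.mem 0) hV.1)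
    ((hA.isHermitian 0).add hV.2)]

/-- The partition function, defined at time `0`: the trace of the Gibbs operator is real and does not
depend on time. -/
noncomputable def partitionFunction (D : QMP n) (σ : D.Time → Op n) (P : Op n)
    (C : Fin d → D.Time → Op n) (γ : Fin d → ℝ) : ℝ := (D.gibbsOp σ P C γ 0).trace.re

include hE hr hC hA in
theorem partitionFunction_pos (γ : Fin d → ℝ) : 0 < partitionFunction D σ P C γ ∧
    (D.gibbsOp σ P C γ 0).trace = (partitionFunction D σ P C γ : ℂ) := by
  have hV := gibbsShift_mem hE hr hC γ 0
  have h := hr.exp_mul_reference_trace_pos ((𝒩).add_mem (hA.mem 0) hV.1)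
    ((hA.isHermitian 0).add hV.2)
  rw [← gibbsOp_eq hE hr hC hA, Complex.lt_def] at h
  exact ⟨h.1, Complex.ext rfl (by simpa using h.2.symm)⟩

include hE hC in
/-- The expectation values of the constants of motion determine the asymptotic part of a state. -/
theorem apply_eq_of_expectations (t : D.Time) {X Y : Op n} (htr : X.trace = Y.trace)
    (h : ∀ j, (C j t * X).trace = (C j t * Y).trace) : E X = E Y := by
  have hst := hE.isSchwarzChannel.map_conjTranspose
  have hf : Matrix.traceLinearMap n ℂ ℂ ∘ₗ LinearMap.mulLeft ℂ (E X) =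
      Matrix.traceLinearMap n ℂ ℂ ∘ₗ LinearMap.mulLeft ℂ (E Y) := by
    refine LinearMap.ext_posSemidef fun B hB => ?_
    obtain ⟨κ, γ, hκ⟩ := hE.exists_eq_sum_constants hC t (Y := hsAdjoint E B)
      (by rw [Matrix.IsHermitian, ← hE.isSchwarzChannel.adjoint_conjTranspose, hB.1.eq])
      (hE.hsAdjoint_gen.idem B)
    change (E X * B).trace = (E Y * B).trace
    rw [trace_mul_hsAdjoint hst, trace_mul_hsAdjoint hst, hκ]
    simp only [Matrix.mul_add, Matrix.mul_smul, Matrix.mul_one, Finset.mul_sum, Matrix.trace_add,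
      Matrix.trace_smul, Matrix.trace_sum, htr]
    congr 1
    refine Finset.sum_congr rfl fun j _ => ?_
    rw [Matrix.trace_mul_comm X, Matrix.trace_mul_comm Y, h]
  exact Matrix.ext_iff_trace_mul_right.2 fun B => LinearMap.congr_fun hf B

include hE hr hC hA in
/-- An exponential whose exponent differs from that of a Gibbs operator by a multiple of `P` is,
after normalization, that Gibbs operator. -/
theorem normalized_eq_gibbsOp {X : Op n} {γ : Fin d → ℝ} {κ : ℝ}
    (h : X = Real.exp κ • D.gibbsOp σ P C γ 0) :
    (X.trace.re)⁻¹ • X = (partitionFunction D σ P C γ)⁻¹ • D.gibbsOp σ P C γ 0 := by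
  have hZ := partitionFunction_pos hE hr hC hA γ
  have h1 : X.trace.re = Real.exp κ * partitionFunction D σ P C γ := by
    rw [h, Matrix.trace_smul, Complex.smul_re, smul_eq_mul, partitionFunction]
  rw [h1, h, smul_smul, mul_inv, mul_comm, ← mul_assoc, mul_inv_cancel₀ (Real.exp_pos κ).ne',
    one_mul]

include hE hr hC hA in
/-- The multipliers of a normalized Gibbs operator are unique: the normalization is a multiple of `P`
in the exponent, and `P` is independent of the compressed constants. -/
theorem gibbsOp_injective {γ γ' : Fin d → ℝ}
    (h : (partitionFunction D σ P C γ)⁻¹ • D.gibbsOp σ P C γ 0 =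
      (partitionFunction D σ P C γ')⁻¹ • D.gibbsOp σ P C γ' 0) : γ = γ' := by
  have key : ∀ γ : Fin d → ℝ, (partitionFunction D σ P C γ)⁻¹ • D.gibbsOp σ P C γ 0 =
      P * NormedSpace.exp (A 0 + gibbsShift P C γ 0 +
        (-Real.log (partitionFunction D σ P C γ)) • P) * E P := by
    intro γ
    have hV := gibbsShift_mem hE hr hC γ 0
    rw [hr.exp_add_smul_proj ((𝒩).add_mem (hA.mem 0) hV.1), ← gibbsOp_eq hE hr hC hA,
      Real.exp_neg, Real.exp_log (partitionFunction_pos hE hr hC hA γ).1]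
  rw [key, key] at h
  have hm : ∀ (γ : Fin d → ℝ) (κ : ℝ), A 0 + gibbsShift P C γ 0 + κ • P ∈ 𝒩 ∧
      (A 0 + gibbsShift P C γ 0 + κ • P).IsHermitian := fun γ κ =>
    have hV := gibbsShift_mem hE hr hC γ 0
    ⟨(𝒩).add_mem ((𝒩).add_mem (hA.mem 0) hV.1) (IsRecurrentProjection.real_smul_mem _ hr.proj_mem),
      ((hA.isHermitian 0).add hV.2).add (hr.isHermitian.real_smul κ)⟩
  have h1 := hr.exp_mul_reference_injective (hm _ _).1 (hm _ _).2 (hm _ _).1 (hm _ _).2 h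
  have h2 : (Real.log (partitionFunction D σ P C γ') - Real.log (partitionFunction D σ P C γ)) • P +
      ∑ j, (γ' - γ) j • (P * C j 0 * P) = 0 := by
    simp only [gibbsShift] at h1
    simp only [Pi.sub_apply, sub_smul, Finset.sum_sub_distrib]
    rw [← sub_eq_zero] at h1
    rw [← h1]
    module
  have h3 := (hE.compressed_independent hr hC 0 h2).2
  exact (sub_eq_zero.1 h3).symm

include hE hr hC hA in
/-- Every state of the attractor space that is strictly positive on the range of `P` is a normalized
Gibbs operator. -/
theorem exists_eq_gibbsOp {ρ : Op n} (hρ : IsDensity ρ) (hEρ : E ρ = ρ)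
    (hsupp : opSupport ρ = opSupport P) :
    ∃ γ, ρ = (partitionFunction D σ P C γ)⁻¹ • D.gibbsOp σ P C γ 0 := by
  obtain ⟨B, hB, hBh, hρB, -⟩ := hr.exists_log_of_posDef hρ.1 hEρ
    (posDef_add_compl_of_opSupport_eq hρ.1 hr.isHermitian hr.mul_self hsupp)
  obtain ⟨κ, γ, hκ⟩ := hE.exists_eq_sum_compressed hr hC 0 (hBh.sub (hA.isHermitian 0))
    ((𝒩).sub_mem hB (hA.mem 0))
  have hBeq : B = A 0 + gibbsShift P C (-γ) 0 + κ • P := by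
    have : gibbsShift P C (-γ) 0 = ∑ j, γ j • (P * C j 0 * P) := by
      simp [gibbsShift]
    rw [this, add_assoc, add_comm (∑ j, γ j • (P * C j 0 * P)), ← hκ]
    abel
  refine ⟨-γ, ?_⟩
  rw [← normalized_eq_gibbsOp hE hr hC hA (X := ρ) (κ := κ), hρ.2]
  · simp
  · rw [hρB, hBeq, hr.exp_add_smul_proj
      ((𝒩).add_mem (hA.mem 0) (gibbsShift_mem hE hr hC (-γ) 0).1), ← gibbsOp_eq hE hr hC hA]

include hE hr hC hA in
/-- Every state of the attractor space is a limit of normalized Gibbs operators along a ray of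
multipliers: the direction of the ray suppresses the complement of the support. -/
theorem exists_tendsto_gibbsOp {ρ : Op n} (hρ : IsDensity ρ) (hEρ : E ρ = ρ) :
    ∃ γ η : Fin d → ℝ, Filter.Tendsto (fun s : ℝ =>
      (partitionFunction D σ P C (γ + s • η))⁻¹ • D.gibbsOp σ P C (γ + s • η) 0)
      Filter.atTop (𝓝 ρ) := by
  obtain ⟨a, ha, hapos, hρa⟩ := hr.exists_posSemidef_eq_mul_reference hρ.1 hEρ
  obtain ⟨Q, hQ, K, hK, hQh, hQQ, hKh, hKQ, haQ, hexp, -, -⟩ := hr.exists_log ha hapos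
  obtain ⟨κ₀, γ, hγ⟩ := hE.exists_eq_sum_compressed hr hC 0 (hKh.sub (hA.isHermitian 0))
    ((𝒩).sub_mem hK (hA.mem 0))
  obtain ⟨κ₁, η, hη⟩ := hE.exists_eq_sum_compressed hr hC 0 (hQh.sub hr.isHermitian)
    ((𝒩).sub_mem hQ hr.proj_mem)
  set R := P - Q with hR
  have hRmem : R ∈ 𝒩 := (𝒩).sub_mem hr.proj_mem hQ
  have hRh : R.IsHermitian := hr.isHermitian.sub hQh
  have hRR : R * R = R := by
    simp only [hR, Matrix.mul_sub, Matrix.sub_mul, hr.mul_self, hQQ, hr.mul_proj_of_mem hQ,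
      hr.proj_mul_of_mem hQ]
    abel
  have haR : a * R = 0 := by rw [hR, Matrix.mul_sub, haQ, hr.mul_proj_of_mem ha, sub_self]
  have hKR : K * R = 0 := by rw [hR, Matrix.mul_sub, hKQ, hr.mul_proj_of_mem hK, sub_self]
  have hRK : R * K = 0 := by
    have := congrArg Matrix.conjTranspose hKR
    rwa [Matrix.conjTranspose_mul, hRh.eq, hKh.eq, Matrix.conjTranspose_zero] at this
  -- the unnormalized state with exponent `K - s R`
  set N : ℝ → Op n := fun s => (a + Real.exp (-s) • R) * E P with hN
  have hNexp : ∀ s : ℝ, P * NormedSpace.exp (K + (-s) • R) * E P = N s := by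
    intro s
    have hcomm : Commute K ((-s) • R) := Commute.smul_right (hKR.trans hRK.symm) (-s)
    have h1 : P * NormedSpace.exp K = a + R := by
      rw [hexp, Matrix.mul_add, Matrix.mul_sub, hr.proj_mul_of_mem ha, hr.proj_mul_of_mem hQ,
        Matrix.mul_one]
    -- `a` lives on `Q`, where `exp (-s R)` is the identity
    have h2 : a * NormedSpace.exp ((-s) • R) = a := by
      have h3 := exp_mul_compl (hRh.real_smul (-s)) (P := R)
        (by rw [Matrix.smul_mul, hRR]) (by rw [Matrix.mul_smul, hRR])
      have h4 : Commute (NormedSpace.exp ((-s) • R)) (1 - R) :=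
        (Commute.one_right _).sub_right (exp_commute ((Commute.refl R).smul_left (-s)))
      rw [h4.eq] at h3
      have h5 : a * (1 - R) = a := by rw [Matrix.mul_sub, haR]; simp
      nth_rw 1 [← h5]
      rw [Matrix.mul_assoc, h3, h5]
    rw [Matrix.exp_add_of_commute _ _ hcomm, ← Matrix.mul_assoc, h1, Matrix.add_mul, h2,
      mul_exp_smul_proj hRh hRR]
  have hNgibbs : ∀ s : ℝ, ((N s).trace.re)⁻¹ • N s =
      (partitionFunction D σ P C (-γ + s • -η))⁻¹ • D.gibbsOp σ P C (-γ + s • -η) 0 := by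
    intro s
    refine normalized_eq_gibbsOp hE hr hC hA (κ := κ₀ + s * κ₁) ?_
    rw [gibbsOp_eq hE hr hC hA, ← hr.exp_add_smul_proj
      ((𝒩).add_mem (hA.mem 0) (gibbsShift_mem hE hr hC _ 0).1), ← hNexp]
    congr 3
    have h1 : gibbsShift P C (-γ + s • -η) 0 =
        (∑ j, γ j • (P * C j 0 * P)) + s • ∑ j, η j • (P * C j 0 * P) := by
      simp only [gibbsShift, Pi.add_apply, Pi.neg_apply, Pi.smul_apply, smul_eq_mul, add_smul,
        Finset.sum_add_distrib, neg_smul, mul_neg, Finset.sum_neg_distrib, Finset.smul_sum,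
        smul_smul]
      abel
    have h2 : (∑ j, γ j • (P * C j 0 * P)) = K - A 0 - κ₀ • P := by rw [hγ]; abel
    have h3 : (∑ j, η j • (P * C j 0 * P)) = Q - P - κ₁ • P := by rw [hη]; abel
    rw [h1, h2, h3, hR]
    module
  refine ⟨-γ, -η, ?_⟩
  simp only [← hNgibbs]
  have hNlim : Filter.Tendsto N Filter.atTop (𝓝 ρ) := by
    have h1 : Filter.Tendsto (fun s : ℝ => Real.exp (-s)) Filter.atTop (𝓝 0) :=
      Real.tendsto_exp_neg_atTop_nhds_zero
    have h2 := ((h1.smul_const R).const_add a).mul_const (E P)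
    rwa [zero_smul, add_zero, ← hρa] at h2
  have htr : Filter.Tendsto (fun s => ((N s).trace.re)⁻¹) Filter.atTop (𝓝 1) := by
    have hc : Continuous fun X : Op n => X.trace.re := by fun_prop
    have h1 := hc.continuousAt.tendsto.comp hNlim
    rw [hρ.2, Complex.one_re] at h1
    simpa using h1.inv₀ one_ne_zero
  simpa using htr.smul hNlim

end Gibbs

end QMP

/-! ### The minimum relative entropy principle -/

theorem theorem1 {n : Type*} [Fintype n] [DecidableEq n] (D : QMP n)
    (P : Op n) (hP : D.IsTProjector P)
    (σ : D.Time → Op n) (hσ : D.IsTTrajectory P σ)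
    {d : ℕ} (C : Fin d → D.Time → Op n) (hC : D.IsBasisOfConstants C) :
    ∃ (Γ : (Fin d → ℝ) → (Fin d → ℝ)) (Z : (Fin d → ℝ) → ℝ),
      (∀ γ, 0 < Z γ ∧ ∀ t, (D.gibbsOp σ P C γ t).trace = (Z γ : ℂ)) ∧
      ∀ ρ₀, IsDensity ρ₀ →
        ∀ c : Fin d → ℝ, (∀ j t, (C j t * D.prop t ρ₀).trace = (c j : ℂ)) →
          ∃ ρ : D.Time → Op n,
            D.IsAsymptoticTrajectory ρ₀ ρ ∧
            Filter.Tendsto (fun t => D.prop t ρ₀ - ρ t) Filter.atTop (𝓝 0) ∧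
            (∀ t, D.IsUniqueMinimizer C c t (σ t) (ρ t)) ∧
            (D.IsTTrajectory P ρ →
              ∀ t γ, ρ t = (Z γ)⁻¹ • D.gibbsOp σ P C γ t ↔ γ = Γ c) ∧
            (∃ γ η : Fin d → ℝ, ∀ t,
              Filter.Tendsto (fun s : ℝ => (Z (γ + s • η))⁻¹ • D.gibbsOp σ P C (γ + s • η) t)
                Filter.atTop (𝓝 (ρ t))) := by
  classical
  obtain ⟨E, U, hE⟩ := D.exists_isAsymptoticProjection
  obtain ⟨τ, hr, hτ⟩ := hE.exists_isRecurrentProjection hP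
  obtain ⟨A, hA⟩ := QMP.IsTTrajectory.exists_isReducedLog hE hr hσ
  set Z := QMP.partitionFunction D σ P C with hZ
  set G : (Fin d → ℝ) → Op n := fun γ => (Z γ)⁻¹ • D.gibbsOp σ P C γ 0 with hG
  have hZpos := QMP.partitionFunction_pos hE hr hC hA
  have hGtr : ∀ γ, (G γ).trace = 1 := fun γ => by
    rw [hG]
    simp only
    rw [Matrix.trace_smul, (hZpos γ).2, Complex.real_smul, ← Complex.ofReal_mul,
      inv_mul_cancel₀ (hZpos γ).1.ne', Complex.ofReal_one]
  have hGE : ∀ γ, E (G γ) = G γ := fun γ => by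
    simp only [hG, LinearMap.map_smul_of_tower, QMP.gibbsOp_mem hE hr hC hA]
  have hGt : ∀ γ t, D.prop t (G γ) = (Z γ)⁻¹ • D.gibbsOp σ P C γ t := fun γ t => by
    simp only [hG, LinearMap.map_smul_of_tower, QMP.prop_gibbsOp hE hr hτ hC hA]
  -- the multipliers of the normalized Gibbs operator with expectation values `c` at time `0`, where
  -- there is one; on other values `Γ` is irrelevant
  let Γ : (Fin d → ℝ) → Fin d → ℝ := fun c =>
    if h : ∃ γ, ∀ j, (C j 0 * G γ).trace = (c j : ℂ) then h.choose else 0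
  have hΓ : ∀ c γ, (∀ j, (C j 0 * G γ).trace = (c j : ℂ)) → γ = Γ c := by
    intro c γ h
    have hex : ∃ γ, ∀ j, (C j 0 * G γ).trace = (c j : ℂ) := ⟨γ, h⟩
    simp only [Γ, dif_pos hex]
    refine QMP.gibbsOp_injective hE hr hC hA ?_
    have h1 := QMP.apply_eq_of_expectations hE hC 0 ((hGtr γ).trans (hGtr hex.choose).symm)
      fun j => (h j).trans (hex.choose_spec j).symm
    rwa [hGE, hGE] at h1
  refine ⟨Γ, Z, fun γ => ⟨(hZpos γ).1, fun t => ?_⟩, fun ρ₀ hρ₀ c hc => ?_⟩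
  · rw [← QMP.prop_gibbsOp hE hr hτ hC hA, (D.prop_isSchwarzChannel t).trace_map, (hZpos γ).2]
  have hst := hE.isSchwarzChannel.map_conjTranspose
  have hρd := hE.trajectory_isDensity hρ₀
  have hρE := hE.apply_trajectory ρ₀
  have hρ0 : D.prop 0 (E ρ₀) = E ρ₀ := by rw [D.prop_zero]
  have hρc : ∀ j t, (C j t * D.prop t (E ρ₀)).trace = (c j : ℂ) := fun j t => by
    rw [← hc j t, ← hE.apply_prop, Matrix.trace_mul_comm, trace_mul_hsAdjoint hst,
      hE.adjoint_constant (hC.mem j), Matrix.trace_mul_comm]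
  have hρc0 : ∀ j, (C j 0 * E ρ₀).trace = (c j : ℂ) := fun j => by
    rw [← hρc j 0, hρ0]
  refine ⟨fun t => D.prop t (E ρ₀), hE.isAsymptoticTrajectory ρ₀, hE.tendsto_prop_sub ρ₀,
    fun t => ⟨⟨hρd t, fun j => hρc j t⟩, fun ω hω hωc hne => ?_⟩, fun hT t γ => ?_, ?_⟩
  · obtain ⟨σ₀, hσ₀, htraj⟩ := hσ.1
    have hσt := hE.eq_prop_of_isAsymptoticTrajectory htraj t
    refine hr.relEntropy_lt ?_ ?_ (hσ.2 t) (hρd t) hω ?_ hne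
    · rw [hσt]
      exact (hE.trajectory_isDensity hσ₀ t).1
    · rw [hσt, hE.apply_trajectory]
    · rw [QMP.apply_eq_of_expectations hE hC t (hω.2.trans (hρd t).2.symm)
        fun j => (hωc j).trans (hρc j t).symm, hρE]
  · constructor
    -- the evolution is injective on the attractor space, which brings the question to time `0`
    · intro h
      refine hΓ c γ fun j => ?_
      have h1 : D.prop t (E ρ₀ - G γ) = 0 := by rw [map_sub, hGt, ← h, sub_self]
      have h2 := hE.eq_zero_of_prop_eq_zero (by rw [map_sub, hE.idem, hGE]) h1
      rw [← sub_eq_zero.1 h2, hρc0]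
    · rintro rfl
      obtain ⟨γ, hγ⟩ := QMP.exists_eq_gibbsOp hE hr hC hA (hE.isSchwarzChannel.isDensity hρ₀)
        (hE.idem ρ₀) (by rw [← hT.2 0]; simp only [hρ0])
      have hγΓ := hΓ c γ fun j => by rw [← hρc0 j, hγ]
      rw [← hγΓ, ← hGt, hγ]
  · obtain ⟨γ, η, h⟩ := QMP.exists_tendsto_gibbsOp hE hr hC hA
      (hE.isSchwarzChannel.isDensity hρ₀) (hE.idem ρ₀)
    refine ⟨γ, η, fun t => ?_⟩
    have hcont := LinearMap.continuous_of_finiteDimensional (D.prop t)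
    have h1 := (hcont.tendsto _).comp h
    refine h1.congr fun s => hGt (γ + s • η) t
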